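/- \textbf{Setting.} A function $F:[0,\infty)^4\to[0,\infty)$ is \emph{permissible} if it is nondecreasing for the componentwise order and $x\,l_y+y\,l_x\le F(x,y,l_x,l_y)$ for all $x,y,l_x,l_y\ge 0$. It is \emph{strongly permissible} if moreover it is continuous and $\lambda\mu F(x,y,l_x,l_y)\le F(\lambda x,\mu y,\lambda l_x,\mu l_y)$ for all $x,y,l_x,l_y,\lambda,\mu\ge 0$. An \emph{$F$-quasi-Leibniz quantum compact metric space} $(\mathfrak A,\mathsf L)$ is a nonzero unital C*-algebra $\mathfrak A$ with a seminorm $\mathsf L$ defined on a dense Jordan-Lie subalgebra $\mathrm{dom}(\mathsf L)$ of the self-adjoint part $\mathfrak{sa}(\mathfrak A)$ (and extended by $\mathsf L=\infty$ outside $\mathrm{dom}(\mathsf L)$) such that: $\mathsf L(a)=0$ if and only if $a\in\mathbb R1_{\mathfrak A}$; the set $\{a\in\mathfrak{sa}(\mathfrak A):\mathsf L(a)\le 1\}$ is norm closed; the Monge-Kantorovich metric $\mathrm{mk}_{\mathsf L}(\varphi,\psi)=\sup\{|\varphi(a)-\psi(a)|: a\in\mathfrak{sa}(\mathfrak A),\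 \mathsf L(a)\le 1\}$ induces the weak* topology of the state space $\mathscr S(\mathfrak A)$; and $\mathsf L\big(\tfrac{ab+ba}{2}\big)$ and $\mathsf L\big(\tfrac{ab-ba}{2i}\big)$ are at most $F(\|a\|,\|b\|,\mathsf L(a),\mathsf L(b))$ for all $a,b\in\mathrm{dom}(\mathsf L)$. Its diameter $\mathrm{diam}(\mathfrak A,\mathsf L)$ is the diameter of $\mathscr S(\mathfrak A)$ for $\mathrm{mk}_{\mathsf L}$. Two such spaces are \emph{isometrically isomorphic} if there is a unital *-isomorphism between the algebras whose dual map is an isometry of the state spaces for the Monge-Kantorovich metrics. An \emph{$F$-tunnel} from $(\mathfrak A_1,\mathsf L_1)$ to $(\mathfrak A_2,\mathsf L_2)$ is an $F$-quasi-Leibniz quantum compact metric space $(\mathfrak D,\mathsf L_{\mathfrak D})$ with *-epimorphisms $\pi_j:\mathfrak D\to\mathfrak A_j$ such that $\mathsf L_j(a)=\inf\{\mathsf L_{\mathfrak D}(d): d\in\mathfrak{sa}(\mathfrak D),\ \pi_j(d)=a\}$ for all $a\in\mathfrak{sa}(\mathfrak A_j)$, $j=1,2$. Its \emph{extent} is the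 maximum over $j=1,2$ of the Hausdorff distance, for $\mathrm{mk}_{\mathsf L_{\mathfrak D}}$, between $\mathscr S(\mathfrak D)$ and $\{\varphi\circ\pi_j:\varphi\in\mathscr S(\mathfrak A_j)\}$. The \emph{dual propinquity} $\Lambda_F$ between two $F$-quasi-Leibniz quantum compact metric spaces is the infimum of the extents of all $F$-tunnels between them. The class of all $F$-quasi-Leibniz quantum compact metric spaces is endowed with the topology induced by $\Lambda_F$ (a set is open if it contains a $\Lambda_F$-ball of positive radius around each of its points). For $\varepsilon>0$, the \emph{covering number} $\mathrm{cov}_F(\mathfrak A,\mathsf L\,|\,\varepsilon)\in\mathbb N\cup\{\infty\}$ is the least $n\in\mathbb N$ for which there is an $F$-quasi-Leibniz quantum compact metric space $(\mathfrak B,\mathsf L_{\mathfrak B})$ with $\dim_{\mathbb C}\mathfrak B\le n$ and $\Lambda_F((\mathfrak A,\mathsf L),(\mathfrak B,\mathsf L_{\mathfrak B}))\le\varepsilon$, with $\min\emptyset=\infty$. \textbf{Statement.} Let $F$ be strongly permissible, and let $\mathcal A$ be a class of $F$-quasi-Leibniz quantum compact metric spaces contained in the closure, for $\Lambda_F$,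 of the class of all $F$-quasi-Leibniz quantum compact metric spaces $(\mathfrak B,\mathsf L_{\mathfrak B})$ with $\dim_{\mathbb C}\mathfrak B<\infty$. Then $\mathcal A$ is compact for $\Lambda_F$ if and only if there exist a function $f:(0,\infty)\to\mathbb N$ and a real $K>0$ such that: \begin{enumerate} \item $\mathrm{diam}(\mathfrak A,\mathsf L)\le K$ for all $(\mathfrak A,\mathsf L)\in\mathcal A$; \item $\mathrm{cov}_F(\mathfrak A,\mathsf L\,|\,\varepsilon)\le f(\varepsilon)$ for all $(\mathfrak A,\mathsf L)\in\mathcal A$ and all $\varepsilon>0$; \item $\mathcal A$ is closed for $\Lambda_F$ up to isometric isomorphism, that is, the class of all $F$-quasi-Leibniz quantum compact metric spaces isometrically isomorphic to a member of $\mathcal A$ is closed for $\Lambda_F$. \end{enumerate} -/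

import Mathlib

open scoped NNReal ENNReal ComplexOrder

universe u

namespace QuasiLeibniz

noncomputable section

/-! ### Extended distance functions -/

/-- The topology induced by a `[0, ∞]`-valued distance function `d`: a set is open when it contains
a `d`-ball of positive radius around each of its points. (For a pseudometric this is its usual
topology.) -/
@[reducible]
def ballTopology {X : Type*} (d : X → X → ℝ≥0∞) : TopologicalSpace X where
  IsOpen U := ∀ x ∈ U, ∃ ε : ℝ≥0∞, 0 < ε ∧ ∀ y, d x y < ε → y ∈ U
  isOpen_univ := fun _ _ => ⟨1, one_pos, fun _ _ => trivial⟩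
  isOpen_inter := by
    intro U V hU hV x hx
    obtain ⟨ε, hε, hεU⟩ := hU x hx.1
    obtain ⟨δ, hδ, hδV⟩ := hV x hx.2
    exact ⟨min ε δ, lt_min hε hδ, fun y hy =>
      ⟨hεU y (hy.trans_le (min_le_left _ _)), hδV y (hy.trans_le (min_le_right _ _))⟩⟩
  isOpen_sUnion := by
    intro S hS x hx
    obtain ⟨U, hUS, hxU⟩ := hx
    obtain ⟨ε, hε, h⟩ := hS U hUS x hxU
    exact ⟨ε, hε, fun y hy => ⟨U, hUS, h y hy⟩⟩

/-- The Hausdorff distance of two subsets, for a `[0, ∞]`-valued distance function `d`. -/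
def hausdorff {X : Type*} (d : X → X → ℝ≥0∞) (S T : Set X) : ℝ≥0∞ :=
  max (⨆ x ∈ S, ⨅ y ∈ T, d x y) (⨆ y ∈ T, ⨅ x ∈ S, d x y)

/-! ### States, Jordan and Lie products -/

/-- The states of a unital C*-algebra: the positive unital linear functionals, with the weak*
topology (the subspace topology of `WeakDual ℂ A`). -/
abbrev StateSpace (A : Type u) [CStarAlgebra A] : Type u :=
  {φ : WeakDual ℂ A // φ 1 = 1 ∧ ∀ a : A, 0 ≤ φ (star a * a)}

/-- The Jordan product `(ab + ba) / 2` of two self-adjoint elements. -/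
def jordan {A : Type u} [CStarAlgebra A] (a b : selfAdjoint A) : selfAdjoint A :=
  ⟨(1 / 2 : ℂ) • ((a : A) * b + b * a), by
    have ha : star (a : A) = a := a.2
    have hb : star (b : A) = b := b.2
    simp [selfAdjoint.mem_iff, star_smul, ha, hb, add_comm]⟩

/-- The Lie product `(ab - ba) / (2i)` of two self-adjoint elements. -/
def lie {A : Type u} [CStarAlgebra A] (a b : selfAdjoint A) : selfAdjoint A :=
  ⟨(1 / (2 * Complex.I) : ℂ) • ((a : A) * b - b * a), by
    have ha : star (a : A) = a := a.2
    have hb : star (b : A) = b := b.2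
    rw [selfAdjoint.mem_iff, star_smul, star_sub, star_mul, star_mul, ha, hb,
      ← neg_sub, smul_neg, ← neg_smul]
    congr 1
    simp⟩

/-- The map `π^* : φ ↦ φ ∘ π` from the states of `B` to the states of `A`. -/
def pullback {A B : Type u} [CStarAlgebra A] [CStarAlgebra B] (π : A →⋆ₐ[ℂ] B)
    (φ : StateSpace B) : StateSpace A :=
  ⟨StrongDual.toWeakDual
      ((WeakDual.toStrongDual φ.1).comp ⟨(π : A →ₐ[ℂ] B).toLinearMap,
        haveI := NonUnitalStarAlgHom.instContinuousLinearMapClassComplex (F := A →⋆ₐ[ℂ] B)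
        map_continuous π⟩), by
    refine ⟨?_, fun a => ?_⟩
    · change φ.1 (π 1) = 1
      rw [map_one]; exact φ.2.1
    · change 0 ≤ φ.1 (π (star a * a))
      rw [map_mul, map_star]; exact φ.2.2 _⟩

/-- The Monge-Kantorovich metric on the state space associated with `L`. -/
def mongeKantorovich {A : Type u} [CStarAlgebra A] (L : selfAdjoint A → ℝ≥0∞)
    (φ ψ : StateSpace A) : ℝ≥0∞ :=
  ⨆ (a : selfAdjoint A) (_ : L a ≤ 1), ‖φ.1 (a : A) - ψ.1 (a : A)‖ₑ

/-! ### Permissible functions -/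

/-- Permissible functions `[0, ∞)⁴ → [0, ∞)`; the order on the product is the componentwise one. -/
structure Permissible (F : ℝ≥0 × ℝ≥0 × ℝ≥0 × ℝ≥0 → ℝ≥0) : Prop where
  mono : Monotone F
  le_apply : ∀ x y lx ly : ℝ≥0, x * ly + y * lx ≤ F (x, y, lx, ly)

structure StronglyPermissible (F : ℝ≥0 × ℝ≥0 × ℝ≥0 × ℝ≥0 → ℝ≥0) : Prop extends
    Permissible F where
  continuous : Continuous F
  mul_le : ∀ x y lx ly s t : ℝ≥0, s * t * F (x, y, lx, ly) ≤ F (s * x, t * y, s * lx, t * ly)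

/-! ### Quasi-Leibniz quantum compact metric spaces -/

/-- `F`-quasi-Leibniz quantum compact metric spaces `(A, L)`, with `A` a nonzero unital C*-algebra.
The seminorm `L` is extended to all self-adjoint elements by the value `∞` off its domain, so that
its domain is `{a | L a < ∞}`, a real subspace by `L_add` and `L_smul` (with `0 * ∞ = 0`), and a
Jordan-Lie subalgebra by `L_jordan` and `L_lie`. -/
structure Space (F : ℝ≥0 × ℝ≥0 × ℝ≥0 × ℝ≥0 → ℝ≥0) : Type (u + 1) where
  carrier : Type u
  [cstar : CStarAlgebra carrier]
  [nontriv : Nontrivial carrier]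
  L : selfAdjoint carrier → ℝ≥0∞
  L_add : ∀ a b, L (a + b) ≤ L a + L b
  L_smul : ∀ (t : ℝ) a, L (t • a) = ‖t‖ₑ * L a
  dense_dom : Dense {a | L a < ⊤}
  L_eq_zero : ∀ a, L a = 0 ↔ ∃ t : ℝ, a = t • (1 : selfAdjoint carrier)
  isClosed_unitBall : IsClosed {a | L a ≤ 1}
  mk_lt_top : ∀ φ ψ : StateSpace carrier, mongeKantorovich L φ ψ < ⊤
  mk_topology : ballTopology (mongeKantorovich L) =
    (inferInstance : TopologicalSpace (StateSpace carrier))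
  L_jordan : ∀ a b, L a < ⊤ → L b < ⊤ →
    L (jordan a b) ≤ F (‖(a : carrier)‖₊, ‖(b : carrier)‖₊, (L a).toNNReal, (L b).toNNReal)
  L_lie : ∀ a b, L a < ⊤ → L b < ⊤ →
    L (lie a b) ≤ F (‖(a : carrier)‖₊, ‖(b : carrier)‖₊, (L a).toNNReal, (L b).toNNReal)

attribute [instance] Space.cstar Space.nontriv

variable {F : ℝ≥0 × ℝ≥0 × ℝ≥0 × ℝ≥0 → ℝ≥0}

/-- The Monge-Kantorovich metric of a space. -/
def Space.kantorovich (X : Space.{u} F) (φ ψ : StateSpace X.carrier) : ℝ≥0∞ := mongeKantorovich X.L φ ψ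

/-- The diameter of the state space for the Monge-Kantorovich metric. -/
def Space.diam (X : Space.{u} F) : ℝ≥0∞ := ⨆ (φ : StateSpace X.carrier) (ψ), X.kantorovich φ ψ

/-- Isometric isomorphism: there is a unital *-isomorphism whose dual map is an isometry of the
state spaces (it is automatically onto). -/
def Isometric (X Y : Space.{u} F) : Prop :=
  ∃ π : X.carrier ≃⋆ₐ[ℂ] Y.carrier, ∀ φ ψ : StateSpace Y.carrier,
    X.kantorovich (pullback (π : X.carrier →⋆ₐ[ℂ] Y.carrier) φ)
      (pullback (π : X.carrier →⋆ₐ[ℂ] Y.carrier) ψ) = Y.kantorovich φ ψ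

/-! ### Tunnels and the dual propinquity -/

/-- `F`-tunnels from `X` to `Y`. -/
structure Tunnel (X Y : Space.{u} F) : Type (u + 1) where
  D : Space.{u} F
  π₁ : D.carrier →⋆ₐ[ℂ] X.carrier
  π₂ : D.carrier →⋆ₐ[ℂ] Y.carrier
  surj₁ : Function.Surjective π₁
  surj₂ : Function.Surjective π₂
  quotient₁ : ∀ a : selfAdjoint X.carrier,
    X.L a = ⨅ (d : selfAdjoint D.carrier) (_ : π₁ d = a), D.L d
  quotient₂ : ∀ a : selfAdjoint Y.carrier,
    Y.L a = ⨅ (d : selfAdjoint D.carrier) (_ : π₂ d = a), D.L d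

/-- The extent of a tunnel. -/
def Tunnel.extent {X Y : Space.{u} F} (τ : Tunnel X Y) : ℝ≥0∞ :=
  max (hausdorff τ.D.kantorovich Set.univ (Set.range (pullback τ.π₁)))
    (hausdorff τ.D.kantorovich Set.univ (Set.range (pullback τ.π₂)))

/-- The dual propinquity on the class of all `F`-quasi-Leibniz quantum compact metric spaces,
using all `F`-tunnels. -/
def propinquity (X Y : Space.{u} F) : ℝ≥0∞ := ⨅ τ : Tunnel X Y, τ.extent

/-- The class of all spaces carries the topology induced by the dual propinquity. -/
instance : TopologicalSpace (Space.{u} F) := ballTopology propinquity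

/-- The class of spaces of finite dimension. -/
def finiteDimensionalSpaces (F : ℝ≥0 × ℝ≥0 × ℝ≥0 × ℝ≥0 → ℝ≥0) : Set (Space.{u} F) :=
  {X | FiniteDimensional ℂ X.carrier}

/-- The covering number, which is `∞` when no approximation by a finite dimensional space exists. -/
def coveringNumber (X : Space.{u} F) (ε : ℝ) : ℕ∞ :=
  ⨅ (n : ℕ) (_ : ∃ Y : Space.{u} F, Module.rank ℂ Y.carrier ≤ n ∧
    propinquity X Y ≤ ENNReal.ofReal ε), (n : ℕ∞)

/-- The class of all spaces that are isometrically isomorphic to a member of `𝒜`. -/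
def isometryHull (𝒜 : Set (Space.{u} F)) : Set (Space.{u} F) := {X | ∃ Y ∈ 𝒜, Isometric Y X}

end

end QuasiLeibniz

/-!
The extent of a tunnel is awkward to handle through states. The Hahn-Banach theorem turns it into a
norm estimate: the extent is at most `r` exactly when `‖d‖ ≤ ‖πⱼ(d)‖ + r L(d)` for every self-adjoint
`d` and `j = 1, 2` (`Space.hausdorff_le_iff`). Likewise, the condition that the Monge-Kantorovich
metric induces the weak* topology holds exactly when the unit ball of the seminorm is totally
bounded up to scalars (`mk_of_totallyBounded`, `Space.exists_totallyBounded`). Consequently the sets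
`{L ≤ l, ‖·‖ ≤ R}` are compact, and the infima that define quotient seminorms are attained
(`Space.exists_lift`). After these two reformulations states are hardly needed, and the theorem
becomes the statement that a class is compact if and only if it is totally bounded and complete, in
a complete pseudometric space.

* The propinquity is a pseudometric. For the triangle inequality, tunnels `D₁` from `X` to `Y` and
  `D₂` from `Y` to `Z` are glued along `Y`: their direct sum carries the seminorm
  `max (L(d₁), L(d₂), ‖π₂(d₁) - ρ₁(d₂)‖ / ε)`, which is quasi-Leibniz because
  `x l_y + y l_x ≤ F(x, y, l_x, l_y)` (`bridge`, `propinquity_triangle`).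
* Two spaces are at distance zero if and only if they are isometrically isomorphic
  (`Isometric.propinquity_eq_zero`, `isometric_of_propinquity_eq_zero`). Given tunnels of vanishing
  extents, the pairs of limits along an ultrafilter of the two images of a bounded sequence `dₙ` form
  a Jordan-Lie algebra of pairs of elements of equal norms. The C*-algebra that it generates is the
  graph of a *-isomorphism.
* The propinquity is complete (`Chain.exists_limit`, `completeSpace_propinquity`). For tunnels `Dₙ`
  from `Xₙ` to `Xₙ₊₁` of summable extents, the sequences `dₖ ∈ Dₖ`, `k ≥ n`, of bounded seminorm whose
  consecutive terms agree in the space between them generate a quantum compact metric space. It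
  projects to `Xₙ`, and to the limit: the quotient of the space for `n = 0` by the C*-seminorm
  `lim ‖dₖ‖`. Hence it is a tunnel from `Xₙ` to the limit, with extent at most the sum of the remaining
  extents. The quasi-Leibniz inequality of the limit involves the limit of the norms of the tails,
  and that is where continuity of `F` is used.
* The class of spaces of dimension at most `N` and diameter at most `K` is totally bounded
  (`exists_finite_code`). By the Gelfand-Naimark-Segal construction for a faithful functional, such
  spaces are represented in finitely many matrix algebras. There, a space is determined up to `ε` by
  the points of a finite net that its truncated unit ball approaches. With the bound of the covering
  numbers and the Lipschitz property of the diameter (`diam_le_add`), a class satisfying the first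
  two conditions is totally bounded (`totallyBounded_of_coveringNumber`).

Finally, a set and its isometry hull have the same closure and are compact together, since
compactness does not distinguish points at distance zero (`isClosed_isometryHull`,
`isCompact_of_isCompact_isometryHull`).
-/

universe v

namespace QuasiLeibniz

noncomputable section

open scoped ComplexStarModule
open Filter Topology

/-! ### States of a C*-algebra -/

section States

variable {A B : Type u} [CStarAlgebra A] [CStarAlgebra B]

instance : CompleteSpace (selfAdjoint A) :=
  (isClosed_eq continuous_star continuous_id : IsClosed {a : A | star a = a}).completeSpace_coe

theorem norm_selfAdjoint_one [Nontrivial A] : ‖(1 : selfAdjoint A)‖ = 1 := by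
  change ‖((1 : selfAdjoint A) : A)‖ = 1
  simp

/-- The elements `t ± a` are positive when `‖a‖ ≤ t`. -/
theorem exists_sqrt_of_norm_sub_le {a : A} (ha : IsSelfAdjoint a) (t : ℝ) (h : ‖a‖ ≤ t) (s : ℝ)
    (hs : s = 1 ∨ s = -1) : ∃ b : A, (t : ℂ) • (1 : A) + (s : ℂ) • a = star b * b := by
  let _ := CStarAlgebra.spectralOrder A
  have _ := CStarAlgebra.spectralOrderedRing A
  have h1 : 0 ≤ (t : ℂ) • (1 : A) + (s : ℂ) • a := by
    have h2 := ha.le_algebraMap_norm_self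
    have h3 := ha.neg.le_algebraMap_norm_self
    have h4 : (algebraMap ℝ A) ‖a‖ ≤ algebraMap ℝ A t := by
      rw [← sub_nonneg, ← map_sub]
      rw [Algebra.algebraMap_eq_smul_one]
      exact smul_nonneg (sub_nonneg.2 h) zero_le_one
    have e : (t : ℂ) • (1 : A) = algebraMap ℝ A t := by
      rw [Algebra.algebraMap_eq_smul_one]; exact Complex.coe_smul t (1 : A)
    rw [e]
    rw [norm_neg] at h3
    rcases hs with rfl | rfl
    · simp only [Complex.ofReal_one, one_smul]
      have := h3.trans h4
      rwa [neg_le_iff_add_nonneg] at this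
    · simp only [Complex.ofReal_neg, Complex.ofReal_one, neg_smul, one_smul]
      rw [← sub_eq_add_neg, sub_nonneg]; exact h2.trans h4
  obtain ⟨b, hb⟩ := (CStarAlgebra.nonneg_iff_eq_star_mul_self).1 h1
  exact ⟨b, hb⟩

/-- The real linear functional on the self-adjoint part given by a state. -/
def stateRe (φ : StateSpace A) : selfAdjoint A →ₗ[ℝ] ℝ where
  toFun a := (φ.1 (a : A)).re
  map_add' a b := by simp
  map_smul' t a := by
    have : ((t • a : selfAdjoint A) : A) = (t : ℂ) • (a : A) := by
      rw [Complex.coe_smul]; rfl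
    rw [this, map_smul]; simp

theorem state_apply_one (φ : StateSpace A) : stateRe φ 1 = 1 := by
  change (φ.1 (1 : A)).re = 1
  rw [φ.2.1]; simp

/-- States are real on self-adjoint elements, as `‖a‖ + a` is positive. -/
theorem state_im (φ : StateSpace A) (a : selfAdjoint A) : (φ.1 (a : A)).im = 0 := by
  obtain ⟨b, hb⟩ := exists_sqrt_of_norm_sub_le a.2 ‖(a : A)‖ le_rfl 1 (Or.inl rfl)
  have := φ.2.2 b
  rw [← hb] at this
  have h := (Complex.le_def.1 this).2
  rw [map_add, map_smul, map_smul, φ.2.1] at h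
  simpa using h.symm

theorem state_apply (φ : StateSpace A) (a : selfAdjoint A) : φ.1 (a : A) = stateRe φ a :=
  Complex.ext rfl (by simpa using state_im φ a)

theorem abs_state_le (φ : StateSpace A) (a : selfAdjoint A) : |stateRe φ a| ≤ ‖a‖ := by
  have key : ∀ s : ℝ, (s = 1 ∨ s = -1) → 0 ≤ ‖a‖ + s * stateRe φ a := by
    intro s hs
    obtain ⟨b, hb⟩ := exists_sqrt_of_norm_sub_le a.2 ‖(a : A)‖ le_rfl s hs
    have := φ.2.2 b
    rw [← hb, map_add, map_smul, map_smul, φ.2.1, state_apply] at this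
    have h := (Complex.le_def.1 this).1
    simpa using h
  have h1 := key 1 (Or.inl rfl)
  have h2 := key (-1) (Or.inr rfl)
  rw [abs_le]; constructor <;> linarith

theorem enorm_state_sub (φ ψ : StateSpace A) (a : selfAdjoint A) :
    ‖φ.1 (a : A) - ψ.1 (a : A)‖ₑ = ENNReal.ofReal |stateRe φ a - stateRe ψ a| := by
  rw [state_apply, state_apply, ← Complex.ofReal_sub, ← ofReal_norm, Complex.norm_real,
    Real.norm_eq_abs]

/-- The positivity of a unital contractive functional: a real functional on the self-adjoint part
that is dominated by the norm and takes the value `1` at `1` is given by a state. -/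
theorem exists_state_of_le_norm [Nontrivial A] (f : selfAdjoint A →ₗ[ℝ] ℝ) (h1 : f 1 = 1)
    (hf : ∀ a, f a ≤ ‖a‖) : ∃ φ : StateSpace A, stateRe φ = f := by
  have habs : ∀ a, |f a| ≤ ‖a‖ := fun a => abs_le.2 ⟨by
    have := hf (-a); rw [map_neg, norm_neg] at this; linarith, hf a⟩
  let g : A →ₗ[ℂ] ℂ :=
    { toFun := fun x => (f (ℜ x) : ℂ) + Complex.I * f (ℑ x)
      map_add' := fun x y => by simp; ring
      map_smul' := fun c x => by
        have e1 : ℜ (c • x) = c.re • ℜ x - c.im • ℑ x := by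
          exact realPart_smul c x
        have e2 : ℑ (c • x) = c.re • ℑ x + c.im • ℜ x := by
          exact imaginaryPart_smul c x
        rw [e1, e2, map_sub, map_add, map_smul, map_smul, map_smul, map_smul]
        apply Complex.ext <;> simp }
  have gsa : ∀ a : selfAdjoint A, g (a : A) = f a := by
    intro a
    change (f (ℜ (a : A)) : ℂ) + Complex.I * f (ℑ (a : A)) = _
    rw [selfAdjoint.realPart_coe, selfAdjoint.imaginaryPart_coe]; simp
  have hb : ∀ x, ‖g x‖ ≤ 2 * ‖x‖ := by
    intro x
    calc ‖g x‖ ≤ ‖(f (ℜ x) : ℂ)‖ + ‖Complex.I * f (ℑ x)‖ := norm_add_le _ _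
      _ = |f (ℜ x)| + |f (ℑ x)| := by simp
      _ ≤ ‖ℜ x‖ + ‖ℑ x‖ := add_le_add (habs _) (habs _)
      _ ≤ ‖x‖ + ‖x‖ := add_le_add (realPart.norm_le x) (imaginaryPart.norm_le x)
      _ = 2 * ‖x‖ := by ring
  refine ⟨⟨StrongDual.toWeakDual (g.mkContinuous 2 hb), ?_, ?_⟩, ?_⟩
  · change g 1 = 1
    have := gsa 1
    rw [h1] at this; simpa using this
  · intro b
    change 0 ≤ g (star b * b)
    let p : selfAdjoint A := ⟨star b * b, IsSelfAdjoint.star_mul_self b⟩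
    have hp : g (star b * b) = f p := gsa p
    rw [hp]
    -- The distance of `‖p‖ • 1` to `p ≥ 0` is at most `‖p‖`.
    have hn : ‖(‖p‖ • (1 : selfAdjoint A) - p)‖ ≤ ‖p‖ := by
      let _ := CStarAlgebra.spectralOrder A
      have _ := CStarAlgebra.spectralOrderedRing A
      have h0 : (0 : A) ≤ p := star_mul_self_nonneg b
      have hle : (p : A) ≤ algebraMap ℝ A ‖(p : A)‖ := p.2.le_algebraMap_norm_self
      have : ‖(algebraMap ℝ A ‖(p : A)‖ - p)‖ ≤ ‖algebraMap ℝ A ‖(p : A)‖‖ :=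
        CStarAlgebra.norm_le_norm_of_nonneg_of_le (sub_nonneg.2 hle) (sub_le_self _ h0)
      rw [norm_algebraMap', norm_norm, Algebra.algebraMap_eq_smul_one] at this
      exact this
    have h2 := hf (‖p‖ • (1 : selfAdjoint A) - p)
    rw [map_sub, map_smul, h1, smul_eq_mul, mul_one] at h2
    have h3 : 0 ≤ f p := by linarith
    exact_mod_cast h3
  · ext a
    change (g (a : A)).re = f a
    rw [gsa]; simp

/-- The norm of a self-adjoint element is attained at a state: up to the sign `s` of an extreme point
of the spectrum, a norming functional of `‖a‖ + s a`, which has norm `2 ‖a‖`, takes the value `1`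
at `1`. -/
theorem exists_state_abs_eq_norm [Nontrivial A] (a : selfAdjoint A) :
    ∃ φ : StateSpace A, |stateRe φ a| = ‖a‖ := by
  have key : ∃ s : ℝ, (s = 1 ∨ s = -1) ∧ ‖(‖a‖ • (1 : selfAdjoint A) + s • a)‖ ≥ 2 * ‖a‖ := by
    have aux : ∀ s : ℝ, (s = 1 ∨ s = -1) → s * ‖(a : A)‖ ∈ spectrum ℝ (a : A) →
        ‖(‖a‖ • (1 : selfAdjoint A) + s • a)‖ ≥ 2 * ‖a‖ := by
      intro s hs h
      have h1 : ‖(a : A)‖ + s * (s * ‖(a : A)‖) ∈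
          spectrum ℝ (algebraMap ℝ A ‖(a : A)‖ + s • (a : A)) := by
        rw [add_comm ‖(a : A)‖, spectrum.add_mem_add_iff]
        have hu : s ≠ 0 := by rcases hs with rfl | rfl <;> norm_num
        have := (spectrum.smul_mem_smul_iff (a := (a : A)) (r := Units.mk0 s hu)
          (s := s * ‖(a : A)‖)).2 h
        simpa using! this
      have h2 := spectrum.norm_le_norm_of_mem h1
      have h3 : ‖(a : A)‖ + s * (s * ‖(a : A)‖) = 2 * ‖(a : A)‖ := by
        rcases hs with rfl | rfl <;> ring
      rw [h3, Real.norm_of_nonneg (by positivity), Algebra.algebraMap_eq_smul_one] at h2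
      exact h2
    rcases CStarAlgebra.norm_or_neg_norm_mem_spectrum (a := (a : A)) a.2 with h | h
    · exact ⟨1, Or.inl rfl, aux 1 (Or.inl rfl) (by simpa using h)⟩
    · exact ⟨-1, Or.inr rfl, aux (-1) (Or.inr rfl) (by simpa using h)⟩
  obtain ⟨s, hs, hn⟩ := key
  by_cases h0 : ‖a‖ = 0
  · obtain ⟨g, hg, hg'⟩ := exists_dual_vector ℝ (1 : selfAdjoint A)
      (by rw [norm_selfAdjoint_one]; exact one_ne_zero)
    obtain ⟨φ, hφ⟩ := exists_state_of_le_norm (g : selfAdjoint A →ₗ[ℝ] ℝ)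
      (by simpa [norm_selfAdjoint_one] using hg')
      (fun x => (le_abs_self _).trans (by simpa [hg] using g.le_opNorm x))
    exact ⟨φ, le_antisymm (abs_state_le _ _) (by rw [h0]; positivity)⟩
  have hpos : 0 < ‖a‖ := lt_of_le_of_ne (norm_nonneg _) (Ne.symm h0)
  obtain ⟨g, hg, hg'⟩ := exists_dual_vector ℝ (‖a‖ • (1 : selfAdjoint A) + s • a)
    (by intro h; rw [h] at hn; linarith)
  have hle : ∀ x, g x ≤ ‖x‖ := fun x => (le_abs_self _).trans (by simpa [hg] using g.le_opNorm x)
  rw [map_add, map_smul, map_smul] at hg'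
  simp only [smul_eq_mul, RCLike.ofReal_real_eq_id, id] at hg'
  have h1 : g 1 ≤ 1 := by simpa [norm_selfAdjoint_one] using hle 1
  have h2 : s * g a ≤ ‖a‖ := by
    have := hle (s • a)
    rw [map_smul, norm_smul] at this
    rcases hs with rfl | rfl <;> simpa using this
  have h3 : g 1 = 1 := by
    refine le_antisymm h1 ?_
    by_contra hlt
    push Not at hlt
    nlinarith
  obtain ⟨φ, hφ⟩ := exists_state_of_le_norm (g : selfAdjoint A →ₗ[ℝ] ℝ) h3 hle
  refine ⟨φ, le_antisymm (abs_state_le _ _) ?_⟩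
  rw [hφ]
  have h4 : ‖a‖ ≤ s * g a := by rw [h3] at hg'; linarith
  refine h4.trans ((le_abs_self _).trans ?_)
  rw [abs_mul]
  rcases hs with rfl | rfl <;> simp

instance [Nontrivial A] : Nonempty (StateSpace A) :=
  ⟨(exists_state_abs_eq_norm (1 : selfAdjoint A)).choose⟩

theorem norm_state_le (φ : StateSpace A) (x : A) : ‖φ.1 x‖ ≤ 2 * ‖x‖ := by
  have hx : φ.1 x = φ.1 ((ℜ x : selfAdjoint A) : A) + Complex.I * φ.1 ((ℑ x : selfAdjoint A) : A) := by
    conv_lhs => rw [← realPart_add_I_smul_imaginaryPart x]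
    rw [map_add, map_smul]; rfl
  rw [hx, state_apply, state_apply]
  calc _ ≤ ‖(stateRe φ (ℜ x) : ℂ)‖ + ‖Complex.I * stateRe φ (ℑ x)‖ := norm_add_le _ _
    _ = |stateRe φ (ℜ x)| + |stateRe φ (ℑ x)| := by simp
    _ ≤ ‖ℜ x‖ + ‖ℑ x‖ := add_le_add (abs_state_le _ _) (abs_state_le _ _)
    _ ≤ ‖x‖ + ‖x‖ := add_le_add (realPart.norm_le x) (imaginaryPart.norm_le x)
    _ = 2 * ‖x‖ := by ring

/-- The states form a weak* closed subset of a ball, and the Banach-Alaoglu theorem applies. -/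
instance : CompactSpace (StateSpace A) := by
  refine isCompact_iff_compactSpace.1 ?_
  refine (WeakDual.isCompact_closedBall (𝕜 := ℂ) (0 : StrongDual ℂ A) 2).of_isClosed_subset ?_ ?_
  · have h1 : IsClosed {φ : WeakDual ℂ A | φ 1 = 1} :=
      isClosed_eq (WeakDual.eval_continuous _) continuous_const
    have h2 : IsClosed {φ : WeakDual ℂ A | ∀ a : A, 0 ≤ φ (star a * a)} := by
      simp only [Set.ofPred_forall]
      exact isClosed_iInter fun a => isClosed_le continuous_const (WeakDual.eval_continuous _)
    exact h1.inter h2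
  · intro φ hφ
    simp only [Set.mem_preimage, mem_closedBall_zero_iff]
    exact ContinuousLinearMap.opNorm_le_bound _ (by norm_num) fun x => norm_state_le ⟨φ, hφ⟩ x

theorem stateRe_pullback (π : A →⋆ₐ[ℂ] B) (φ : StateSpace B) (a : selfAdjoint A)
    (b : selfAdjoint B) (h : π (a : A) = b) : stateRe (pullback π φ) a = stateRe φ b := by
  change (φ.1 (π (a : A))).re = (φ.1 (b : B)).re
  rw [h]

end States

/-! ### Extension of real functionals -/

/-- A form of the Hahn-Banach theorem for a functional `l` that is defined everywhere, but dominated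
by `N` on the subspace `W` only. -/
theorem exists_extension_of_le_sublinear_on {E : Type*} [AddCommGroup E] [Module ℝ E]
    (W : Submodule ℝ E) (l : E →ₗ[ℝ] ℝ) (N : E → ℝ)
    (N_hom : ∀ c : ℝ, 0 < c → ∀ x, N (c • x) = c * N x) (N_add : ∀ x y, N (x + y) ≤ N x + N y)
    (hl : ∀ x ∈ W, l x ≤ N x) :
    ∃ g : E →ₗ[ℝ] ℝ, (∀ x ∈ W, g x = l x) ∧ ∀ x, g x ≤ N x := by
  obtain ⟨g, hg, hg'⟩ := exists_extension_of_le_sublinear ⟨W, l.domRestrict W⟩ N N_hom N_add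
    (fun x => hl x x.2)
  exact ⟨g, fun x hx => hg ⟨x, hx⟩, hg'⟩

/-- A form of the Jordan decomposition: every bounded functional on the self-adjoint part vanishing
at `1` is a multiple of a difference of two states. It extends `(x + t, t - x) ↦ f x + c t`,
with `c` a bound of `f`, to a functional on pairs that is dominated by `c` times the maximum norm. -/
theorem exists_states_of_functional {A : Type u} [CStarAlgebra A] [Nontrivial A]
    (f : selfAdjoint A →ₗ[ℝ] ℝ) (h1 : f 1 = 0) (c : ℝ) (hc : 0 < c) (hf : ∀ a, f a ≤ c * ‖a‖) :
    ∃ φ ψ : StateSpace A, ∀ a, f a = c / 2 * (stateRe φ a - stateRe ψ a) := by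
  obtain ⟨φ0⟩ : Nonempty (StateSpace A) := inferInstance
  let N : selfAdjoint A × selfAdjoint A → ℝ := fun p => c * max ‖p.1‖ ‖p.2‖
  -- The pairs `(x + t, t - x)` are those with a scalar sum.
  let W : Submodule ℝ (selfAdjoint A × selfAdjoint A) :=
    { carrier := {p | ∃ t : ℝ, p.1 + p.2 = (2 * t) • (1 : selfAdjoint A)}
      zero_mem' := ⟨0, by simp⟩
      add_mem' := by
        rintro p q ⟨s, hs⟩ ⟨t, ht⟩
        refine ⟨s + t, ?_⟩
        have : (p + q).1 + (p + q).2 = (p.1 + p.2) + (q.1 + q.2) := by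
          simp only [Prod.fst_add, Prod.snd_add]; abel
        rw [this, hs, ht, ← add_smul]; ring_nf
      smul_mem' := by
        rintro r p ⟨t, ht⟩
        refine ⟨r * t, ?_⟩
        rw [Prod.smul_fst, Prod.smul_snd, ← smul_add, ht, smul_smul]; ring_nf }
  let l : selfAdjoint A × selfAdjoint A →ₗ[ℝ] ℝ :=
    (1 / 2 : ℝ) • (f.comp (LinearMap.fst ℝ _ _) - f.comp (LinearMap.snd ℝ _ _)) +
      (c / 2) • ((stateRe φ0).comp (LinearMap.fst ℝ _ _) + (stateRe φ0).comp (LinearMap.snd ℝ _ _))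
  have lapp : ∀ p, l p = 1 / 2 * (f p.1 - f p.2) + c / 2 * (stateRe φ0 p.1 + stateRe φ0 p.2) :=
    fun p => by simp [l]; ring
  obtain ⟨g, hgW, hgN⟩ := exists_extension_of_le_sublinear_on W l N
    (fun r hr p => by
      simp only [N, Prod.smul_fst, Prod.smul_snd, norm_smul, Real.norm_of_nonneg hr.le]
      rw [← mul_max_of_nonneg _ _ hr.le]; ring)
    (fun p q => by
      simp only [N, Prod.fst_add, Prod.snd_add]
      rw [← mul_add]
      refine mul_le_mul_of_nonneg_left ?_ hc.le
      exact max_le ((norm_add_le _ _).trans (add_le_add (le_max_left _ _) (le_max_left _ _)))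
        ((norm_add_le _ _).trans (add_le_add (le_max_right _ _) (le_max_right _ _))))
    (by
      rintro ⟨x, y⟩ ⟨t, ht⟩
      simp only at ht
      rw [lapp]
      obtain ⟨φ, hφ⟩ := exists_state_abs_eq_norm ((1 / 2 : ℝ) • (x - y))
      have e1 : ∀ θ : StateSpace A, stateRe θ x + stateRe θ y = 2 * t := fun θ => by
        rw [← map_add, ht, map_smul, state_apply_one]; simp
      have e2 : stateRe φ ((1 / 2 : ℝ) • (x - y)) = 1 / 2 * (stateRe φ x - stateRe φ y) := by
        rw [map_smul, map_sub]; rfl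
      have e3 : 1 / 2 * (f x - f y) ≤ c * ‖(1 / 2 : ℝ) • (x - y)‖ := by
        have := hf ((1 / 2 : ℝ) • (x - y))
        rwa [map_smul, map_sub, smul_eq_mul] at this
      have hx := abs_le.1 (abs_state_le φ x)
      have hy := abs_le.1 (abs_state_le φ y)
      have hmx := le_max_left ‖x‖ ‖y‖
      have hmy := le_max_right ‖x‖ ‖y‖
      have e4 : |1 / 2 * (stateRe φ x - stateRe φ y)| + t ≤ max ‖x‖ ‖y‖ := by
        have := e1 φ
        rcases abs_cases (1 / 2 * (stateRe φ x - stateRe φ y)) with ⟨h, -⟩ | ⟨h, -⟩ <;>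
          rw [h] <;> linarith [hx.2, hy.2]
      have e5 := e1 φ0
      rw [← e2, hφ] at e4
      simp only [N]
      have e6 := mul_le_mul_of_nonneg_left e4 hc.le
      rw [e5]; linarith)
  -- The components of the extension take the value `c / 2` at `1` and are dominated by `c / 2` times
  -- the norm, so that they are multiples of states.
  let g1 : selfAdjoint A →ₗ[ℝ] ℝ := g.comp (LinearMap.inl ℝ _ _)
  let g2 : selfAdjoint A →ₗ[ℝ] ℝ := g.comp (LinearMap.inr ℝ _ _)
  have hadd : ∀ x y, g (x, y) = g1 x + g2 y := fun x y => by
    simp only [g1, g2, LinearMap.comp_apply, LinearMap.inl_apply, LinearMap.inr_apply]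
    rw [← map_add]; simp
  have hdiff : ∀ x, g1 x - g2 x = f x := by
    intro x
    have h := hgW (x, -x) ⟨0, by simp⟩
    rw [hadd, lapp] at h
    simp only [map_neg] at h
    linarith
  have hs1 : g1 1 = c / 2 ∧ g2 1 = c / 2 := by
    have h := hgW (1, 1) ⟨1, by rw [mul_one, two_smul]⟩
    rw [hadd, lapp] at h
    simp only [state_apply_one] at h
    have := hdiff 1
    rw [h1] at this
    constructor <;> linarith
  have hN : ∀ x y, g1 x + g2 y ≤ c * max ‖x‖ ‖y‖ := fun x y => by
    have := hgN (x, y); rwa [hadd] at this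
  have hb : ∀ x, g1 x ≤ c / 2 * ‖x‖ ∧ g2 x ≤ c / 2 * ‖x‖ := by
    intro x
    have e : ‖(‖x‖ • (1 : selfAdjoint A))‖ = ‖x‖ := by
      rw [norm_smul, norm_selfAdjoint_one]; simp
    have h2 := hN x (‖x‖ • 1)
    have h3 := hN (‖x‖ • 1) x
    rw [e, max_self, map_smul, hs1.2] at h2
    rw [e, max_self, map_smul, hs1.1] at h3
    simp only [smul_eq_mul] at h2 h3
    constructor <;> linarith
  have mk : ∀ h : selfAdjoint A →ₗ[ℝ] ℝ, h 1 = c / 2 → (∀ x, h x ≤ c / 2 * ‖x‖) →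
      ∃ φ : StateSpace A, ∀ a, h a = c / 2 * stateRe φ a := by
    intro h hh1 hh
    obtain ⟨φ, hφ⟩ := exists_state_of_le_norm ((2 / c) • h)
      (by rw [LinearMap.smul_apply, hh1, smul_eq_mul]; field_simp)
      (fun a => by
        rw [LinearMap.smul_apply, smul_eq_mul]
        have := mul_le_mul_of_nonneg_left (hh a) (by positivity : 0 ≤ 2 / c)
        refine this.trans (le_of_eq ?_); field_simp)
    refine ⟨φ, fun a => ?_⟩
    rw [hφ, LinearMap.smul_apply, smul_eq_mul]; field_simp
  obtain ⟨φ, hφ⟩ := mk g1 hs1.1 fun x => (hb x).1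
  obtain ⟨ψ, hψ⟩ := mk g2 hs1.2 fun x => (hb x).2
  exact ⟨φ, ψ, fun a => by rw [← hdiff a, hφ, hψ]; ring⟩

end

end QuasiLeibniz

namespace QuasiLeibniz

noncomputable section

open Filter Topology

/-! ### Total boundedness and the topology of the Monge-Kantorovich metric -/

/-- A set is totally bounded when, for each `ε`, some map with totally bounded image separates its
points up to `ε`. -/
theorem totallyBounded_of_approx {E : Type u} [PseudoEMetricSpace E] {S : Set E}
    (h : ∀ ε : ℝ≥0∞, 0 < ε → ∃ (Y : Type v) (_ : PseudoEMetricSpace Y) (θ : E → Y),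
      TotallyBounded (θ '' S) ∧ ∃ δ : ℝ≥0∞, 0 < δ ∧ ∀ a ∈ S, ∀ b ∈ S,
        edist (θ a) (θ b) < δ → edist a b < ε) : TotallyBounded S := by
  rw [EMetric.totallyBounded_iff]
  intro ε hε
  obtain ⟨Y, _, θ, hθ, δ, hδ, H⟩ := h ε hε
  obtain ⟨t, hts, htf, ht⟩ := EMetric.totallyBounded_iff'.1 hθ δ hδ
  have hts' : ∀ y : t, ∃ a ∈ S, θ a = y := fun y => hts y.2
  choose g hgS hg using hts'
  have : Finite t := htf
  refine ⟨Set.range g, Set.finite_range g, fun a ha => ?_⟩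
  obtain ⟨y, hy, hay⟩ := Set.mem_iUnion₂.1 (ht (Set.mem_image_of_mem θ ha))
  refine Set.mem_iUnion₂.2 ⟨g ⟨y, hy⟩, Set.mem_range_self _, H a ha _ (hgS _) ?_⟩
  rw [hg]; exact hay

/-- A finite distance function has finite diameter when finitely many balls of radius `1` cover. -/
theorem iSup_lt_top_of_finite_cover {S : Type u} (d : S → S → ℝ≥0∞) (hc : ∀ x y, d x y = d y x)
    (ht : ∀ x y z, d x z ≤ d x y + d y z) (hd : ∀ x y, d x y < ⊤)
    (hT : ∃ T : Finset S, ∀ x, ∃ y ∈ T, d y x < 1) : ⨆ (x) (y), d x y < ⊤ := by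
  obtain ⟨T, hT⟩ := hT
  have hfin : (∑ p ∈ T ×ˢ T, d p.1 p.2) < ⊤ := ENNReal.sum_lt_top.2 fun p _ => hd _ _
  have hfin' : 1 + (∑ p ∈ T ×ˢ T, d p.1 p.2) + 1 < ⊤ :=
    ENNReal.add_lt_top.2 ⟨ENNReal.add_lt_top.2 ⟨ENNReal.one_lt_top, hfin⟩, ENNReal.one_lt_top⟩
  refine lt_of_le_of_lt (iSup₂_le fun x y => ?_) hfin'
  obtain ⟨x', hx', h1⟩ := hT x
  obtain ⟨y', hy', h2⟩ := hT y
  refine (ht x x' y).trans ?_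
  rw [add_assoc]
  refine add_le_add (by rw [hc]; exact h1.le) ?_
  refine (ht x' y' y).trans (add_le_add ?_ h2.le)
  exact Finset.single_le_sum (f := fun p : S × S => d p.1 p.2) (fun _ _ => zero_le)
    (Finset.mk_mem_product hx' hy')

section MongeKantorovich

variable {A B : Type u} [CStarAlgebra A] [CStarAlgebra B] (L : selfAdjoint A → ℝ≥0∞)

theorem mongeKantorovich_self (φ : StateSpace A) : mongeKantorovich L φ φ = 0 := by
  simp [mongeKantorovich]

theorem mongeKantorovich_comm (φ ψ : StateSpace A) :
    mongeKantorovich L φ ψ = mongeKantorovich L ψ φ := by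
  simp only [mongeKantorovich, enorm_state_sub, abs_sub_comm]

theorem mongeKantorovich_triangle (φ ψ χ : StateSpace A) :
    mongeKantorovich L φ χ ≤ mongeKantorovich L φ ψ + mongeKantorovich L ψ χ := by
  refine iSup₂_le fun a ha => ?_
  have e : φ.1 (a : A) - χ.1 (a : A) =
      (φ.1 (a : A) - ψ.1 (a : A)) + (ψ.1 (a : A) - χ.1 (a : A)) := by ring
  rw [e]
  refine (enorm_add_le _ _).trans (add_le_add ?_ ?_)
  · exact le_iSup₂ (f := fun (a : selfAdjoint A) (_ : L a ≤ 1) => ‖φ.1 (a : A) - ψ.1 (a : A)‖ₑ) a ha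
  · exact le_iSup₂ (f := fun (a : selfAdjoint A) (_ : L a ≤ 1) => ‖ψ.1 (a : A) - χ.1 (a : A)‖ₑ) a ha

theorem mongeKantorovich_le_iff (φ ψ : StateSpace A) (r : ℝ≥0) :
    mongeKantorovich L φ ψ ≤ r ↔ ∀ a, L a ≤ 1 → |stateRe φ a - stateRe ψ a| ≤ r := by
  simp only [mongeKantorovich, iSup_le_iff, enorm_state_sub]
  refine forall₂_congr fun a _ => ?_
  rw [ENNReal.ofReal_le_iff_le_toReal ENNReal.coe_ne_top]; rfl

/-- Sufficient condition for the Monge-Kantorovich metric to be finite and induce the weak*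
topology: the unit ball of the seminorm is totally bounded up to scalars. -/
theorem mk_of_totallyBounded [Nontrivial A]
    (L_smul : ∀ (t : ℝ) a, L (t • a) = ‖t‖ₑ * L a)
    (dense_dom : Dense {a | L a < ⊤})
    (K : Set (selfAdjoint A)) (hK : TotallyBounded K)
    (hLK : ∀ a, L a ≤ 1 → ∃ t : ℝ, a - t • (1 : selfAdjoint A) ∈ K) :
    (∀ φ ψ : StateSpace A, mongeKantorovich L φ ψ < ⊤) ∧
    ballTopology (mongeKantorovich L) = (inferInstance : TopologicalSpace (StateSpace A)) := by
  have hshift : ∀ (φ ψ : StateSpace A) (a : selfAdjoint A) (t : ℝ),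
      stateRe φ a - stateRe ψ a =
        stateRe φ (a - t • (1 : selfAdjoint A)) - stateRe ψ (a - t • (1 : selfAdjoint A)) := by
    intro φ ψ a t
    simp only [map_sub, map_smul, state_apply_one]; ring
  constructor
  · intro φ ψ
    obtain ⟨R, hR⟩ := hK.isBounded.exists_norm_le
    have h0 : mongeKantorovich L φ ψ ≤ ((2 * |R|).toNNReal : ℝ≥0) := by
      rw [mongeKantorovich_le_iff]
      intro a ha
      obtain ⟨t, ht⟩ := hLK a ha
      rw [hshift φ ψ a t, Real.coe_toNNReal _ (by positivity)]
      have h1 := (abs_state_le φ _).trans (hR _ ht)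
      have h2 := (abs_state_le ψ _).trans (hR _ ht)
      have h3 := le_abs_self R
      rw [abs_le] at *
      constructor <;> linarith [h1.1, h1.2, h2.1, h2.2]
    exact h0.trans_lt ENNReal.coe_lt_top
  · refine TopologicalSpace.ext (funext fun U => propext ?_)
    refine ⟨fun hU => ?_, fun hU => ?_⟩
    · -- A ball contains a weak* neighbourhood given by a finite net of `K`.
      rw [isOpen_iff_mem_nhds]
      intro φ hφ
      obtain ⟨ε, hε, hball⟩ := hU φ hφ
      obtain ⟨δ, hδ0, hδε⟩ : ∃ δ : ℝ≥0, 0 < δ ∧ ((3 * δ : ℝ≥0) : ℝ≥0∞) < ε := by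
        obtain ⟨δ, h1, h2⟩ := ENNReal.lt_iff_exists_nnreal_btwn.1 hε
        refine ⟨δ / 3, div_pos (by exact_mod_cast h1) (by norm_num), ?_⟩
        rwa [mul_div_cancel₀ _ (by norm_num)]
      obtain ⟨T, hTf, hT⟩ := Metric.totallyBounded_iff.1 hK δ (by exact_mod_cast hδ0)
      have hopen : ∀ b ∈ T, ∀ᶠ ψ : StateSpace A in 𝓝 φ, |stateRe φ b - stateRe ψ b| < δ := by
        intro b _
        have hc : Continuous fun ψ : StateSpace A => |stateRe φ b - stateRe ψ b| := by
          refine (continuous_const.sub ?_).abs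
          exact Complex.continuous_re.comp
            ((WeakDual.eval_continuous (b : A)).comp continuous_subtype_val)
        have : Tendsto (fun ψ : StateSpace A => |stateRe φ b - stateRe ψ b|) (𝓝 φ) (𝓝 0) := by
          have := hc.tendsto φ
          simpa using this
        exact this.eventually (gt_mem_nhds (by exact_mod_cast hδ0))
      filter_upwards [(Filter.eventually_all_finite hTf).2 hopen] with ψ hψ
      refine hball ψ (lt_of_le_of_lt ?_ hδε)
      rw [mongeKantorovich_le_iff]
      intro a ha
      obtain ⟨t, ht⟩ := hLK a ha
      rw [hshift φ ψ a t]
      obtain ⟨b, hb, hab⟩ := Set.mem_iUnion₂.1 (hT ht)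
      rw [Metric.mem_ball, dist_eq_norm] at hab
      have h1 := abs_state_le φ (a - t • (1 : selfAdjoint A) - b)
      have h2 := abs_state_le ψ (a - t • (1 : selfAdjoint A) - b)
      have h3 := hψ b hb
      rw [map_sub _ _ b] at h1 h2
      rw [abs_le] at *
      rw [abs_lt] at h3
      push_cast
      constructor <;> linarith [h1.1, h1.2, h2.1, h2.2, h3.1, h3.2]
    · -- Weak* neighbourhoods are determined by finitely many elements of the domain.
      intro φ hφ
      have hmem : U ∈ 𝓝 φ := hU.mem_nhds hφ
      by_contra hcon
      push Not at hcon
      -- Otherwise a sequence of states outside `U` converges to `φ` for the metric.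
      have hseq : ∀ n : ℕ, ∃ ψ : StateSpace A,
          mongeKantorovich L φ ψ < ((n : ℝ≥0∞) + 1)⁻¹ ∧ ψ ∉ U := fun n =>
        hcon _ (ENNReal.inv_pos.2 (by finiteness))
      choose ψ hψ hψU using hseq
      have hsa : ∀ a : selfAdjoint A, Tendsto (fun n => stateRe (ψ n) a) atTop (𝓝 (stateRe φ a)) := by
        intro a
        rw [Metric.tendsto_atTop]
        intro ε hε
        obtain ⟨b, hb, hab⟩ := Metric.dense_iff.1 dense_dom a (ε / 3) (by positivity)
        rw [Metric.mem_ball, dist_eq_norm] at hb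
        obtain ⟨l, hl⟩ := ENNReal.lt_iff_exists_coe.1 (show L b < ⊤ from hab)
        obtain ⟨N, hN⟩ := exists_nat_gt (((l : ℝ) + 1) * 3 / ε)
        refine ⟨N, fun n hn => ?_⟩
        have hl1 : (0 : ℝ) < (l : ℝ) + 1 := by positivity
        -- Scale `b` into the unit ball of `L`.
        have hLb : L (((l : ℝ) + 1)⁻¹ • b) ≤ 1 := by
          rw [L_smul, hl.1, enorm_inv hl1.ne']
          have e : ‖((l : ℝ) + 1)‖ₑ = ((l + 1 : ℝ≥0) : ℝ≥0∞) := by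
            rw [Real.enorm_eq_ofReal hl1.le, ENNReal.ofReal]
            congr 1
            ext
            rw [Real.coe_toNNReal _ hl1.le]; push_cast; rfl
          rw [e, mul_comm, ← div_eq_mul_inv]
          refine ENNReal.div_le_of_le_mul ?_
          rw [one_mul]; exact_mod_cast le_self_add
        have hd := (mongeKantorovich_le_iff L φ (ψ n) ((n : ℝ≥0) + 1)⁻¹).1 (by
          refine (hψ n).le.trans (le_of_eq ?_)
          rw [ENNReal.coe_inv (by positivity)]; push_cast; rfl) _ hLb
        rw [map_smul, map_smul, ← smul_sub, smul_eq_mul, abs_mul, abs_of_pos (inv_pos.2 hl1)] at hd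
        have hd2 : |stateRe φ b - stateRe (ψ n) b| < ε / 3 := by
          have hn1 : (0 : ℝ) < (n : ℝ) + 1 := by positivity
          have : |stateRe φ b - stateRe (ψ n) b| ≤ ((l : ℝ) + 1) * ((n : ℝ) + 1)⁻¹ := by
            have := mul_le_mul_of_nonneg_left hd hl1.le
            rw [← mul_assoc, mul_inv_cancel₀ hl1.ne', one_mul] at this
            push_cast at this; exact this
          refine this.trans_lt ?_
          rw [← div_eq_mul_inv, div_lt_iff₀ hn1]
          have hnN : (N : ℝ) ≤ n := by exact_mod_cast hn
          rw [div_lt_iff₀ hε] at hN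
          nlinarith
        have h1 := abs_state_le φ (b - a)
        have h2 := abs_state_le (ψ n) (b - a)
        rw [map_sub] at h1 h2
        rw [Real.dist_eq]
        rw [abs_le] at h1 h2
        rw [abs_lt] at *
        constructor <;> linarith [h1.1, h1.2, h2.1, h2.2, hd2.1, hd2.2]
      have hlim : Tendsto ψ atTop (𝓝 φ) := by
        rw [tendsto_subtype_rng]
        refine tendsto_iff_forall_eval_tendsto_topDualPairing.2 ?_
        intro x
        have hx : ∀ θ : StateSpace A, θ.1 x = (stateRe θ (realPart x) : ℂ) +
            Complex.I * (stateRe θ (imaginaryPart x) : ℂ) := by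
          intro θ
          conv_lhs => rw [← realPart_add_I_smul_imaginaryPart x]
          rw [map_add, map_smul, state_apply, state_apply]; rfl
        change Tendsto (fun n => (ψ n).1 x) atTop (𝓝 (φ.1 x))
        simp only [hx]
        refine Tendsto.add ?_ (Tendsto.mul tendsto_const_nhds ?_)
        · exact (Complex.continuous_ofReal.tendsto _).comp (hsa _)
        · exact (Complex.continuous_ofReal.tendsto _).comp (hsa _)
      obtain ⟨n, hn⟩ := (hlim.eventually hmem).exists
      exact hψU n hn

/-- States are covered by finitely many balls of the Monge-Kantorovich metric when it induces
the weak* topology. -/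
theorem exists_finite_cover
    (hL : ballTopology (mongeKantorovich L) = (inferInstance : TopologicalSpace (StateSpace A)))
    (ε : ℝ≥0∞) (hε : 0 < ε) :
    ∃ T : Finset (StateSpace A), ∀ φ, ∃ ψ ∈ T, mongeKantorovich L ψ φ < ε := by
  have hopen : ∀ ψ : StateSpace A, IsOpen {φ | mongeKantorovich L ψ φ < ε} := by
    intro ψ
    have : IsOpen[ballTopology (mongeKantorovich L)] {φ | mongeKantorovich L ψ φ < ε} := by
      intro φ hφ
      refine ⟨ε - mongeKantorovich L ψ φ, tsub_pos_of_lt hφ, fun χ hχ => ?_⟩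
      refine (mongeKantorovich_triangle L ψ φ χ).trans_lt ?_
      rw [add_comm]
      exact lt_tsub_iff_right.1 hχ
    rwa [hL] at this
  obtain ⟨T, hT⟩ := isCompact_univ.elim_finite_subcover _ hopen (fun φ _ =>
    Set.mem_iUnion.2 ⟨φ, by
      change mongeKantorovich L φ φ < ε
      rwa [mongeKantorovich_self]⟩)
  refine ⟨T, fun φ => ?_⟩
  obtain ⟨ψ, hψ, h⟩ := Set.mem_iUnion₂.1 (hT (Set.mem_univ φ))
  exact ⟨ψ, hψ, h⟩

end MongeKantorovich

section JordanLie

variable {A : Type u} [CStarAlgebra A]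

/-- The Jordan product (for `false`) and the Lie product (for `true`), treated uniformly. -/
def jl (i : Bool) (a b : selfAdjoint A) : selfAdjoint A :=
  match i with
  | false => jordan a b
  | true => lie a b

theorem norm_jl_le (i : Bool) (a b : selfAdjoint A) : ‖jl i a b‖ ≤ ‖a‖ * ‖b‖ := by
  have h₁ := norm_mul_le (a : A) b
  have h₂ := norm_mul_le (b : A) a
  cases i
  · change ‖(1 / 2 : ℂ) • ((a : A) * b + b * a)‖ ≤ ‖(a : A)‖ * ‖(b : A)‖
    rw [norm_smul]
    have h := norm_add_le ((a : A) * b) (b * a)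
    norm_num
    linarith
  · change ‖(1 / (2 * Complex.I) : ℂ) • ((a : A) * b - b * a)‖ ≤ ‖(a : A)‖ * ‖(b : A)‖
    rw [norm_smul]
    have h := norm_sub_le ((a : A) * b) (b * a)
    norm_num
    linarith

theorem jl_sub_jl (i : Bool) (a b c d : selfAdjoint A) :
    jl i a b - jl i c d = jl i (a - c) b + jl i c (b - d) := by
  refine Subtype.ext ?_
  cases i <;>
  · simp only [jl, jordan, lie, AddSubgroup.coe_sub, AddSubgroup.coe_add, ← smul_sub, ← smul_add]
    congr 1; noncomm_ring

/-- The product of the algebra is recovered from the Jordan and Lie products. -/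
theorem coe_mul_coe_eq_jl (a b : selfAdjoint A) :
    (a : A) * b = (jl false a b : A) + Complex.I • (jl true a b : A) := by
  simp only [jl, jordan, lie, smul_smul]
  have h : Complex.I * (1 / (2 * Complex.I)) = 1 / 2 := by
    field_simp
  rw [h]
  module

end JordanLie

variable {F : ℝ≥0 × ℝ≥0 × ℝ≥0 × ℝ≥0 → ℝ≥0}

namespace Space

variable (X : Space.{u} F)

theorem diam_lt_top : X.diam < ⊤ :=
  iSup_lt_top_of_finite_cover (mongeKantorovich X.L) (mongeKantorovich_comm X.L)
    (mongeKantorovich_triangle X.L) X.mk_lt_top (exists_finite_cover X.L X.mk_topology 1 one_pos)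

theorem L_smul_le {a : selfAdjoint X.carrier} {l : ℝ≥0} (h : X.L a ≤ l) (t : ℝ≥0) :
    X.L ((t : ℝ) • a) ≤ (t * l : ℝ≥0) := by
  rw [X.L_smul, ENNReal.coe_mul]
  refine mul_le_mul' (le_of_eq ?_) h
  rw [Real.enorm_eq_ofReal t.coe_nonneg, ENNReal.ofReal_coe_nnreal]

theorem L_neg (a : selfAdjoint X.carrier) : X.L (-a) = X.L a := by
  have := X.L_smul (-1) a
  simpa using this

theorem L_sub (a b : selfAdjoint X.carrier) : X.L (a - b) ≤ X.L a + X.L b := by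
  rw [sub_eq_add_neg, ← X.L_neg b]; exact X.L_add _ _

theorem L_scalar (t : ℝ) : X.L (t • 1) = 0 := (X.L_eq_zero _).2 ⟨t, rfl⟩

theorem L_one : X.L 1 = 0 := (X.L_eq_zero _).2 ⟨1, (one_smul _ _).symm⟩

theorem L_zero : X.L 0 = 0 := (X.L_eq_zero _).2 ⟨0, (zero_smul _ _).symm⟩

theorem L_add_scalar (a : selfAdjoint X.carrier) (t : ℝ) : X.L (a + t • 1) = X.L a := by
  refine le_antisymm ?_ ?_
  · have := X.L_add a (t • 1)
    rwa [X.L_scalar, add_zero] at this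
  · have := X.L_add (a + t • 1) ((-t) • 1)
    rw [X.L_scalar, add_zero] at this
    simpa [neg_smul] using this

theorem L_sub_scalar (a : selfAdjoint X.carrier) (t : ℝ) : X.L (a - t • 1) = X.L a := by
  have := X.L_add_scalar a (-t)
  rwa [neg_smul, ← sub_eq_add_neg] at this

theorem L_jl_le (hF : Permissible F) (i : Bool) {a b : selfAdjoint X.carrier} {x y l m : ℝ≥0}
    (hx : ‖a‖ ≤ x) (hy : ‖b‖ ≤ y) (ha : X.L a ≤ l) (hb : X.L b ≤ m) :
    X.L (jl i a b) ≤ F (x, y, l, m) := by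
  have hm : F (‖(a : X.carrier)‖₊, ‖(b : X.carrier)‖₊, (X.L a).toNNReal, (X.L b).toNNReal) ≤
      F (x, y, l, m) :=
    hF.mono ⟨hx, hy, by simpa using ENNReal.toNNReal_mono ENNReal.coe_ne_top ha,
      by simpa using ENNReal.toNNReal_mono ENNReal.coe_ne_top hb⟩
  have ha' := ha.trans_lt ENNReal.coe_lt_top
  have hb' := hb.trans_lt ENNReal.coe_lt_top
  refine le_trans ?_ (ENNReal.coe_le_coe.2 hm)
  cases i
  · exact X.L_jordan a b ha' hb'
  · exact X.L_lie a b ha' hb'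

/-- The closed unit ball gives the closed balls of positive radius by scaling, and the kernel as their
intersection. -/
theorem isClosed_L_le (l : ℝ≥0) : IsClosed {a | X.L a ≤ l} := by
  have hpos : ∀ l : ℝ≥0, 0 < l → IsClosed {a | X.L a ≤ l} := by
    intro l hl
    have hl' : (0 : ℝ) < l := by exact_mod_cast hl
    have : {a | X.L a ≤ l} = (fun a => (l : ℝ)⁻¹ • a) ⁻¹' {a | X.L a ≤ 1} := by
      ext a
      simp only [Set.mem_ofPred_eq, Set.mem_preimage]
      rw [X.L_smul, enorm_inv hl'.ne', Real.enorm_eq_ofReal hl'.le, ENNReal.ofReal_coe_nnreal,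
        mul_comm, ← div_eq_mul_inv, ENNReal.div_le_iff (by exact_mod_cast hl.ne')
          ENNReal.coe_ne_top, one_mul]
    rw [this]
    exact X.isClosed_unitBall.preimage (continuous_const_smul _)
  have : {a | X.L a ≤ l} = ⋂ n : ℕ, {a | X.L a ≤ (l + ((n : ℝ≥0) + 1)⁻¹ : ℝ≥0)} := by
    ext a
    simp only [Set.mem_ofPred_eq, Set.mem_iInter]
    refine ⟨fun h n => h.trans (by exact_mod_cast le_self_add), fun h => ?_⟩
    have ht : Tendsto (fun n : ℕ => ((l + ((n : ℝ≥0) + 1)⁻¹ : ℝ≥0) : ℝ≥0∞)) atTop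
        (𝓝 ((l + 0 : ℝ≥0) : ℝ≥0∞)) := by
      refine ENNReal.tendsto_coe.2 (tendsto_const_nhds.add ?_)
      have := tendsto_one_div_add_atTop_nhds_zero_nat (𝕜 := ℝ≥0)
      simpa using this
    rw [add_zero] at ht
    exact ge_of_tendsto' ht h
  rw [this]
  exact isClosed_iInter fun n => hpos _ (by positivity)

/-- `|φ(a) - ψ(a)| ≤ mk(φ, ψ) L(a)`. -/
theorem abs_sub_le_of_kantorovich {φ ψ : StateSpace X.carrier} {r : ℝ≥0}
    (h : X.kantorovich φ ψ ≤ r) {a : selfAdjoint X.carrier} {l : ℝ≥0} (ha : X.L a ≤ l) :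
    |stateRe φ a - stateRe ψ a| ≤ r * l := by
  rcases eq_or_ne l 0 with rfl | hl
  · have h0 : X.L a = 0 := le_antisymm (by simpa using ha) zero_le
    obtain ⟨t, rfl⟩ := (X.L_eq_zero a).1 h0
    simp [map_smul, state_apply_one]
  · have hl' : (0 : ℝ) < l := by exact_mod_cast pos_iff_ne_zero.2 hl
    have h1 : X.L ((l⁻¹ : ℝ≥0) • a) ≤ 1 := by
      have := X.L_smul_le ha l⁻¹
      rwa [inv_mul_cancel₀ hl, ENNReal.coe_one] at this
    have h2 := (mongeKantorovich_le_iff X.L φ ψ r).1 h _ h1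
    have e : ∀ θ : StateSpace X.carrier, stateRe θ ((l⁻¹ : ℝ≥0) • a) = (l : ℝ)⁻¹ * stateRe θ a := by
      intro θ
      change stateRe θ (((l⁻¹ : ℝ≥0) : ℝ) • a) = _
      rw [map_smul, smul_eq_mul, NNReal.coe_inv]
    rw [e, e, ← mul_sub, abs_mul, abs_of_pos (inv_pos.2 hl'), inv_mul_le_iff₀ hl'] at h2
    linarith

/-- Every element is at distance at most `K * L(a)` from the scalars when `K` bounds the
diameter. -/
theorem exists_norm_sub_scalar_le {K : ℝ≥0} (hK : X.diam ≤ K) {a : selfAdjoint X.carrier} {l : ℝ≥0}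
    (ha : X.L a ≤ l) : ∃ t : ℝ, ‖a - t • (1 : selfAdjoint X.carrier)‖ ≤ K * l := by
  obtain ⟨φ⟩ : Nonempty (StateSpace X.carrier) := inferInstance
  refine ⟨stateRe φ a, ?_⟩
  obtain ⟨ψ, hψ⟩ := exists_state_abs_eq_norm (a - stateRe φ a • (1 : selfAdjoint X.carrier))
  rw [← hψ, map_sub, map_smul, state_apply_one, smul_eq_mul, mul_one]
  refine X.abs_sub_le_of_kantorovich ?_ ha
  exact (le_iSup₂ (f := fun φ ψ => X.kantorovich φ ψ) ψ φ).trans hK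

/-- An element of the ball is determined up to `ε` by its values at finitely many states, because its
values vary by at most `l` times the Monge-Kantorovich distance. -/
theorem totallyBounded_ball (l R : ℝ≥0) : TotallyBounded {a | X.L a ≤ l ∧ ‖a‖ ≤ R} := by
  refine totallyBounded_of_approx.{u, u} fun ε hε => ?_
  obtain ⟨δ, hδ0, hδε⟩ : ∃ δ : ℝ≥0, 0 < δ ∧ (δ : ℝ≥0∞) < ε := by
    obtain ⟨δ, h1, h2⟩ := ENNReal.lt_iff_exists_nnreal_btwn.1 hε
    exact ⟨δ, by exact_mod_cast h1, h2⟩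
  obtain ⟨T, hT⟩ := exists_finite_cover X.L X.mk_topology ((δ / (3 * (l + 1)) : ℝ≥0))
    (by exact_mod_cast (by positivity : 0 < δ / (3 * (l + 1))))
  refine ⟨T → ℝ, inferInstance, fun a ψ => stateRe ψ.1 a, ?_, ((δ / 3 : ℝ≥0) : ℝ≥0∞),
    by exact_mod_cast (by positivity : 0 < δ / 3), ?_⟩
  · refine (isCompact_closedBall (0 : T → ℝ) R).totallyBounded.subset ?_
    rintro _ ⟨a, ha, rfl⟩
    rw [mem_closedBall_zero_iff]
    refine (pi_norm_le_iff_of_nonneg R.2).2 ?_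
    exact fun ψ => (abs_state_le ψ.1 a).trans ha.2
  · intro a ha b hb hab
    refine lt_of_le_of_lt ?_ hδε
    rw [edist_dist, dist_eq_norm]
    refine ENNReal.ofReal_le_of_le_toReal ?_
    change ‖a - b‖ ≤ δ
    obtain ⟨φ, hφ⟩ := exists_state_abs_eq_norm (a - b)
    obtain ⟨ψ, hψT, hψ⟩ := hT φ
    have h1 := X.abs_sub_le_of_kantorovich hψ.le ha.1
    have h2 := X.abs_sub_le_of_kantorovich hψ.le hb.1
    have h3 : |stateRe ψ a - stateRe ψ b| < δ / 3 := by
      have := (edist_le_pi_edist (fun ψ : T => stateRe ψ.1 a) (fun ψ : T => stateRe ψ.1 b)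
        ⟨ψ, hψT⟩).trans_lt hab
      rw [edist_dist, Real.dist_eq] at this
      have := (ENNReal.ofReal_lt_iff_lt_toReal (abs_nonneg _) ENNReal.coe_ne_top).1 this
      simpa using this
    have h4 : ((δ / (3 * (l + 1)) : ℝ≥0) : ℝ) * l ≤ δ / 3 := by
      push_cast
      have : (0 : ℝ) ≤ l := l.2
      have h5 : (δ : ℝ) / (3 * (l + 1)) * l = δ / 3 * (l / (l + 1)) := by field_simp
      rw [h5]
      refine mul_le_of_le_one_right (by positivity) ?_
      rw [div_le_one (by positivity)]; linarith
    rw [← hφ, map_sub]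
    rw [abs_le] at *
    rw [abs_lt] at h3
    constructor <;> linarith [h1.1, h1.2, h2.1, h2.2, h3.1, h3.2]

theorem isCompact_ball (l R : ℝ≥0) : IsCompact {a | X.L a ≤ l ∧ ‖a‖ ≤ R} := by
  refine isCompact_iff_totallyBounded_isComplete.2 ⟨X.totallyBounded_ball l R, IsClosed.isComplete ?_⟩
  exact (X.isClosed_L_le l).inter (isClosed_le continuous_norm continuous_const)

/-- The unit ball of the seminorm is totally bounded up to scalars. -/
theorem exists_totallyBounded : ∃ K : Set (selfAdjoint X.carrier), TotallyBounded K ∧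
    ∀ a, X.L a ≤ 1 → ∃ t : ℝ, a - t • (1 : selfAdjoint X.carrier) ∈ K := by
  obtain ⟨K, hK⟩ := ENNReal.lt_iff_exists_coe.1 X.diam_lt_top
  refine ⟨_, X.totallyBounded_ball 1 K, fun a ha => ?_⟩
  obtain ⟨t, ht⟩ := X.exists_norm_sub_scalar_le hK.1.le (l := 1) (by simpa using ha)
  refine ⟨t, ?_, by simpa using ht⟩
  rw [X.L_sub_scalar]; simpa using ha

/-- Construction of a space from a seminorm whose unit ball is totally bounded up to scalars. -/
def ofTotallyBounded (A : Type u) [CStarAlgebra A] [Nontrivial A] (L : selfAdjoint A → ℝ≥0∞)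
    (L_add : ∀ a b, L (a + b) ≤ L a + L b)
    (L_smul : ∀ (t : ℝ) a, L (t • a) = ‖t‖ₑ * L a)
    (dense_dom : Dense {a | L a < ⊤})
    (L_eq_zero : ∀ a, L a = 0 ↔ ∃ t : ℝ, a = t • (1 : selfAdjoint A))
    (isClosed_unitBall : IsClosed {a | L a ≤ 1})
    (htb : ∃ K : Set (selfAdjoint A), TotallyBounded K ∧
      ∀ a, L a ≤ 1 → ∃ t : ℝ, a - t • (1 : selfAdjoint A) ∈ K)
    (L_leibniz : ∀ (i : Bool) (a b : selfAdjoint A) (l m : ℝ≥0), L a ≤ l → L b ≤ m →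
      L (jl i a b) ≤ F (‖(a : A)‖₊, ‖(b : A)‖₊, l, m)) :
    Space.{u} F where
  carrier := A
  L := L
  L_add := L_add
  L_smul := L_smul
  dense_dom := dense_dom
  L_eq_zero := L_eq_zero
  isClosed_unitBall := isClosed_unitBall
  mk_lt_top := by
    obtain ⟨K, hK, hLK⟩ := htb
    exact (mk_of_totallyBounded L L_smul dense_dom K hK hLK).1
  mk_topology := by
    obtain ⟨K, hK, hLK⟩ := htb
    exact (mk_of_totallyBounded L L_smul dense_dom K hK hLK).2
  L_jordan := fun a b ha hb => L_leibniz false a b _ _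
    (ENNReal.coe_toNNReal ha.ne).ge (ENNReal.coe_toNNReal hb.ne).ge
  L_lie := fun a b ha hb => L_leibniz true a b _ _
    (ENNReal.coe_toNNReal ha.ne).ge (ENNReal.coe_toNNReal hb.ne).ge

end Space

end

end QuasiLeibniz

namespace QuasiLeibniz

noncomputable section

open Filter Topology

/-! ### Morphisms on self-adjoint parts -/

section MapSA

variable {A : Type u} {B : Type v} [CStarAlgebra A] [CStarAlgebra B]

/-- The restriction of a *-homomorphism to the self-adjoint parts. -/
def mapSA (π : A →⋆ₐ[ℂ] B) : selfAdjoint A →ₗ[ℝ] selfAdjoint B where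
  toFun a := ⟨π a, a.2.map π⟩
  map_add' a b := Subtype.ext (map_add π (a : A) b)
  map_smul' t a := Subtype.ext (by
    change π (t • (a : A)) = t • π (a : A)
    rw [← Complex.coe_smul, map_smul, Complex.coe_smul])

@[simp]
theorem coe_mapSA (π : A →⋆ₐ[ℂ] B) (a : selfAdjoint A) : (mapSA π a : B) = π (a : A) := rfl

theorem mapSA_eq_iff (π : A →⋆ₐ[ℂ] B) (a : selfAdjoint A) (b : selfAdjoint B) :
    mapSA π a = b ↔ π (a : A) = b := Subtype.ext_iff

theorem mapSA_one (π : A →⋆ₐ[ℂ] B) : mapSA π 1 = 1 := Subtype.ext (map_one π)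

theorem mapSA_scalar (π : A →⋆ₐ[ℂ] B) (t : ℝ) : mapSA π (t • 1) = t • 1 := by
  rw [map_smul, mapSA_one]

theorem mapSA_jl (π : A →⋆ₐ[ℂ] B) (i : Bool) (a b : selfAdjoint A) :
    mapSA π (jl i a b) = jl i (mapSA π a) (mapSA π b) :=
  Subtype.ext (by cases i <;> simp [jl, jordan, lie])

theorem norm_mapSA_le (π : A →⋆ₐ[ℂ] B) (a : selfAdjoint A) : ‖mapSA π a‖ ≤ ‖a‖ :=
  NonUnitalStarAlgHom.norm_apply_le π (a : A)

theorem norm_mapSA_of_injective (π : A →⋆ₐ[ℂ] B) (h : Function.Injective π) (a : selfAdjoint A) :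
    ‖mapSA π a‖ = ‖a‖ :=
  NonUnitalStarAlgHom.norm_map π h (a : A)

theorem continuous_mapSA (π : A →⋆ₐ[ℂ] B) : Continuous (mapSA π) :=
  AddMonoidHomClass.continuous_of_bound (mapSA π) 1 fun a => by
    rw [one_mul]; exact norm_mapSA_le π a

theorem surjective_mapSA (π : A →⋆ₐ[ℂ] B) (h : Function.Surjective π) :
    Function.Surjective (mapSA π) := by
  intro b
  obtain ⟨a, ha⟩ := h b
  refine ⟨realPart a, Subtype.ext ?_⟩
  have hb : star (b : B) = b := b.2
  rw [coe_mapSA, realPart_apply_coe, ← Complex.coe_smul, map_smul, map_add, map_star, ha, hb,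
    Complex.coe_smul, ← two_smul ℝ (b : B), smul_smul]
  norm_num

end MapSA

/-- Two homogeneous functions are comparable when their unit balls are. -/
theorem le_of_unitBall_subset {E : Type*} [AddCommGroup E] [Module ℝ E] {L₁ L₂ : E → ℝ≥0∞}
    (h₁ : ∀ (t : ℝ) a, L₁ (t • a) = ‖t‖ₑ * L₁ a) (h₂ : ∀ (t : ℝ) a, L₂ (t • a) = ‖t‖ₑ * L₂ a)
    (h : ∀ a, L₁ a ≤ 1 → L₂ a ≤ 1) (a : E) : L₂ a ≤ L₁ a := by
  refine le_of_forall_gt_imp_ge_of_dense fun r hr => ?_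
  rcases eq_or_ne r ⊤ with rfl | hr'
  · exact le_top
  lift r to ℝ≥0 using hr'
  have hr0 : 0 < r := by exact_mod_cast (zero_le.trans_lt hr : (0 : ℝ≥0∞) < r)
  have hr1 : (0 : ℝ) < r := by exact_mod_cast hr0
  have e : ‖(r : ℝ)⁻¹‖ₑ = (r : ℝ≥0∞)⁻¹ := by
    rw [enorm_inv hr1.ne', Real.enorm_eq_ofReal hr1.le, ENNReal.ofReal_coe_nnreal]
  have hne : (r : ℝ≥0∞) ≠ 0 := by exact_mod_cast hr0.ne'
  have := h ((r : ℝ)⁻¹ • a) (by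
    rw [h₁, e, mul_comm, ← div_eq_mul_inv]
    exact ENNReal.div_le_of_le_mul (by rw [one_mul]; exact hr.le))
  rw [h₂, e, mul_comm, ← div_eq_mul_inv, ENNReal.div_le_iff hne ENNReal.coe_ne_top, one_mul] at this
  exact this

variable {F : ℝ≥0 × ℝ≥0 × ℝ≥0 × ℝ≥0 → ℝ≥0}

namespace Space

variable (X : Space.{u} F)

/-- The domain of the seminorm. -/
def dom : Submodule ℝ (selfAdjoint X.carrier) where
  carrier := {a | X.L a < ⊤}
  zero_mem' := by simp [X.L_zero]
  add_mem' := fun {a b} ha hb => (X.L_add a b).trans_lt (ENNReal.add_lt_top.2 ⟨ha, hb⟩)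
  smul_mem' := fun t a ha => by
    change X.L (t • a) < ⊤
    rw [X.L_smul]; exact ENNReal.mul_lt_top enorm_lt_top ha

/-- The seminorm is determined by the Monge-Kantorovich metric. -/
theorem L_le_one_of_kantorovich {a : selfAdjoint X.carrier}
    (h : ∀ (φ ψ : StateSpace X.carrier) (r : ℝ≥0), X.kantorovich φ ψ ≤ r →
      |stateRe φ a - stateRe ψ a| ≤ r) : X.L a ≤ 1 := by
  -- Separate `a` from the unit ball, which is closed and convex, by a functional `f`. It vanishes at
  -- `1`, hence is a multiple of a difference of two states, and these contradict the hypothesis.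
  by_contra hcon
  have hconv : Convex ℝ {a | X.L a ≤ 1} := by
    intro b hb c hc s t hs ht hst
    lift s to ℝ≥0 using hs
    lift t to ℝ≥0 using ht
    have hb' := X.L_smul_le (l := 1) (by simpa using hb) s
    have hc' := X.L_smul_le (l := 1) (by simpa using hc) t
    refine (X.L_add _ _).trans ((add_le_add hb' hc').trans ?_)
    rw [mul_one, mul_one, ← ENNReal.coe_add]
    refine le_of_eq ?_
    rw [ENNReal.coe_eq_one]
    exact_mod_cast hst
  obtain ⟨f, w, hf, hw⟩ := geometric_hahn_banach_closed_point hconv X.isClosed_unitBall hcon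
  have hw0 : 0 < w := by simpa using hf 0 (by simp [X.L_zero])
  have hf1 : f 1 = 0 := by
    by_contra hne
    have := hf ((w / f 1) • 1) (by simp [X.L_scalar])
    rw [map_smul, smul_eq_mul, div_mul_cancel₀ _ hne] at this
    exact lt_irrefl _ this
  have hc : 0 < ‖f‖ + 1 := by positivity
  obtain ⟨φ, ψ, hφψ⟩ := exists_states_of_functional (f : selfAdjoint X.carrier →ₗ[ℝ] ℝ) hf1
    (‖f‖ + 1) hc (fun x => (le_abs_self _).trans ((f.le_opNorm x).trans
      (mul_le_mul_of_nonneg_right (by linarith) (norm_nonneg _))))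
  simp only [ContinuousLinearMap.coe_coe] at hφψ
  have hr : 0 ≤ 2 * w / (‖f‖ + 1) := by positivity
  have hconv : ∀ x, stateRe φ x - stateRe ψ x = 2 / (‖f‖ + 1) * f x := fun x => by
    rw [hφψ]; field_simp
  have hk : X.kantorovich φ ψ ≤ ((2 * w / (‖f‖ + 1)).toNNReal : ℝ≥0) := by
    refine (mongeKantorovich_le_iff _ _ _ _).2 fun b hb => ?_
    rw [hconv, abs_mul, abs_of_pos (by positivity)]
    have h1 := hf b hb
    have h2 := hf (-b) (by change X.L (-b) ≤ 1; rwa [X.L_neg])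
    rw [map_neg] at h2
    have h3 : |f b| ≤ w := abs_le.2 ⟨by linarith, h1.le⟩
    refine (mul_le_mul_of_nonneg_left h3 (by positivity)).trans (le_of_eq ?_)
    rw [Real.coe_toNNReal _ hr]; ring
  have h4 := (le_abs_self _).trans (h φ ψ _ hk)
  rw [hconv] at h4
  rw [Real.coe_toNNReal _ hr] at h4
  have h5 : 2 / (‖f‖ + 1) * w < 2 / (‖f‖ + 1) * f a := by
    exact mul_lt_mul_of_pos_left hw (by positivity)
  have h6 : 2 * w / (‖f‖ + 1) = 2 / (‖f‖ + 1) * w := by ring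
  linarith

/-- Infima of the seminorm over the fibres of a morphism are attained. -/
theorem exists_lift {B : Type v} [CStarAlgebra B] [Nontrivial B] (π : X.carrier →⋆ₐ[ℂ] B)
    {a : selfAdjoint B} {l : ℝ≥0} (h : ⨅ (d : selfAdjoint X.carrier) (_ : π d = a), X.L d ≤ l) :
    ∃ d, mapSA π d = a ∧ X.L d ≤ l := by
  obtain ⟨K, hK⟩ := ENNReal.lt_iff_exists_coe.1 X.diam_lt_top
  let e : ℕ → ℝ≥0 := fun n => ((n : ℝ≥0) + 1)⁻¹
  have he0 : Antitone e := fun m n hmn => by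
    refine inv_anti₀ (by positivity) ?_
    gcongr
  -- Lifts of bounded seminorm are bounded in norm.
  let R : ℝ≥0 := ‖a‖₊ + 2 * (K * (l + 1))
  have hnorm : ∀ d, mapSA π d = a → X.L d ≤ (l + 1 : ℝ≥0) → ‖d‖ ≤ R := by
    intro d hd hL
    obtain ⟨t, ht⟩ := X.exists_norm_sub_scalar_le hK.1.le hL
    have h1 := (norm_mapSA_le π _).trans ht
    rw [map_sub, mapSA_scalar, hd] at h1
    have h2 : ‖t • (1 : selfAdjoint B)‖ = |t| := by
      rw [norm_smul, norm_selfAdjoint_one, mul_one]; rfl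
    have h3 : ‖t • (1 : selfAdjoint X.carrier)‖ = |t| := by
      rw [norm_smul, norm_selfAdjoint_one, mul_one]; rfl
    have h4 := norm_sub_norm_le (t • (1 : selfAdjoint B)) a
    rw [norm_sub_rev, h2] at h4
    have h5 := norm_sub_norm_le d (t • (1 : selfAdjoint X.carrier))
    rw [h3] at h5
    simp only [R, NNReal.coe_add, NNReal.coe_mul, NNReal.coe_ofNat, coe_nnnorm]
    push_cast at *
    linarith
  let S : ℕ → Set (selfAdjoint X.carrier) := fun n =>
    {d | X.L d ≤ (l + e n : ℝ≥0) ∧ ‖d‖ ≤ R} ∩ {d | mapSA π d = a}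
  have hSc : ∀ n, IsCompact (S n) := fun n =>
    (X.isCompact_ball _ _).inter_right (isClosed_eq (continuous_mapSA π) continuous_const)
  have hSn : ∀ n, (S n).Nonempty := by
    intro n
    have hlt : ⨅ (d : selfAdjoint X.carrier) (_ : π d = a), X.L d < (l + e n : ℝ≥0) := by
      refine h.trans_lt ?_
      exact_mod_cast lt_add_of_pos_right l (by positivity : 0 < e n)
    simp only [iInf_lt_iff] at hlt
    obtain ⟨d, hd, hdL⟩ := hlt
    have hd' : mapSA π d = a := Subtype.ext hd
    refine ⟨d, ⟨hdL.le, hnorm d hd' (hdL.le.trans ?_)⟩, hd'⟩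
    have : e n ≤ 1 := inv_le_one_of_one_le₀ (by simp)
    exact_mod_cast (by gcongr)
  obtain ⟨d, hd⟩ := IsCompact.nonempty_iInter_of_sequence_nonempty_isCompact_isClosed S
    (fun n d hd => ⟨⟨hd.1.1.trans (by
      have := he0 n.le_succ
      exact_mod_cast (by gcongr)), hd.1.2⟩, hd.2⟩) hSn (hSc 0) (fun n => (hSc n).isClosed)
  rw [Set.mem_iInter] at hd
  refine ⟨d, (hd 0).2, ?_⟩
  have ht : Tendsto (fun n : ℕ => ((l + e n : ℝ≥0) : ℝ≥0∞)) atTop (𝓝 ((l + 0 : ℝ≥0) : ℝ≥0∞)) := by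
    refine ENNReal.tendsto_coe.2 (tendsto_const_nhds.add ?_)
    have := tendsto_one_div_add_atTop_nhds_zero_nat (𝕜 := ℝ≥0)
    simpa [e] using this
  rw [add_zero] at ht
  exact ge_of_tendsto' ht fun n => (hd n).1.1

/-- A seminorm is a quotient seminorm when the morphism does not increase seminorms and has exact
lifts. -/
theorem eq_iInf_of_lift {D X : Space.{u} F} (π : D.carrier →⋆ₐ[ℂ] X.carrier)
    (hle : ∀ d, X.L (mapSA π d) ≤ D.L d)
    (hlift : ∀ (a : selfAdjoint X.carrier) (l : ℝ≥0), X.L a ≤ l → ∃ d, mapSA π d = a ∧ D.L d ≤ l)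
    (a : selfAdjoint X.carrier) :
    X.L a = ⨅ (d : selfAdjoint D.carrier) (_ : π d = a), D.L d := by
  refine le_antisymm (le_iInf₂ fun d hd => ?_) ?_
  · have : mapSA π d = a := Subtype.ext hd
    rw [← this]; exact hle d
  · rcases eq_or_ne (X.L a) ⊤ with h | h
    · rw [h]; exact le_top
    · obtain ⟨d, hd, hL⟩ := hlift a (X.L a).toNNReal (ENNReal.coe_toNNReal h).ge
      rw [ENNReal.coe_toNNReal h] at hL
      exact (iInf₂_le d ((mapSA_eq_iff π d a).1 hd)).trans hL

/-- The Hausdorff distance between the states of `D` and those factoring through a morphism `π` is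
at most `r` exactly when `‖d‖ ≤ ‖π(d)‖ + r L(d)` for every self-adjoint `d`. The states of `D` that
are close to a given one are found with the Hahn-Banach theorem. -/
theorem hausdorff_le_iff (D : Space.{u} F) {B : Type u} [CStarAlgebra B] [Nontrivial B]
    (π : D.carrier →⋆ₐ[ℂ] B) (r : ℝ≥0) :
    hausdorff D.kantorovich Set.univ (Set.range (pullback π)) ≤ r ↔
      ∀ (d : selfAdjoint D.carrier) (l : ℝ≥0), D.L d ≤ l → ‖d‖ ≤ ‖mapSA π d‖ + r * l := by
  constructor
  · intro h d l hd
    have hr' : ∀ δ : ℝ≥0, 0 < δ → ‖d‖ ≤ ‖mapSA π d‖ + (r + δ : ℝ≥0) * l := by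
      intro δ hδ
      obtain ⟨φ, hφ⟩ := exists_state_abs_eq_norm d
      have h1 : ⨅ y ∈ Set.range (pullback π), D.kantorovich φ y < (r + δ : ℝ≥0) := by
        refine lt_of_le_of_lt ?_ (show (r : ℝ≥0∞) < (r + δ : ℝ≥0) by
          exact_mod_cast lt_add_of_pos_right r hδ)
        refine le_trans ?_ ((le_max_left _ _).trans h)
        exact le_iSup₂ (f := fun φ (_ : φ ∈ Set.univ) =>
          ⨅ y ∈ Set.range (pullback π), D.kantorovich φ y) φ (Set.mem_univ φ)
      simp only [iInf_lt_iff] at h1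
      obtain ⟨_, ⟨ψ, rfl⟩, hψ⟩ := h1
      have h2 := D.abs_sub_le_of_kantorovich hψ.le hd
      rw [stateRe_pullback π ψ d (mapSA π d) rfl] at h2
      have h3 := abs_state_le ψ (mapSA π d)
      rw [← hφ]
      have := abs_sub_abs_le_abs_sub (stateRe φ d) (stateRe ψ (mapSA π d))
      linarith
    have ht : Tendsto (fun n : ℕ => ‖mapSA π d‖ + ((r + ((n : ℝ≥0) + 1)⁻¹ : ℝ≥0) : ℝ) * l) atTop
        (𝓝 (‖mapSA π d‖ + ((r + 0 : ℝ≥0) : ℝ) * l)) := by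
      refine tendsto_const_nhds.add (Tendsto.mul_const _ ?_)
      refine NNReal.tendsto_coe.2 (tendsto_const_nhds.add ?_)
      have := tendsto_one_div_add_atTop_nhds_zero_nat (𝕜 := ℝ≥0)
      simpa using this
    rw [add_zero] at ht
    exact ge_of_tendsto' ht fun n => hr' _ (by positivity)
  · intro h
    refine max_le (iSup₂_le fun Φ _ => ?_) (iSup₂_le fun φ _ => ?_)
    · -- On pairs `(b, d)`, the functional `Φ(d)` is dominated by `‖b‖ + r L(d)` on the graph of `π`.
      -- An extension `g` is `f(b) + h(d)` with `f` a state of `B` and `h = Φ - f ∘ π` at most `r L`.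
      let N : selfAdjoint B × D.dom → ℝ := fun p => ‖p.1‖ + r * (D.L p.2).toReal
      let l : selfAdjoint B × D.dom →ₗ[ℝ] ℝ :=
        (stateRe Φ).comp (D.dom.subtype.comp (LinearMap.snd ℝ _ _))
      let W : Submodule ℝ (selfAdjoint B × D.dom) :=
        LinearMap.range (((mapSA π).comp D.dom.subtype).prod LinearMap.id)
      obtain ⟨g, hgW, hgN⟩ := exists_extension_of_le_sublinear_on W l N
        (fun c hc p => by
          simp only [N, Prod.smul_fst, Prod.smul_snd, norm_smul, Real.norm_of_nonneg hc.le,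
            Submodule.coe_smul, D.L_smul, ENNReal.toReal_mul, toReal_enorm]
          ring)
        (fun p q => by
          have h1 : D.L ((p + q).2 : D.dom) ≤ D.L p.2 + D.L q.2 := D.L_add _ _
          have h2 := ENNReal.toReal_mono (ENNReal.add_ne_top.2 ⟨p.2.2.ne, q.2.2.ne⟩) h1
          rw [ENNReal.toReal_add p.2.2.ne q.2.2.ne] at h2
          have h3 := norm_add_le p.1 q.1
          have h4 := mul_le_mul_of_nonneg_left h2 r.coe_nonneg
          simp only [N, Prod.fst_add] at *
          linarith)
        (by
          rintro _ ⟨d, rfl⟩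
          refine (le_abs_self _).trans ((abs_state_le Φ (d : selfAdjoint D.carrier)).trans ?_)
          have := h d (D.L d).toNNReal (ENNReal.coe_toNNReal d.2.ne).ge
          exact this)
      let f : selfAdjoint B →ₗ[ℝ] ℝ := g.comp (LinearMap.inl ℝ _ _)
      have hf : ∀ b, f b ≤ ‖b‖ := fun b => by
        have := hgN (b, 0)
        simp only [N, ZeroMemClass.coe_zero, D.L_zero, ENNReal.toReal_zero, mul_zero,
          add_zero] at this
        exact this
      have hd : ∀ d : D.dom, stateRe Φ d - f (mapSA π d) ≤ r * (D.L d).toReal := by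
        intro d
        have h1 : g (mapSA π d, d) = stateRe Φ d := hgW _ ⟨d, rfl⟩
        have h2 : g (mapSA π d, d) = f (mapSA π d) + g (0, d) := by
          simp only [f, LinearMap.comp_apply, LinearMap.inl_apply]
          rw [← map_add]; simp
        have h3 := hgN (0, d)
        simp only [N, norm_zero, zero_add] at h3
        linarith
      have hf1 : f 1 = 1 := by
        refine le_antisymm ((hf 1).trans_eq norm_selfAdjoint_one) ?_
        have := hd ⟨1, by change D.L 1 < ⊤; rw [D.L_one]; exact ENNReal.zero_lt_top⟩
        simp only [D.L_one, mapSA_one, state_apply_one, ENNReal.toReal_zero, mul_zero] at this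
        linarith
      obtain ⟨φ, hφ⟩ := exists_state_of_le_norm f hf1 hf
      refine (iInf₂_le (pullback π φ) ⟨φ, rfl⟩).trans ?_
      refine (mongeKantorovich_le_iff _ _ _ _).2 fun d hdL => ?_
      rw [stateRe_pullback π φ d (mapSA π d) rfl, hφ]
      have hfin : D.L d < ⊤ := hdL.trans_lt ENNReal.one_lt_top
      have h1 : (D.L d).toReal ≤ 1 := ENNReal.toReal_le_of_le_ofReal zero_le_one (by simpa using hdL)
      have h2 := hd ⟨d, hfin⟩
      have h3 := hd (-⟨d, hfin⟩)
      simp only [NegMemClass.coe_neg, map_neg, D.L_neg] at h3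
      have h4 := mul_le_mul_of_nonneg_left h1 r.coe_nonneg
      simp only at h2
      rw [abs_le]; constructor <;> linarith
    · refine (iInf₂_le φ (Set.mem_univ φ)).trans ?_
      change mongeKantorovich D.L φ φ ≤ r
      rw [mongeKantorovich_self]; exact zero_le

end Space

/-! ### Tunnels -/

namespace Tunnel

variable {X Y : Space.{u} F}

theorem L_map₁_le (τ : Tunnel X Y) (d : selfAdjoint τ.D.carrier) :
    X.L (mapSA τ.π₁ d) ≤ τ.D.L d := by
  rw [τ.quotient₁]
  exact iInf₂_le (f := fun (d : selfAdjoint τ.D.carrier) (_ : τ.π₁ d = _) => τ.D.L d) d rfl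

theorem L_map₂_le (τ : Tunnel X Y) (d : selfAdjoint τ.D.carrier) :
    Y.L (mapSA τ.π₂ d) ≤ τ.D.L d := by
  rw [τ.quotient₂]
  exact iInf₂_le (f := fun (d : selfAdjoint τ.D.carrier) (_ : τ.π₂ d = _) => τ.D.L d) d rfl

theorem exists_lift₁ (τ : Tunnel X Y) {a : selfAdjoint X.carrier} {l : ℝ≥0} (h : X.L a ≤ l) :
    ∃ d, mapSA τ.π₁ d = a ∧ τ.D.L d ≤ l :=
  τ.D.exists_lift τ.π₁ (by rwa [← τ.quotient₁])

theorem exists_lift₂ (τ : Tunnel X Y) {a : selfAdjoint Y.carrier} {l : ℝ≥0} (h : Y.L a ≤ l) :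
    ∃ d, mapSA τ.π₂ d = a ∧ τ.D.L d ≤ l :=
  τ.D.exists_lift τ.π₂ (by rwa [← τ.quotient₂])

/-- The inverse tunnel. -/
def symm (τ : Tunnel X Y) : Tunnel Y X :=
  ⟨τ.D, τ.π₂, τ.π₁, τ.surj₂, τ.surj₁, τ.quotient₂, τ.quotient₁⟩

theorem extent_symm (τ : Tunnel X Y) : τ.symm.extent = τ.extent := max_comm _ _

/-- The norm estimates equivalent to an upper bound of the extent of a tunnel. -/
structure ExtentLE (τ : Tunnel X Y) (r : ℝ≥0) : Prop where
  left : ∀ (d : selfAdjoint τ.D.carrier) (l : ℝ≥0), τ.D.L d ≤ l → ‖d‖ ≤ ‖mapSA τ.π₁ d‖ + r * l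
  right : ∀ (d : selfAdjoint τ.D.carrier) (l : ℝ≥0), τ.D.L d ≤ l → ‖d‖ ≤ ‖mapSA τ.π₂ d‖ + r * l

theorem extent_le_iff (τ : Tunnel X Y) (r : ℝ≥0) : τ.extent ≤ r ↔ τ.ExtentLE r := by
  rw [extent, max_le_iff, Space.hausdorff_le_iff, Space.hausdorff_le_iff]
  exact ⟨fun h => ⟨h.1, h.2⟩, fun h => ⟨h.1, h.2⟩⟩

/-- Construction of tunnels from exact lifts. -/
def ofLifts (D : Space.{u} F) (π₁ : D.carrier →⋆ₐ[ℂ] X.carrier) (π₂ : D.carrier →⋆ₐ[ℂ] Y.carrier)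
    (surj₁ : Function.Surjective π₁) (surj₂ : Function.Surjective π₂)
    (hle₁ : ∀ d, X.L (mapSA π₁ d) ≤ D.L d) (hle₂ : ∀ d, Y.L (mapSA π₂ d) ≤ D.L d)
    (hlift₁ : ∀ (a : selfAdjoint X.carrier) (l : ℝ≥0), X.L a ≤ l →
      ∃ d, mapSA π₁ d = a ∧ D.L d ≤ l)
    (hlift₂ : ∀ (a : selfAdjoint Y.carrier) (l : ℝ≥0), Y.L a ≤ l →
      ∃ d, mapSA π₂ d = a ∧ D.L d ≤ l) : Tunnel X Y :=
  ⟨D, π₁, π₂, surj₁, surj₂, Space.eq_iInf_of_lift π₁ hle₁ hlift₁,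
    Space.eq_iInf_of_lift π₂ hle₂ hlift₂⟩

end Tunnel

theorem propinquity_le {X Y : Space.{u} F} (τ : Tunnel X Y) {r : ℝ≥0} (h : τ.ExtentLE r) :
    propinquity X Y ≤ r :=
  (iInf_le _ τ).trans ((τ.extent_le_iff r).2 h)

theorem exists_tunnel {X Y : Space.{u} F} {r : ℝ≥0} (h : propinquity X Y < r) :
    ∃ τ : Tunnel X Y, τ.ExtentLE r := by
  obtain ⟨τ, hτ⟩ := iInf_lt_iff.1 h
  exact ⟨τ, (τ.extent_le_iff r).1 hτ.le⟩

theorem propinquity_comm (X Y : Space.{u} F) : propinquity X Y = propinquity Y X :=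
  le_antisymm (le_iInf fun τ => (iInf_le _ τ.symm).trans_eq τ.extent_symm)
    (le_iInf fun τ => (iInf_le _ τ.symm).trans_eq τ.extent_symm)

/-- A *-isomorphism identifying the seminorms gives a tunnel of extent zero. -/
theorem propinquity_eq_zero_of_equiv {X Y : Space.{u} F} (π : X.carrier ≃⋆ₐ[ℂ] Y.carrier)
    (h : ∀ a, Y.L (mapSA (π : X.carrier →⋆ₐ[ℂ] Y.carrier) a) = X.L a) : propinquity X Y = 0 := by
  have hs : Function.Surjective (π : X.carrier →⋆ₐ[ℂ] Y.carrier) := π.surjective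
  let τ : Tunnel X Y := Tunnel.ofLifts X (StarAlgHom.id ℂ _) (π : X.carrier →⋆ₐ[ℂ] Y.carrier)
    Function.surjective_id hs (fun d => le_rfl) (fun d => (h d).le)
    (fun a l ha => ⟨a, rfl, ha⟩) (fun a l ha => by
      obtain ⟨d, rfl⟩ := surjective_mapSA _ hs a
      exact ⟨d, rfl, by rwa [← h]⟩)
  have : propinquity X Y ≤ (0 : ℝ≥0) := propinquity_le τ
    ⟨fun d l _ => by
      rw [NNReal.coe_zero, zero_mul, add_zero]; exact le_rfl,
    fun d l _ => by
      rw [NNReal.coe_zero, zero_mul, add_zero]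
      exact (norm_mapSA_of_injective (π : X.carrier →⋆ₐ[ℂ] Y.carrier) π.injective d).ge⟩
  simpa using this

theorem propinquity_self (X : Space.{u} F) : propinquity X X = 0 :=
  propinquity_eq_zero_of_equiv (StarAlgEquiv.refl ℂ X.carrier) fun _ => rfl

/-- A *-isomorphism identifying the seminorms is dual to an isometry of the state spaces. -/
theorem isometric_of_equiv {X Y : Space.{u} F} (π : X.carrier ≃⋆ₐ[ℂ] Y.carrier)
    (h : ∀ a, Y.L (mapSA (π : X.carrier →⋆ₐ[ℂ] Y.carrier) a) = X.L a) : Isometric X Y := by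
  have hs : Function.Surjective (π : X.carrier →⋆ₐ[ℂ] Y.carrier) := π.surjective
  refine ⟨π, fun φ ψ => le_antisymm (iSup₂_le fun a ha => ?_) (iSup₂_le fun b hb => ?_)⟩
  · exact le_iSup₂ (f := fun (a : selfAdjoint Y.carrier) (_ : Y.L a ≤ 1) =>
      ‖φ.1 (a : Y.carrier) - ψ.1 (a : Y.carrier)‖ₑ)
      (mapSA (π : X.carrier →⋆ₐ[ℂ] Y.carrier) a) (by rwa [h])
  · obtain ⟨a, rfl⟩ := surjective_mapSA _ hs b
    rw [h] at hb
    exact le_iSup₂ (f := fun (a : selfAdjoint X.carrier) (_ : X.L a ≤ 1) =>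
      ‖(pullback (π : X.carrier →⋆ₐ[ℂ] Y.carrier) φ).1 (a : X.carrier) -
        (pullback (π : X.carrier →⋆ₐ[ℂ] Y.carrier) ψ).1 (a : X.carrier)‖ₑ) a hb

/-- An isometric isomorphism identifies the seminorms, because they are determined by the
Monge-Kantorovich metrics. -/
theorem Isometric.propinquity_eq_zero {X Y : Space.{u} F} (h : Isometric X Y) :
    propinquity X Y = 0 := by
  obtain ⟨π, hπ⟩ := h
  refine propinquity_eq_zero_of_equiv π ?_
  let p : X.carrier →⋆ₐ[ℂ] Y.carrier := π
  let q : Y.carrier →⋆ₐ[ℂ] X.carrier := π.symm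
  have hpq : ∀ y, p (q y) = y := π.apply_symm_apply
  have hqp : ∀ x, q (p x) = x := π.symm_apply_apply
  have hpull : ∀ φ : StateSpace X.carrier, pullback p (pullback q φ) = φ := fun φ =>
    Subtype.ext (ContinuousLinearMap.ext fun x => by
      change φ.1 (q (p x)) = φ.1 x
      rw [hqp])
  have h1 : ∀ a, X.L a ≤ 1 → Y.L (mapSA p a) ≤ 1 := by
    intro a ha
    refine Y.L_le_one_of_kantorovich fun φ ψ r hr => ?_
    rw [← hπ] at hr
    have := X.abs_sub_le_of_kantorovich hr (l := 1) (by simpa using ha)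
    rw [stateRe_pullback _ φ a (mapSA p a) rfl, stateRe_pullback _ ψ a (mapSA p a) rfl] at this
    simpa using this
  have h2 : ∀ a, Y.L (mapSA p a) ≤ 1 → X.L a ≤ 1 := by
    intro a ha
    refine X.L_le_one_of_kantorovich fun φ ψ r hr => ?_
    have hr' : Y.kantorovich (pullback q φ) (pullback q ψ) ≤ r := by
      rw [← hπ]
      change X.kantorovich (pullback p (pullback q φ)) (pullback p (pullback q ψ)) ≤ r
      rwa [hpull, hpull]
    have := Y.abs_sub_le_of_kantorovich hr' (l := 1) (by simpa using ha)
    rw [stateRe_pullback q φ (mapSA p a) a (hqp a), stateRe_pullback q ψ (mapSA p a) a (hqp a)]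
      at this
    simpa using this
  intro a
  have hY : ∀ (t : ℝ) a, Y.L (mapSA p (t • a)) = ‖t‖ₑ * Y.L (mapSA p a) := fun t a => by
    rw [map_smul, Y.L_smul]
  exact le_antisymm
    (le_of_unitBall_subset (L₁ := X.L) (L₂ := fun a => Y.L (mapSA p a)) X.L_smul hY h1 a)
    (le_of_unitBall_subset (L₁ := fun a => Y.L (mapSA p a)) (L₂ := X.L) hY X.L_smul h2 a)

/-- The diameter is Lipschitz for the propinquity. -/
theorem diam_le_add {X Y : Space.{u} F} {r : ℝ≥0} (h : propinquity X Y < r) :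
    X.diam ≤ Y.diam + 2 * r := by
  obtain ⟨τ, hτ⟩ := iInf_lt_iff.1 h
  refine iSup₂_le fun φ ψ => ?_
  have h1 : X.kantorovich φ ψ ≤ τ.D.kantorovich (pullback τ.π₁ φ) (pullback τ.π₁ ψ) := by
    refine iSup₂_le fun a ha => ?_
    obtain ⟨d, rfl, hd⟩ := τ.exists_lift₁ (l := 1) (by simpa using ha)
    exact le_iSup₂ (f := fun (a : selfAdjoint τ.D.carrier) (_ : τ.D.L a ≤ 1) =>
      ‖(pullback τ.π₁ φ).1 (a : τ.D.carrier) - (pullback τ.π₁ ψ).1 (a : τ.D.carrier)‖ₑ) d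
      (by simpa using hd)
  have h2 : ∀ Φ : StateSpace τ.D.carrier, ∃ θ : StateSpace Y.carrier,
      τ.D.kantorovich Φ (pullback τ.π₂ θ) < r := by
    intro Φ
    have h3 : ⨅ y ∈ Set.range (pullback τ.π₂), τ.D.kantorovich Φ y < r := by
      refine lt_of_le_of_lt ?_ hτ
      refine le_trans ?_ ((le_max_left _ _).trans (le_max_right _ _))
      exact le_iSup₂ (f := fun φ (_ : φ ∈ Set.univ) =>
        ⨅ y ∈ Set.range (pullback τ.π₂), τ.D.kantorovich φ y) Φ (Set.mem_univ Φ)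
    simp only [iInf_lt_iff] at h3
    obtain ⟨_, ⟨θ, rfl⟩, hθ⟩ := h3
    exact ⟨θ, hθ⟩
  obtain ⟨φ', hφ'⟩ := h2 (pullback τ.π₁ φ)
  obtain ⟨ψ', hψ'⟩ := h2 (pullback τ.π₁ ψ)
  have h4 : τ.D.kantorovich (pullback τ.π₂ φ') (pullback τ.π₂ ψ') ≤ Y.kantorovich φ' ψ' := by
    refine iSup₂_le fun d hd => ?_
    exact le_iSup₂ (f := fun (a : selfAdjoint Y.carrier) (_ : Y.L a ≤ 1) =>
      ‖φ'.1 (a : Y.carrier) - ψ'.1 (a : Y.carrier)‖ₑ) (mapSA τ.π₂ d) ((τ.L_map₂_le d).trans hd)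
  have h5 : Y.kantorovich φ' ψ' ≤ Y.diam := le_iSup₂ (f := fun φ ψ => Y.kantorovich φ ψ) φ' ψ'
  have t1 := mongeKantorovich_triangle τ.D.L (pullback τ.π₁ φ) (pullback τ.π₂ φ') (pullback τ.π₁ ψ)
  have t2 := mongeKantorovich_triangle τ.D.L (pullback τ.π₂ φ') (pullback τ.π₂ ψ') (pullback τ.π₁ ψ)
  have h6 : mongeKantorovich τ.D.L (pullback τ.π₂ ψ') (pullback τ.π₁ ψ) ≤ r := by
    rw [mongeKantorovich_comm]; exact hψ'.le
  calc X.kantorovich φ ψ ≤ _ := h1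
    _ ≤ _ := t1
    _ ≤ r + (Y.diam + r) := add_le_add hφ'.le (t2.trans (add_le_add (h4.trans h5) h6))
    _ = Y.diam + 2 * r := by ring

end

end QuasiLeibniz

namespace QuasiLeibniz

noncomputable section

open Filter Topology

variable {F : ℝ≥0 × ℝ≥0 × ℝ≥0 × ℝ≥0 → ℝ≥0}

/-! ### Gluing two spaces along a common target -/

section Pair

variable {A B : Type u} [CStarAlgebra A] [CStarAlgebra B]

/-- A pair of self-adjoint elements as a self-adjoint element of the product. -/
def pairSA (a : selfAdjoint A) (b : selfAdjoint B) : selfAdjoint (A × B) :=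
  ⟨(a, b), Prod.ext a.2 b.2⟩

theorem mapSA_fst_pairSA (a : selfAdjoint A) (b : selfAdjoint B) :
    mapSA (StarAlgHom.fst ℂ A B) (pairSA a b) = a := rfl

theorem mapSA_snd_pairSA (a : selfAdjoint A) (b : selfAdjoint B) :
    mapSA (StarAlgHom.snd ℂ A B) (pairSA a b) = b := rfl

theorem norm_eq_max_mapSA (p : selfAdjoint (A × B)) :
    ‖p‖ = max ‖mapSA (StarAlgHom.fst ℂ A B) p‖ ‖mapSA (StarAlgHom.snd ℂ A B) p‖ := rfl

theorem ext_mapSA {p q : selfAdjoint (A × B)}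
    (h₁ : mapSA (StarAlgHom.fst ℂ A B) p = mapSA (StarAlgHom.fst ℂ A B) q)
    (h₂ : mapSA (StarAlgHom.snd ℂ A B) p = mapSA (StarAlgHom.snd ℂ A B) q) : p = q :=
  Subtype.ext (Prod.ext (Subtype.ext_iff.1 h₁) (Subtype.ext_iff.1 h₂))

end Pair

section Bridge

variable (X Y : Space.{u} F) {E : Type v} [CStarAlgebra E]
  (f : X.carrier →⋆ₐ[ℂ] E) (g : Y.carrier →⋆ₐ[ℂ] E) (ε : ℝ≥0)

/-- The difference `f(a) - g(b)` of the images of a pair in the common target. -/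
def bridgeDiff : selfAdjoint (X.carrier × Y.carrier) →ₗ[ℝ] selfAdjoint E :=
  (mapSA f).comp (mapSA (StarAlgHom.fst ℂ _ _)) - (mapSA g).comp (mapSA (StarAlgHom.snd ℂ _ _))

/-- The seminorm `(a, b) ↦ max (L(a), L(b), ‖f(a) - g(b)‖ / ε)` on a direct sum. -/
def bridgeL (p : selfAdjoint (X.carrier × Y.carrier)) : ℝ≥0∞ :=
  max (max (X.L (mapSA (StarAlgHom.fst ℂ _ _) p)) (Y.L (mapSA (StarAlgHom.snd ℂ _ _) p)))
    ((ε⁻¹ * ‖bridgeDiff X Y f g p‖₊ : ℝ≥0) : ℝ≥0∞)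

theorem bridgeDiff_apply (p : selfAdjoint (X.carrier × Y.carrier)) :
    bridgeDiff X Y f g p = mapSA f (mapSA (StarAlgHom.fst ℂ _ _) p) -
      mapSA g (mapSA (StarAlgHom.snd ℂ _ _) p) := rfl

theorem bridgeL_le_iff (hε : 0 < ε) (p : selfAdjoint (X.carrier × Y.carrier)) (l : ℝ≥0) :
    bridgeL X Y f g ε p ≤ l ↔ X.L (mapSA (StarAlgHom.fst ℂ _ _) p) ≤ l ∧
      Y.L (mapSA (StarAlgHom.snd ℂ _ _) p) ≤ l ∧ ‖bridgeDiff X Y f g p‖ ≤ ε * l := by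
  rw [bridgeL, max_le_iff, max_le_iff, and_assoc, ENNReal.coe_le_coe, inv_mul_le_iff₀ hε]
  rfl

theorem fst_le_bridgeL (p : selfAdjoint (X.carrier × Y.carrier)) :
    X.L (mapSA (StarAlgHom.fst ℂ _ _) p) ≤ bridgeL X Y f g ε p :=
  (le_max_left _ _).trans (le_max_left _ _)

theorem snd_le_bridgeL (p : selfAdjoint (X.carrier × Y.carrier)) :
    Y.L (mapSA (StarAlgHom.snd ℂ _ _) p) ≤ bridgeL X Y f g ε p :=
  (le_max_right _ _).trans (le_max_left _ _)

theorem bridgeL_add (p q : selfAdjoint (X.carrier × Y.carrier)) :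
    bridgeL X Y f g ε (p + q) ≤ bridgeL X Y f g ε p + bridgeL X Y f g ε q := by
  refine max_le (max_le ?_ ?_) ?_
  · rw [map_add]
    exact (X.L_add _ _).trans (add_le_add (fst_le_bridgeL ..) (fst_le_bridgeL ..))
  · rw [map_add]
    exact (Y.L_add _ _).trans (add_le_add (snd_le_bridgeL ..) (snd_le_bridgeL ..))
  · refine le_trans ?_ (add_le_add (le_max_right _ _) (le_max_right _ _))
    rw [map_add, ← ENNReal.coe_add, ENNReal.coe_le_coe, ← mul_add]
    exact mul_le_mul_right (nnnorm_add_le _ _) _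

theorem bridgeL_smul (t : ℝ) (p : selfAdjoint (X.carrier × Y.carrier)) :
    bridgeL X Y f g ε (t • p) = ‖t‖ₑ * bridgeL X Y f g ε p := by
  have hm : ∀ a b c : ℝ≥0∞, a * max b c = max (a * b) (a * c) := fun a b c =>
    Monotone.map_max (f := fun x : ℝ≥0∞ => a * x) fun x y h => mul_le_mul_right h a
  rw [bridgeL, bridgeL, map_smul, map_smul, map_smul, X.L_smul, Y.L_smul, hm, hm, nnnorm_smul,
    ENNReal.coe_mul, ENNReal.coe_mul, ENNReal.coe_mul]
  congr 1
  change _ * (‖t‖ₑ * _) = _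
  ring

theorem bridgeL_dense : Dense {p | bridgeL X Y f g ε p < ⊤} := by
  rw [Metric.dense_iff]
  intro p r hr
  obtain ⟨a, ha, hLa⟩ := Metric.dense_iff.1 X.dense_dom (mapSA (StarAlgHom.fst ℂ _ _) p) r hr
  obtain ⟨b, hb, hLb⟩ := Metric.dense_iff.1 Y.dense_dom (mapSA (StarAlgHom.snd ℂ _ _) p) r hr
  refine ⟨pairSA a b, ?_, max_lt (max_lt hLa hLb) ENNReal.coe_lt_top⟩
  rw [Metric.mem_ball, dist_eq_norm] at *
  rw [norm_eq_max_mapSA, map_sub, map_sub]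
  exact max_lt ha hb

theorem bridgeL_scalar (t : ℝ) : bridgeL X Y f g ε (t • 1) = 0 := by
  rw [bridgeL, bridgeDiff_apply, mapSA_scalar, mapSA_scalar, mapSA_scalar, mapSA_scalar, sub_self,
    X.L_scalar, Y.L_scalar]
  simp

theorem bridgeL_eq_zero [Nontrivial E] (hε : 0 < ε) (p : selfAdjoint (X.carrier × Y.carrier)) :
    bridgeL X Y f g ε p = 0 ↔ ∃ t : ℝ, p = t • (1 : selfAdjoint (X.carrier × Y.carrier)) := by
  constructor
  · intro h
    obtain ⟨h1, h2, h3⟩ := (bridgeL_le_iff X Y f g ε hε p 0).1 (by simp [h])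
    obtain ⟨t, ht⟩ := (X.L_eq_zero _).1 (le_antisymm (by simpa using h1) zero_le)
    obtain ⟨s, hs⟩ := (Y.L_eq_zero _).1 (le_antisymm (by simpa using h2) zero_le)
    rw [bridgeDiff_apply, ht, hs, mapSA_scalar, mapSA_scalar, ← sub_smul, norm_smul,
      norm_selfAdjoint_one, NNReal.coe_zero, mul_zero, mul_one, norm_le_zero_iff, sub_eq_zero] at h3
    refine ⟨t, ext_mapSA ?_ ?_⟩
    · rw [ht, mapSA_scalar]
    · rw [hs, mapSA_scalar, h3]
  · rintro ⟨t, rfl⟩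
    exact bridgeL_scalar X Y f g ε t

theorem isClosed_bridgeL (hε : 0 < ε) : IsClosed {p | bridgeL X Y f g ε p ≤ 1} := by
  have : {p | bridgeL X Y f g ε p ≤ 1} =
      (mapSA (StarAlgHom.fst ℂ _ _)) ⁻¹' {a | X.L a ≤ (1 : ℝ≥0)} ∩
      ((mapSA (StarAlgHom.snd ℂ _ _)) ⁻¹' {b | Y.L b ≤ (1 : ℝ≥0)} ∩
        {p | ‖bridgeDiff X Y f g p‖ ≤ ε * (1 : ℝ≥0)}) := by
    ext p
    have := bridgeL_le_iff X Y f g ε hε p 1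
    rw [ENNReal.coe_one] at this
    exact this
  rw [this]
  refine ((X.isClosed_L_le 1).preimage (continuous_mapSA _)).inter
    (((Y.isClosed_L_le 1).preimage (continuous_mapSA _)).inter
      (isClosed_le (Continuous.norm ?_) continuous_const))
  exact ((continuous_mapSA f).comp (continuous_mapSA _)).sub
    ((continuous_mapSA g).comp (continuous_mapSA _))

theorem bridgeL_totallyBounded [Nontrivial E] (hε : 0 < ε) :
    ∃ K : Set (selfAdjoint (X.carrier × Y.carrier)), TotallyBounded K ∧
      ∀ p, bridgeL X Y f g ε p ≤ 1 → ∃ t : ℝ, p - t • (1 : selfAdjoint (X.carrier × Y.carrier)) ∈ K := by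
  obtain ⟨R, hR⟩ := ENNReal.lt_iff_exists_coe.1 X.diam_lt_top
  obtain ⟨S, hS⟩ := ENNReal.lt_iff_exists_coe.1 Y.diam_lt_top
  refine ⟨{p | (X.L (mapSA (StarAlgHom.fst ℂ _ _) p) ≤ (1 : ℝ≥0) ∧
      ‖mapSA (StarAlgHom.fst ℂ _ _) p‖ ≤ R) ∧ Y.L (mapSA (StarAlgHom.snd ℂ _ _) p) ≤ (1 : ℝ≥0) ∧
      ‖mapSA (StarAlgHom.snd ℂ _ _) p‖ ≤ (ε + R + 2 * S : ℝ≥0)}, ?_, ?_⟩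
  · refine totallyBounded_of_approx.{u, u} fun δ hδ => ⟨_, inferInstance,
      fun p => (mapSA (StarAlgHom.fst ℂ X.carrier Y.carrier) p,
        mapSA (StarAlgHom.snd ℂ X.carrier Y.carrier) p), ?_, δ, hδ, ?_⟩
    · refine (((X.isCompact_ball 1 R).prod (Y.isCompact_ball 1 (ε + R + 2 * S))).totallyBounded).subset ?_
      rintro _ ⟨p, hp, rfl⟩
      exact hp
    · intro p _ q _ h
      exact h
  · intro p hp
    obtain ⟨h1, h2, h3⟩ := (bridgeL_le_iff X Y f g ε hε p 1).1 (by simpa using hp)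
    obtain ⟨t, ht⟩ := X.exists_norm_sub_scalar_le hR.1.le h1
    obtain ⟨s, hs⟩ := Y.exists_norm_sub_scalar_le hS.1.le h2
    refine ⟨t, ⟨?_, ?_⟩, ?_, ?_⟩
    · rwa [map_sub, mapSA_scalar, X.L_sub_scalar]
    · rw [map_sub, mapSA_scalar]; simpa using ht
    · rwa [map_sub, mapSA_scalar, Y.L_sub_scalar]
    · rw [map_sub, mapSA_scalar]
      set a := mapSA (StarAlgHom.fst ℂ X.carrier Y.carrier) p
      set b := mapSA (StarAlgHom.snd ℂ X.carrier Y.carrier) p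
      -- The two scalars are close as their images in `E` are.
      have hts : |s - t| ≤ S + ε + R := by
        have e : (s - t) • (1 : selfAdjoint E) =
            -(mapSA g (b - s • 1)) - bridgeDiff X Y f g p + mapSA f (a - t • 1) := by
          rw [bridgeDiff_apply, map_sub, map_sub, mapSA_scalar, mapSA_scalar, sub_smul]
          abel
        have h4 : ‖(s - t) • (1 : selfAdjoint E)‖ = |s - t| := by
          rw [norm_smul, norm_selfAdjoint_one, mul_one]; rfl
        rw [← h4, e]
        refine (norm_add_le _ _).trans (add_le_add ((norm_sub_le _ _).trans (add_le_add ?_ ?_)) ?_)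
        · rw [norm_neg]
          exact (norm_mapSA_le g _).trans (by simpa using hs)
        · simpa using h3
        · exact (norm_mapSA_le f _).trans (by simpa using ht)
      have e : b - t • (1 : selfAdjoint Y.carrier) = (b - s • 1) + (s - t) • 1 := by
        rw [sub_smul]; abel
      rw [e]
      refine (norm_add_le _ _).trans ?_
      have h4 : ‖(s - t) • (1 : selfAdjoint Y.carrier)‖ = |s - t| := by
        rw [norm_smul, norm_selfAdjoint_one, mul_one]; rfl
      rw [h4]
      simp only [NNReal.coe_one, mul_one] at hs
      push_cast
      linarith

/-- The products of pairs satisfy `‖f(aa') - g(bb')‖ ≤ ‖f(a) - g(b)‖ ‖a'‖ + ‖b‖ ‖f(a') - g(b')‖`, which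
is where `x l_y + y l_x ≤ F(x, y, l_x, l_y)` is needed. -/
theorem bridgeL_leibniz (hF : Permissible F) (hε : 0 < ε) (i : Bool)
    (p q : selfAdjoint (X.carrier × Y.carrier)) (l m : ℝ≥0) (hp : bridgeL X Y f g ε p ≤ l)
    (hq : bridgeL X Y f g ε q ≤ m) : bridgeL X Y f g ε (jl i p q) ≤
      F (‖(p : X.carrier × Y.carrier)‖₊, ‖(q : X.carrier × Y.carrier)‖₊, l, m) := by
  obtain ⟨a1, a2, a3⟩ := (bridgeL_le_iff X Y f g ε hε p l).1 hp
  obtain ⟨b1, b2, b3⟩ := (bridgeL_le_iff X Y f g ε hε q m).1 hq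
  refine (bridgeL_le_iff X Y f g ε hε _ _).2 ⟨?_, ?_, ?_⟩
  · rw [mapSA_jl]
    exact X.L_jl_le hF i (norm_mapSA_le _ p) (norm_mapSA_le _ q) a1 b1
  · rw [mapSA_jl]
    exact Y.L_jl_le hF i (norm_mapSA_le _ p) (norm_mapSA_le _ q) a2 b2
  · rw [bridgeDiff_apply, mapSA_jl, mapSA_jl, mapSA_jl, mapSA_jl, jl_sub_jl]
    have k1 : ‖jl i (mapSA f (mapSA (StarAlgHom.fst ℂ _ _) p) -
        mapSA g (mapSA (StarAlgHom.snd ℂ _ _) p)) (mapSA f (mapSA (StarAlgHom.fst ℂ _ _) q))‖ ≤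
        ε * l * ‖q‖ :=
      (norm_jl_le _ _ _).trans (mul_le_mul a3 ((norm_mapSA_le f _).trans (norm_mapSA_le _ _))
        (norm_nonneg _) (by positivity))
    have k2 : ‖jl i (mapSA g (mapSA (StarAlgHom.snd ℂ _ _) p))
        (mapSA f (mapSA (StarAlgHom.fst ℂ _ _) q) - mapSA g (mapSA (StarAlgHom.snd ℂ _ _) q))‖ ≤
        ‖p‖ * (ε * m) :=
      (norm_jl_le _ _ _).trans (mul_le_mul ((norm_mapSA_le g _).trans (norm_mapSA_le _ _)) b3
        (norm_nonneg _) (by positivity))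
    refine (norm_add_le _ _).trans ((add_le_add k1 k2).trans ?_)
    have := hF.le_apply ‖(p : X.carrier × Y.carrier)‖₊ ‖(q : X.carrier × Y.carrier)‖₊ l m
    have h4 := mul_le_mul_of_nonneg_left (NNReal.coe_le_coe.2 this) ε.coe_nonneg
    refine le_trans (le_of_eq ?_) h4
    push_cast
    change _ = (ε : ℝ) * (‖p‖ * m + ‖q‖ * l)
    ring

/-- The direct sum of two spaces with the seminorm `max (L(a), L(b), ‖f(a) - g(b)‖ / ε)`, for
morphisms `f` and `g` to a common C*-algebra. -/
def bridge [Nontrivial E] (hF : Permissible F) (hε : 0 < ε) : Space.{u} F :=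
  Space.ofTotallyBounded (X.carrier × Y.carrier) (bridgeL X Y f g ε) (bridgeL_add X Y f g ε)
    (bridgeL_smul X Y f g ε) (bridgeL_dense X Y f g ε) (bridgeL_eq_zero X Y f g ε hε)
    (isClosed_bridgeL X Y f g ε hε) (bridgeL_totallyBounded X Y f g ε hε)
    (bridgeL_leibniz X Y f g ε hF hε)

end Bridge

/-- Tunnels are composed by gluing them along their common end. The parameter of the bridge is the
error `ε / 3`. -/
theorem propinquity_triangle (hF : Permissible F) (X Y Z : Space.{u} F) :
    propinquity X Z ≤ propinquity X Y + propinquity Y Z := by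
  refine ENNReal.le_of_forall_pos_le_add fun ε hε hfin => ?_
  have hXY := (ENNReal.add_lt_top.1 hfin).1
  have hYZ := (ENNReal.add_lt_top.1 hfin).2
  set r := (propinquity X Y).toNNReal + ε / 3 with hr
  set s := (propinquity Y Z).toNNReal + ε / 3 with hs
  have hε3 : 0 < ε / 3 := by positivity
  obtain ⟨τ, hτ⟩ := exists_tunnel (X := X) (Y := Y) (r := r) (by
    rw [hr, ENNReal.coe_add, ENNReal.coe_toNNReal hXY.ne]
    exact ENNReal.lt_add_right hXY.ne (by exact_mod_cast hε3.ne'))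
  obtain ⟨σ, hσ⟩ := exists_tunnel (X := Y) (Y := Z) (r := s) (by
    rw [hs, ENNReal.coe_add, ENNReal.coe_toNNReal hYZ.ne]
    exact ENNReal.lt_add_right hYZ.ne (by exact_mod_cast hε3.ne'))
  let p₁ := StarAlgHom.fst ℂ τ.D.carrier σ.D.carrier
  let p₂ := StarAlgHom.snd ℂ τ.D.carrier σ.D.carrier
  let D := bridge τ.D σ.D τ.π₂ σ.π₁ (ε / 3) hF hε3
  have hDL : ∀ (d : selfAdjoint D.carrier) (l : ℝ≥0), D.L d ≤ l ↔ _ :=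
    bridgeL_le_iff τ.D σ.D τ.π₂ σ.π₁ (ε / 3) hε3
  let ρ : Tunnel X Z := Tunnel.ofLifts D (τ.π₁.comp p₁) (σ.π₂.comp p₂)
    (τ.surj₁.comp fun a => ⟨(a, 0), rfl⟩) (σ.surj₂.comp fun b => ⟨(0, b), rfl⟩)
    (fun d => (τ.L_map₁_le (mapSA p₁ d)).trans (fst_le_bridgeL ..))
    (fun d => (σ.L_map₂_le (mapSA p₂ d)).trans (snd_le_bridgeL ..))
    (fun a l ha => by
      obtain ⟨d, rfl, hd⟩ := τ.exists_lift₁ ha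
      obtain ⟨e, he, hLe⟩ := σ.exists_lift₁ ((τ.L_map₂_le d).trans hd)
      refine ⟨pairSA d e, rfl, (hDL _ _).2 ⟨hd, hLe, ?_⟩⟩
      rw [bridgeDiff_apply, mapSA_fst_pairSA, mapSA_snd_pairSA, he, sub_self, norm_zero]
      positivity)
    (fun a l ha => by
      obtain ⟨e, rfl, he⟩ := σ.exists_lift₂ ha
      obtain ⟨d, hd, hLd⟩ := τ.exists_lift₂ ((σ.L_map₁_le e).trans he)
      refine ⟨pairSA d e, rfl, (hDL _ _).2 ⟨hLd, he, ?_⟩⟩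
      rw [bridgeDiff_apply, mapSA_fst_pairSA, mapSA_snd_pairSA, hd, sub_self, norm_zero]
      positivity)
  have hρ : ρ.ExtentLE (r + s + ε / 3) := by
    have key : ∀ (d : selfAdjoint τ.D.carrier) (e : selfAdjoint σ.D.carrier) (l : ℝ≥0),
        τ.D.L d ≤ l → σ.D.L e ≤ l → ‖mapSA τ.π₂ d - mapSA σ.π₁ e‖ ≤ (ε / 3 : ℝ≥0) * l →
        max ‖d‖ ‖e‖ ≤ ‖mapSA τ.π₁ d‖ + (r + s + ε / 3 : ℝ≥0) * l ∧
        max ‖d‖ ‖e‖ ≤ ‖mapSA σ.π₂ e‖ + (r + s + ε / 3 : ℝ≥0) * l := by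
      intro d e l h1 h2 h3
      have e1 := hτ.left _ l h1
      have e2 := hσ.left _ l h2
      have e1' := hτ.right _ l h1
      have e2' := hσ.right _ l h2
      have e3 := norm_le_norm_add_norm_sub (mapSA τ.π₂ d) (mapSA σ.π₁ e)
      have e3' := norm_le_norm_add_norm_sub' (mapSA τ.π₂ d) (mapSA σ.π₁ e)
      have e4 := norm_mapSA_le τ.π₂ d
      have e4' := norm_mapSA_le σ.π₁ e
      have hl := l.coe_nonneg
      have := mul_nonneg r.coe_nonneg hl
      have := mul_nonneg s.coe_nonneg hl
      have := mul_nonneg (ε / 3).coe_nonneg hl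
      rw [NNReal.coe_add, NNReal.coe_add, add_mul, add_mul]
      refine ⟨max_le ?_ ?_, max_le ?_ ?_⟩ <;> linarith
    constructor
    · intro d l hd
      obtain ⟨h1, h2, h3⟩ := (hDL d l).1 hd
      exact (key _ _ l h1 h2 h3).1
    · intro d l hd
      obtain ⟨h1, h2, h3⟩ := (hDL d l).1 hd
      exact (key _ _ l h1 h2 h3).2
  refine (propinquity_le ρ hρ).trans (le_of_eq ?_)
  rw [hr, hs]
  have e : (propinquity X Y).toNNReal + ε / 3 + ((propinquity Y Z).toNNReal + ε / 3) + ε / 3 =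
      (propinquity X Y).toNNReal + (propinquity Y Z).toNNReal + ε := by
    have : ε = ε / 3 + ε / 3 + ε / 3 := by
      apply NNReal.eq; push_cast; ring
    conv_rhs => rw [this]
    ring
  rw [e, ENNReal.coe_add, ENNReal.coe_add, ENNReal.coe_toNNReal hXY.ne, ENNReal.coe_toNNReal hYZ.ne]

/-- Spaces embedded isometrically in a common C*-algebra are close for the propinquity when the
unit balls of their seminorms are close for the Hausdorff distance. -/
theorem propinquity_le_of_embeddings (hF : Permissible F) (X Y : Space.{u} F) {E : Type v}
    [CStarAlgebra E] [Nontrivial E] (f : X.carrier →⋆ₐ[ℂ] E) (g : Y.carrier →⋆ₐ[ℂ] E)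
    (hf : Function.Injective f) (hg : Function.Injective g) (ε : ℝ≥0) (hε : 0 < ε)
    (h₁ : ∀ (a : selfAdjoint X.carrier) (l : ℝ≥0), X.L a ≤ l →
      ∃ b, Y.L b ≤ l ∧ ‖mapSA f a - mapSA g b‖ ≤ ε * l)
    (h₂ : ∀ (b : selfAdjoint Y.carrier) (l : ℝ≥0), Y.L b ≤ l →
      ∃ a, X.L a ≤ l ∧ ‖mapSA f a - mapSA g b‖ ≤ ε * l) :
    propinquity X Y ≤ ε := by
  let p₁ := StarAlgHom.fst ℂ X.carrier Y.carrier
  let p₂ := StarAlgHom.snd ℂ X.carrier Y.carrier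
  let D := bridge X Y f g ε hF hε
  have hDL : ∀ (d : selfAdjoint D.carrier) (l : ℝ≥0), D.L d ≤ l ↔ _ :=
    bridgeL_le_iff X Y f g ε hε
  let ρ : Tunnel X Y := Tunnel.ofLifts D p₁ p₂
    (fun a => ⟨(a, 0), rfl⟩) (fun b => ⟨(0, b), rfl⟩)
    (fun d => fst_le_bridgeL ..) (fun d => snd_le_bridgeL ..)
    (fun a l ha => by
      obtain ⟨b, hb, hab⟩ := h₁ a l ha
      exact ⟨pairSA a b, rfl, (hDL _ _).2 ⟨ha, hb, hab⟩⟩)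
    (fun b l hb => by
      obtain ⟨a, ha, hab⟩ := h₂ b l hb
      exact ⟨pairSA a b, rfl, (hDL _ _).2 ⟨ha, hb, hab⟩⟩)
  have key : ∀ (a : selfAdjoint X.carrier) (b : selfAdjoint Y.carrier) (l : ℝ≥0),
      ‖mapSA f a - mapSA g b‖ ≤ ε * l → max ‖a‖ ‖b‖ ≤ ‖a‖ + ε * l ∧ max ‖a‖ ‖b‖ ≤ ‖b‖ + ε * l := by
    intro a b l h
    have e := norm_le_norm_add_norm_sub (mapSA f a) (mapSA g b)
    have e' := norm_le_norm_add_norm_sub' (mapSA f a) (mapSA g b)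
    rw [norm_mapSA_of_injective f hf, norm_mapSA_of_injective g hg] at e e'
    have : (0 : ℝ) ≤ ε * l := by positivity
    refine ⟨max_le ?_ ?_, max_le ?_ ?_⟩ <;> linarith
  exact propinquity_le ρ ⟨fun d l hd => (key _ _ l ((hDL d l).1 hd).2.2).1,
    fun d l hd => (key _ _ l ((hDL d l).1 hd).2.2).2⟩

end

end QuasiLeibniz

namespace QuasiLeibniz

noncomputable section

open Filter Topology

/-! ### Total boundedness of the class of spaces of bounded dimension and diameter -/

/-- By compactness of the unit sphere, a sum of finitely many states is faithful. -/
theorem exists_faithful_functional (A : Type u) [CStarAlgebra A] [Nontrivial A]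
    [FiniteDimensional ℂ A] : ∃ f : A →ₗ[ℂ] ℂ, (∀ a, 0 ≤ f (star a * a)) ∧
      ∀ a, f (star a * a) = 0 → a = 0 := by
  have : ProperSpace A := FiniteDimensional.proper ℂ A
  have hex : ∀ a : Metric.sphere (0 : A) 1, ∃ φ : StateSpace A, φ.1 (star (a : A) * a) ≠ 0 := by
    intro a
    obtain ⟨φ, hφ⟩ := exists_state_abs_eq_norm
      (⟨star (a : A) * a, IsSelfAdjoint.star_mul_self (a : A)⟩ : selfAdjoint A)
    refine ⟨φ, fun h => ?_⟩
    have h1 : ‖star (a : A) * a‖ = 1 := by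
      rw [CStarRing.norm_star_mul_self, mem_sphere_zero_iff_norm.1 a.2, one_mul]
    have h2 : |(φ.1 (star (a : A) * a)).re| = ‖star (a : A) * a‖ := hφ
    rw [h, h1] at h2
    simp at h2
  choose φ hφ using hex
  obtain ⟨T, hT⟩ := (isCompact_sphere (0 : A) 1).elim_finite_subcover
    (fun a : Metric.sphere (0 : A) 1 => {b : A | (φ a).1 (star b * b) ≠ 0})
    (fun a => isOpen_ne_fun ((WeakDual.toStrongDual (φ a).1).continuous.comp
      (continuous_star.mul continuous_id)) continuous_const)
    (fun a ha => Set.mem_iUnion.2 ⟨⟨a, ha⟩, hφ ⟨a, ha⟩⟩)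
  refine ⟨∑ a ∈ T, (WeakDual.toStrongDual (φ a).1 : A →ₗ[ℂ] ℂ), fun b => ?_, fun b hb => ?_⟩
  · rw [LinearMap.sum_apply]
    exact Finset.sum_nonneg fun a _ => (φ a).2.2 b
  · rw [LinearMap.sum_apply] at hb
    have hz := (Finset.sum_eq_zero_iff_of_nonneg fun a _ => (φ a).2.2 b).1 hb
    by_contra hne
    have hn : ‖b‖ ≠ 0 := norm_ne_zero_iff.2 hne
    have hmem : ((‖b‖⁻¹ : ℝ) : ℂ) • b ∈ Metric.sphere (0 : A) 1 := by
      rw [mem_sphere_zero_iff_norm, norm_smul, Complex.norm_real, norm_inv, norm_norm,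
        inv_mul_cancel₀ hn]
    obtain ⟨a, ha, h⟩ := Set.mem_iUnion₂.1 (hT hmem)
    apply h
    rw [star_smul, smul_mul_assoc, mul_smul_comm, map_smul, map_smul]
    have : (φ a).1 (star b * b) = 0 := hz a ha
    rw [this]; simp

/-- A finite dimensional C*-algebra acts faithfully on a Hilbert space of at most the same
dimension, by the Gelfand-Naimark-Segal construction for a faithful functional. -/
theorem exists_faithful_representation (A : Type u) [CStarAlgebra A] [Nontrivial A]
    [FiniteDimensional ℂ A] : ∃ m ≤ Module.finrank ℂ A,
      ∃ ι : A →⋆ₐ[ℂ] (EuclideanSpace ℂ (Fin m) →L[ℂ] EuclideanSpace ℂ (Fin m)),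
        Function.Injective ι := by
  let _ := CStarAlgebra.spectralOrder A
  have _ := CStarAlgebra.spectralOrderedRing A
  obtain ⟨f₀, hpos, hfaith⟩ := exists_faithful_functional A
  let f : A →ₚ[ℂ] ℂ := PositiveLinearMap.mk₀ f₀ fun a ha => by
    obtain ⟨b, rfl⟩ := (CStarAlgebra.nonneg_iff_eq_star_mul_self).1 ha
    exact hpos b
  have hfin : FiniteDimensional ℂ f.PreGNS := f.toPreGNS.finiteDimensional
  let j : f.PreGNS →ₗ[ℂ] f.GNS := (UniformSpace.Completion.toComplL (𝕜 := ℂ)).toLinearMap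
  have hj : Function.Surjective j := by
    rw [← LinearMap.range_eq_top]
    have h1 : IsClosed (LinearMap.range j : Set f.GNS) := Submodule.closed_of_finiteDimensional _
    have h2 : Dense (LinearMap.range j : Set f.GNS) := UniformSpace.Completion.denseRange_coe
    exact SetLike.coe_injective (by rw [← h1.closure_eq, h2.closure_eq]; rfl)
  have hfin' : FiniteDimensional ℂ f.GNS := Module.Finite.of_surjective j hj
  refine ⟨Module.finrank ℂ f.GNS, ?_, ?_⟩
  · refine (LinearMap.finrank_le_finrank_of_surjective hj).trans ?_
    exact f.toPreGNS.finrank_eq.ge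
  · let e := (stdOrthonormalBasis ℂ f.GNS).repr
    refine ⟨(e.conjStarAlgEquiv : (f.GNS →L[ℂ] f.GNS) →⋆ₐ[ℂ] _).comp f.gnsStarAlgHom, ?_⟩
    have hinj : Function.Injective f.gnsStarAlgHom := by
      rw [injective_iff_map_eq_zero]
      intro a ha
      have h1 : f.gnsStarAlgHom a ((f.toPreGNS 1 : f.PreGNS) : f.GNS) = 0 := by rw [ha]; rfl
      have h2 : ((f.toPreGNS (a * 1) : f.PreGNS) : f.GNS) = 0 := by
        rw [← h1]
        exact (f.gnsNonUnitalStarAlgHom_apply_coe (a := a) (b := f.toPreGNS 1)).symm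
      have h3 : ‖f.toPreGNS (a * 1)‖ = 0 := by
        rw [← UniformSpace.Completion.norm_coe, h2, norm_zero]
      have h4 := f.preGNS_norm_sq (f.toPreGNS (a * 1))
      rw [h3, mul_one, f.ofPreGNS_toPreGNS] at h4
      have h5 : f (star a * a) = 0 := by simpa using h4.symm
      exact hfaith a h5
    exact (EquivLike.injective e.conjStarAlgEquiv).comp hinj

variable {F : ℝ≥0 × ℝ≥0 × ℝ≥0 × ℝ≥0 → ℝ≥0}

/-- If the truncated unit balls of two spaces of diameter at most `K` are, after isometric
embeddings in a common C*-algebra, each in the `ε`-neighbourhood of the other, then the spaces are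
at distance at most `ε`. -/
theorem propinquity_le_of_unitBalls (hF : Permissible F) (X Y : Space.{u} F) {E : Type v}
    [CStarAlgebra E] [Nontrivial E] (f : X.carrier →⋆ₐ[ℂ] E) (g : Y.carrier →⋆ₐ[ℂ] E)
    (hf : Function.Injective f) (hg : Function.Injective g) (K ε : ℝ≥0) (hε : 0 < ε)
    (hX : X.diam ≤ K) (hY : Y.diam ≤ K)
    (h₁ : ∀ a, X.L a ≤ 1 → ‖a‖ ≤ K → ∃ b, Y.L b ≤ 1 ∧ ‖mapSA f a - mapSA g b‖ ≤ ε)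
    (h₂ : ∀ b, Y.L b ≤ 1 → ‖b‖ ≤ K → ∃ a, X.L a ≤ 1 ∧ ‖mapSA f a - mapSA g b‖ ≤ ε) :
    propinquity X Y ≤ ε := by
  have key : ∀ (X Y : Space.{u} F) (f : X.carrier →⋆ₐ[ℂ] E) (g : Y.carrier →⋆ₐ[ℂ] E),
      X.diam ≤ K → (∀ a, X.L a ≤ 1 → ‖a‖ ≤ K → ∃ b, Y.L b ≤ 1 ∧ ‖mapSA f a - mapSA g b‖ ≤ ε) →
      ∀ (a : selfAdjoint X.carrier) (l : ℝ≥0), X.L a ≤ l →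
        ∃ b, Y.L b ≤ l ∧ ‖mapSA f a - mapSA g b‖ ≤ ε * l := by
    intro X Y f g hX h a l ha
    rcases eq_or_ne l 0 with rfl | hl
    · obtain ⟨t, rfl⟩ := (X.L_eq_zero a).1 (le_antisymm (by simpa using ha) zero_le)
      refine ⟨t • 1, by rw [Y.L_scalar]; exact zero_le, ?_⟩
      rw [mapSA_scalar, mapSA_scalar, sub_self, norm_zero]; positivity
    · have hl' : (l : ℝ) ≠ 0 := by exact_mod_cast hl
      have h1 := X.L_smul_le ha l⁻¹
      rw [inv_mul_cancel₀ hl] at h1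
      obtain ⟨t, ht⟩ := X.exists_norm_sub_scalar_le hX h1
      rw [NNReal.coe_one, mul_one] at ht
      obtain ⟨b, hb, hab⟩ := h _ (by rw [X.L_sub_scalar]; simpa using h1) ht
      refine ⟨(l : ℝ) • (b + t • 1), ?_, ?_⟩
      · have := Y.L_smul_le (a := b + t • 1) (l := 1) (by rw [Y.L_add_scalar]; simpa using hb) l
        rwa [mul_one] at this
      · have e : mapSA f a - mapSA g ((l : ℝ) • (b + t • 1)) =
            (l : ℝ) • (mapSA f (((l⁻¹ : ℝ≥0) : ℝ) • a - t • 1) - mapSA g b) := by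
          rw [map_sub, mapSA_scalar, map_smul, map_smul, map_add, mapSA_scalar, smul_sub, smul_sub,
            smul_smul, NNReal.coe_inv, mul_inv_cancel₀ hl', one_smul, smul_add]
          abel
        rw [e, norm_smul, Real.norm_of_nonneg l.coe_nonneg, mul_comm]
        exact mul_le_mul_of_nonneg_right hab l.coe_nonneg
  refine propinquity_le_of_embeddings hF X Y f g hf hg ε hε (key X Y f g hX h₁) fun b l hb => ?_
  obtain ⟨a, ha, hab⟩ := key Y X g f hY (fun b hb hbK => by
    obtain ⟨a, ha, hab⟩ := h₂ b hb hbK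
    exact ⟨a, ha, by rwa [norm_sub_rev]⟩) b l hb
  exact ⟨a, ha, by rwa [norm_sub_rev]⟩

/-- Spaces of dimension at most `N` and diameter at most `K` fall in finitely many classes of
propinquity diameter at most `ε`: a space is classified by the dimension of a faithful
representation and by the points of a finite net close to the image of its unit ball. -/
theorem exists_finite_code (hF : Permissible F) (N : ℕ) (K ε : ℝ≥0) (hε : 0 < ε) :
    ∃ (C : Type) (_ : Finite C) (P : Space.{u} F → C → Prop),
      (∀ X : Space.{u} F, Module.rank ℂ X.carrier ≤ N → X.diam ≤ K → ∃ c, P X c) ∧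
      ∀ (X Y : Space.{u} F) (c : C), X.diam ≤ K → Y.diam ≤ K → P X c → P Y c → propinquity X Y ≤ ε := by
  let E : ℕ → Type := fun m => EuclideanSpace ℂ (Fin m) →L[ℂ] EuclideanSpace ℂ (Fin m)
  have hnet : ∀ m, ∃ T : Set (E m), T.Finite ∧
      Metric.closedBall (0 : E m) K ⊆ ⋃ t ∈ T, Metric.ball t (ε / 2) := fun m => by
    have : ProperSpace (E m) := FiniteDimensional.proper ℂ _
    exact Metric.totallyBounded_iff.1 (isCompact_closedBall (0 : E m) K).totallyBounded _
      (by positivity)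
  choose T hTf hT using hnet
  have hfin : ∀ m, Finite (T m) := fun m => hTf m
  refine ⟨Σ m : Fin (N + 1), Set (T m), inferInstance, fun X c =>
    ∃ ι : X.carrier →⋆ₐ[ℂ] E c.1, Function.Injective ι ∧ ∀ t : T c.1, t ∈ c.2 ↔
      ∃ a, X.L a ≤ 1 ∧ ‖a‖ ≤ K ∧ ‖ι (a : X.carrier) - t‖ < ε / 2, ?_, ?_⟩
  · intro X hX _
    have : FiniteDimensional ℂ X.carrier :=
      Module.rank_lt_aleph0_iff.1 (hX.trans_lt (Cardinal.natCast_lt_aleph0))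
    have hN : Module.finrank ℂ X.carrier ≤ N := by
      rw [← Module.finrank_eq_rank] at hX; exact_mod_cast hX
    obtain ⟨m, hm, ι, hι⟩ := exists_faithful_representation X.carrier
    exact ⟨⟨⟨m, Nat.lt_succ_of_le (hm.trans hN)⟩,
      {t | ∃ a, X.L a ≤ 1 ∧ ‖a‖ ≤ K ∧ ‖ι (a : X.carrier) - t‖ < ε / 2}⟩, ι, hι, fun t => Iff.rfl⟩
  · rintro X Y c hX hY ⟨f, hf, hfc⟩ ⟨g, hg, hgc⟩
    have hnt : Nontrivial (E c.1) := hf.nontrivial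
    have key : ∀ (X Y : Space.{u} F) (f : X.carrier →⋆ₐ[ℂ] E c.1) (g : Y.carrier →⋆ₐ[ℂ] E c.1),
        (∀ t : T c.1, t ∈ c.2 ↔ ∃ a, X.L a ≤ 1 ∧ ‖a‖ ≤ K ∧ ‖f (a : X.carrier) - t‖ < ε / 2) →
        (∀ t : T c.1, t ∈ c.2 ↔ ∃ a, Y.L a ≤ 1 ∧ ‖a‖ ≤ K ∧ ‖g (a : Y.carrier) - t‖ < ε / 2) →
        ∀ a, X.L a ≤ 1 → ‖a‖ ≤ K → ∃ b, Y.L b ≤ 1 ∧ ‖mapSA f a - mapSA g b‖ ≤ ε := by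
      intro X Y f g hfc hgc a ha haK
      have hmem : f (a : X.carrier) ∈ Metric.closedBall (0 : E c.1) K := by
        rw [mem_closedBall_zero_iff]
        exact (norm_mapSA_le f a).trans haK
      obtain ⟨t, ht, hat⟩ := Set.mem_iUnion₂.1 (hT c.1 hmem)
      rw [Metric.mem_ball, dist_eq_norm] at hat
      obtain ⟨b, hb, -, hbt⟩ := (hgc ⟨t, ht⟩).1 ((hfc ⟨t, ht⟩).2 ⟨a, ha, haK, hat⟩)
      refine ⟨b, hb, ?_⟩
      change ‖f (a : X.carrier) - g (b : Y.carrier)‖ ≤ ε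
      have e : f (a : X.carrier) - g (b : Y.carrier) =
        (f (a : X.carrier) - t) - (g (b : Y.carrier) - t) := by abel
      rw [e]
      exact (norm_sub_le _ _).trans ((add_le_add hat.le hbt.le).trans_eq (add_halves _))
    refine propinquity_le_of_unitBalls hF X Y f g hf hg K ε hε hX hY (key X Y f g hfc hgc) ?_
    intro b hb hbK
    obtain ⟨a, ha, hab⟩ := key Y X g f hgc hfc b hb hbK
    exact ⟨a, ha, (norm_sub_rev _ _).trans_le hab⟩

end

end QuasiLeibniz

namespace QuasiLeibniz

noncomputable section

open Filter Topology
open scoped ComplexStarModule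

/-! ### Ranges of morphisms, and C*-algebras generated by Jordan-Lie algebras -/

section Range

variable {A : Type u} {B : Type v} [CStarAlgebra A] [CStarAlgebra B]

/-- Self-adjoint elements of the range have lifts of the same norm, obtained by truncating the real
part of any lift with the functional calculus. -/
theorem exists_lift_norm_le (π : A →⋆ₐ[ℂ] B) (b : selfAdjoint B) (hb : (b : B) ∈ Set.range π) :
    ∃ a : A, π a = b ∧ ‖a‖ ≤ ‖b‖ := by
  obtain ⟨x, hx⟩ := hb
  have hsb : star (b : B) = b := b.2
  have hπ : π ((ℜ x : selfAdjoint A) : A) = b := by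
    rw [realPart_apply_coe, ← Complex.coe_smul, map_smul, map_add, map_star, hx, hsb,
      Complex.coe_smul, ← two_smul ℝ (b : B), smul_smul]
    norm_num
  let r := ‖(b : B)‖
  let f : ℝ → ℝ := fun t => max (-r) (min r t)
  have hf : Continuous f := by fun_prop
  refine ⟨cfc f ((ℜ x : selfAdjoint A) : A), ?_, ?_⟩
  · have hc : Continuous π :=
      haveI := NonUnitalStarAlgHom.instContinuousLinearMapClassComplex (F := A →⋆ₐ[ℂ] B)
      map_continuous π
    refine (StarAlgHomClass.map_cfc (S := ℂ) π f ((ℜ x : selfAdjoint A) : A) hf.continuousOn hc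
      (ℜ x).2 (by rw [hπ]; exact b.2)).trans ?_
    rw [hπ]
    have he : Set.EqOn f id (spectrum ℝ (b : B)) := by
      intro t ht
      have := spectrum.norm_le_norm_mul_of_mem ht
      have h1 : |t| ≤ r := by
        rcases subsingleton_or_nontrivial B with h | h
        · simp at ht
        · exact spectrum.norm_le_norm_of_mem ht
      rw [abs_le] at h1
      simp only [f, id]
      rw [min_eq_right h1.2, max_eq_right h1.1]
    rw [cfc_congr he]
    exact cfc_id ℝ (b : B) b.2
  · refine norm_cfc_le (norm_nonneg _) fun t _ => ?_
    have hr : 0 ≤ r := norm_nonneg _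
    rw [Real.norm_eq_abs, abs_le]
    exact ⟨le_max_left _ _, max_le (show -r ≤ r by linarith) (min_le_left _ _)⟩

/-- Lifting the real and imaginary parts gives lifts of at most twice the norm, so that the morphism is
open onto its range. -/
theorem isClosed_range (π : A →⋆ₐ[ℂ] B) : IsClosed (Set.range π) := by
  let f : NormedAddGroupHom A B := (π : A →+ B).mkNormedAddGroupHom 1 fun a => by
    rw [one_mul]; exact NonUnitalStarAlgHom.norm_apply_le π a
  have hfa : ∀ a, f a = π a := fun _ => rfl
  have hs : f.SurjectiveOnWith f.range 2 := by
    rintro b ⟨a, rfl⟩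
    have hb : π a = f a := rfl
    set b := f a
    have hre : ((ℜ b : selfAdjoint B) : B) ∈ Set.range π := by
      refine ⟨ℜ a, ?_⟩
      rw [realPart_apply_coe, realPart_apply_coe, ← Complex.coe_smul, map_smul, map_add, map_star,
        hb, Complex.coe_smul]
    have him : ((ℑ b : selfAdjoint B) : B) ∈ Set.range π := by
      refine ⟨ℑ a, ?_⟩
      rw [imaginaryPart_apply_coe, imaginaryPart_apply_coe, map_smul, ← Complex.coe_smul, map_smul,
        map_sub, map_star, hb, Complex.coe_smul]
    obtain ⟨x, hx, hxn⟩ := exists_lift_norm_le π _ hre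
    obtain ⟨y, hy, hyn⟩ := exists_lift_norm_le π _ him
    refine ⟨x + Complex.I • y, ?_, ?_⟩
    · rw [hfa, map_add, map_smul, hx, hy, realPart_add_I_smul_imaginaryPart]
      rfl
    · refine (norm_add_le _ _).trans ?_
      rw [norm_smul, Complex.norm_I, one_mul, two_mul]
      exact add_le_add (hxn.trans (realPart.norm_le b)) (hyn.trans (imaginaryPart.norm_le b))
  have hcl := controlled_closure_of_complete (C := 2) (ε := 1) two_pos one_pos hs
  rw [← closure_subset_iff_isClosed]
  intro b hb
  obtain ⟨a, ha, -⟩ := hcl b hb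
  exact ⟨a, ha⟩

/-- A morphism is surjective when its range contains densely many self-adjoint elements. -/
theorem surjective_of_dense (π : A →⋆ₐ[ℂ] B) (S : Set (selfAdjoint B)) (hS : Dense S)
    (h : ∀ b ∈ S, (b : B) ∈ Set.range π) : Function.Surjective π := by
  have hsa : ∀ b : selfAdjoint B, (b : B) ∈ Set.range π := by
    intro b
    have hcl : IsClosed {b : selfAdjoint B | (b : B) ∈ Set.range π} :=
      (isClosed_range π).preimage continuous_subtype_val
    exact (closure_minimal h hcl) (hS b)
  intro b
  obtain ⟨x, hx⟩ := hsa (ℜ b)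
  obtain ⟨y, hy⟩ := hsa (ℑ b)
  exact ⟨x + Complex.I • y, by rw [map_add, map_smul, hx, hy, realPart_add_I_smul_imaginaryPart]⟩

end Range

section JordanLieAlgebra

variable {A : Type u} [CStarAlgebra A]

/-- The *-algebra `S + iS` of a Jordan-Lie algebra `S` of self-adjoint elements. -/
def jlStarSubalgebra (S : Submodule ℝ (selfAdjoint A)) (h1 : (1 : selfAdjoint A) ∈ S)
    (hS : ∀ i, ∀ a ∈ S, ∀ b ∈ S, jl i a b ∈ S) : StarSubalgebra ℂ A where
  carrier := {x | ℜ x ∈ S ∧ ℑ x ∈ S}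
  mul_mem' := by
    rintro x y ⟨ha, hb⟩ ⟨hc, hd⟩
    have e : x * y =
        ((jl false (ℜ x) (ℜ y) - jl false (ℑ x) (ℑ y) - jl true (ℜ x) (ℑ y) - jl true (ℑ x) (ℜ y) :
          selfAdjoint A) : A) + Complex.I •
        ((jl true (ℜ x) (ℜ y) - jl true (ℑ x) (ℑ y) + jl false (ℜ x) (ℑ y) + jl false (ℑ x) (ℜ y) :
          selfAdjoint A) : A) := by
      have e' : x * y = (((ℜ x : selfAdjoint A) : A) + Complex.I • ((ℑ x : selfAdjoint A) : A)) *
          (((ℜ y : selfAdjoint A) : A) + Complex.I • ((ℑ y : selfAdjoint A) : A)) := by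
        rw [realPart_add_I_smul_imaginaryPart, realPart_add_I_smul_imaginaryPart]
      rw [e', add_mul, mul_add, mul_add, smul_mul_assoc, smul_mul_assoc, mul_smul_comm,
        mul_smul_comm, smul_smul, Complex.I_mul_I, coe_mul_coe_eq_jl, coe_mul_coe_eq_jl,
        coe_mul_coe_eq_jl, coe_mul_coe_eq_jl]
      simp only [smul_add, smul_smul, Complex.I_mul_I, AddSubgroup.coe_sub, AddSubgroup.coe_add]
      module
    have hre : ∀ p q : selfAdjoint A, ℜ ((p : A) + Complex.I • (q : A)) = p := fun p q => by
      rw [map_add, realPart_I_smul, selfAdjoint.realPart_coe, selfAdjoint.imaginaryPart_coe]; simp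
    have him : ∀ p q : selfAdjoint A, ℑ ((p : A) + Complex.I • (q : A)) = q := fun p q => by
      rw [map_add, imaginaryPart_I_smul, selfAdjoint.realPart_coe, selfAdjoint.imaginaryPart_coe]
      simp
    change ℜ (x * y) ∈ S ∧ ℑ (x * y) ∈ S
    rw [e, hre, him]
    exact ⟨S.sub_mem (S.sub_mem (S.sub_mem (hS _ _ ha _ hc) (hS _ _ hb _ hd)) (hS _ _ ha _ hd))
      (hS _ _ hb _ hc), S.add_mem (S.add_mem (S.sub_mem (hS _ _ ha _ hc) (hS _ _ hb _ hd))
      (hS _ _ ha _ hd)) (hS _ _ hb _ hc)⟩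
  add_mem' := by
    rintro x y ⟨ha, hb⟩ ⟨hc, hd⟩
    exact ⟨by rw [map_add]; exact S.add_mem ha hc, by rw [map_add]; exact S.add_mem hb hd⟩
  algebraMap_mem' := by
    intro c
    have e : (algebraMap ℂ A c) = c • ((1 : selfAdjoint A) : A) := by
      rw [Algebra.algebraMap_eq_smul_one]; rfl
    change ℜ (algebraMap ℂ A c) ∈ S ∧ ℑ (algebraMap ℂ A c) ∈ S
    rw [e, realPart_smul, imaginaryPart_smul, selfAdjoint.realPart_coe,
      selfAdjoint.imaginaryPart_coe, smul_zero, sub_zero, smul_zero, zero_add]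
    exact ⟨S.smul_mem _ h1, S.smul_mem _ h1⟩
  star_mem' := by
    rintro x ⟨ha, hb⟩
    change ℜ (star x) ∈ S ∧ ℑ (star x) ∈ S
    have hr : ℜ (star x) = ℜ x := Subtype.ext <| by
      rw [realPart_apply_coe, realPart_apply_coe, star_star, add_comm]
    have hi : ℑ (star x) = -ℑ x := Subtype.ext <| by
      rw [AddSubgroup.coe_neg, imaginaryPart_apply_coe, imaginaryPart_apply_coe, star_star,
        ← smul_neg, ← smul_neg, neg_sub]
    rw [hr, hi]
    exact ⟨ha, S.neg_mem hb⟩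

theorem coe_mem_jlStarSubalgebra {S : Submodule ℝ (selfAdjoint A)} {h1 : (1 : selfAdjoint A) ∈ S}
    {hS : ∀ i, ∀ a ∈ S, ∀ b ∈ S, jl i a b ∈ S} (a : selfAdjoint A) :
    (a : A) ∈ jlStarSubalgebra S h1 hS ↔ a ∈ S := by
  change ℜ (a : A) ∈ S ∧ ℑ (a : A) ∈ S ↔ _
  rw [selfAdjoint.realPart_coe, selfAdjoint.imaginaryPart_coe]
  exact ⟨fun h => h.1, fun h => ⟨h, S.zero_mem⟩⟩

/-- The C*-algebra generated by a Jordan-Lie algebra `S` of self-adjoint elements: the closure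
of `S + iS`. -/
def jlClosure (S : Submodule ℝ (selfAdjoint A)) (h1 : (1 : selfAdjoint A) ∈ S)
    (hS : ∀ i, ∀ a ∈ S, ∀ b ∈ S, jl i a b ∈ S) : StarSubalgebra ℂ A :=
  (jlStarSubalgebra S h1 hS).topologicalClosure

instance (S : Submodule ℝ (selfAdjoint A)) (h1 : (1 : selfAdjoint A) ∈ S)
    (hS : ∀ i, ∀ a ∈ S, ∀ b ∈ S, jl i a b ∈ S) : CStarAlgebra (jlClosure S h1 hS) :=
  StarSubalgebra.cstarAlgebra _
    (h_closed := StarSubalgebra.isClosed_topologicalClosure (jlStarSubalgebra S h1 hS))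

variable {S : Submodule ℝ (selfAdjoint A)} {h1 : (1 : selfAdjoint A) ∈ S}
  {hS : ∀ i, ∀ a ∈ S, ∀ b ∈ S, jl i a b ∈ S}

/-- Elements of `S`, in the C*-algebra that it generates. -/
def toJlClosure (a : selfAdjoint A) (ha : a ∈ S) : selfAdjoint (jlClosure S h1 hS) :=
  ⟨⟨a, subset_closure ((coe_mem_jlStarSubalgebra a).2 ha)⟩, Subtype.ext a.2⟩

/-- The self-adjoint elements coming from `S` are dense. -/
theorem dense_jlClosure :
    Dense {x : selfAdjoint (jlClosure S h1 hS) | mapSA (jlClosure S h1 hS).subtype x ∈ S} := by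
  rw [Metric.dense_iff]
  intro x r hr
  obtain ⟨y, hy, hxy⟩ := Metric.mem_closure_iff.1 (show ((x : jlClosure S h1 hS) : A) ∈
    closure (jlStarSubalgebra S h1 hS : Set A) from (x : jlClosure S h1 hS).2) r hr
  refine ⟨toJlClosure (ℜ y) hy.1, ?_, hy.1⟩
  have hx : star ((x : jlClosure S h1 hS) : A) = (x : jlClosure S h1 hS) :=
    congrArg Subtype.val x.2
  let x' : selfAdjoint A := ⟨((x : jlClosure S h1 hS) : A), hx⟩
  have e : ℜ (y - (x' : A)) = ℜ y - x' := by
    rw [map_sub, selfAdjoint.realPart_coe]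
  rw [Metric.mem_ball, dist_eq_norm]
  change ‖(((ℜ y : selfAdjoint A) : A) - (x' : A))‖ < r
  have h2 := realPart.norm_le (y - (x' : A))
  rw [e] at h2
  refine h2.trans_lt ?_
  rw [← dist_eq_norm, dist_comm]; exact hxy

end JordanLieAlgebra

end

end QuasiLeibniz

namespace QuasiLeibniz

noncomputable section

open Filter Topology
open scoped ComplexStarModule

variable {F : ℝ≥0 × ℝ≥0 × ℝ≥0 × ℝ≥0 → ℝ≥0}

/-! ### Spaces at distance zero -/

theorem continuous_jl {A : Type u} [CStarAlgebra A] (i : Bool) :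
    Continuous fun p : selfAdjoint A × selfAdjoint A => jl i p.1 p.2 := by
  cases i
  · exact Continuous.subtype_mk (by fun_prop) _
  · exact Continuous.subtype_mk (by fun_prop) _

/-- By the C*-identity, norm estimates on self-adjoint elements extend to all elements. -/
theorem norm_le_of_norm_mapSA_le {A : Type*} {B : Type*} {C : Type*} [CStarAlgebra A]
    [CStarAlgebra B] [CStarAlgebra C] (p : A →⋆ₐ[ℂ] B) (q : A →⋆ₐ[ℂ] C)
    (h : ∀ a : selfAdjoint A, ‖mapSA p a‖ ≤ ‖mapSA q a‖) (a : A) : ‖p a‖ ≤ ‖q a‖ := by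
  have h1 := h ⟨star a * a, .star_mul_self a⟩
  change ‖p (star a * a)‖ ≤ ‖q (star a * a)‖ at h1
  rw [map_mul, map_star, map_mul, map_star, CStarRing.norm_star_mul_self,
    CStarRing.norm_star_mul_self] at h1
  exact abs_le_of_sq_le_sq' (by nlinarith) (norm_nonneg _) |>.2

section Coincidence

variable {X Y : Space.{u} F} (τ : ℕ → Tunnel X Y) (𝒰 : Ultrafilter ℕ)

/-- Two elements are related when they are the limits, along an ultrafilter, of the images of a
sequence of elements of the tunnels `τ n` with bounded seminorms. -/
def Related (a : selfAdjoint X.carrier) (b : selfAdjoint Y.carrier) : Prop :=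
  ∃ (l : ℝ≥0) (d : ∀ n, selfAdjoint (τ n).D.carrier), (∀ n, (τ n).D.L (d n) ≤ l) ∧
    Tendsto (fun n => mapSA (τ n).π₁ (d n)) 𝒰 (𝓝 a) ∧
    Tendsto (fun n => mapSA (τ n).π₂ (d n)) 𝒰 (𝓝 b)

variable {τ 𝒰}

theorem Related.symm {a : selfAdjoint X.carrier} {b : selfAdjoint Y.carrier}
    (h : Related τ 𝒰 a b) : Related (fun n => (τ n).symm) 𝒰 b a := by
  obtain ⟨l, d, h, h₁, h₂⟩ := h
  exact ⟨l, d, h, h₂, h₁⟩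

theorem related_one : Related τ 𝒰 1 1 := by
  refine ⟨0, fun n => 1, fun n => by rw [Space.L_one]; exact zero_le, ?_, ?_⟩
  · simp only [mapSA_one]; exact tendsto_const_nhds
  · simp only [mapSA_one]; exact tendsto_const_nhds

theorem Related.add {a a' : selfAdjoint X.carrier} {b b' : selfAdjoint Y.carrier}
    (h : Related τ 𝒰 a b) (h' : Related τ 𝒰 a' b') : Related τ 𝒰 (a + a') (b + b') := by
  obtain ⟨l, d, h, h₁, h₂⟩ := h
  obtain ⟨l', d', h', h₁', h₂'⟩ := h'
  refine ⟨l + l', fun n => d n + d' n, fun n => ?_, ?_, ?_⟩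
  · push_cast
    exact ((τ n).D.L_add _ _).trans (add_le_add (h n) (h' n))
  · simp only [map_add]; exact h₁.add h₁'
  · simp only [map_add]; exact h₂.add h₂'

theorem Related.smul {a : selfAdjoint X.carrier} {b : selfAdjoint Y.carrier}
    (h : Related τ 𝒰 a b) (t : ℝ) : Related τ 𝒰 (t • a) (t • b) := by
  obtain ⟨l, d, h, h₁, h₂⟩ := h
  refine ⟨‖t‖₊ * l, fun n => t • d n, fun n => ?_, ?_, ?_⟩
  · rw [(τ n).D.L_smul]
    push_cast
    exact mul_le_mul_right (h n) _
  · simp only [map_smul]; exact h₁.const_smul t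
  · simp only [map_smul]; exact h₂.const_smul t

variable {e : ℕ → ℝ≥0} (hτ : ∀ n, (τ n).ExtentLE (e n)) (he : ∀ n, e n ≤ 1)

include hτ he in
/-- Products of the sequences of elements have bounded seminorms, since their norms are bounded along
the ultrafilter in terms of their images. -/
theorem Related.jl (hF : Permissible F) (i : Bool) {a a' : selfAdjoint X.carrier}
    {b b' : selfAdjoint Y.carrier} (h : Related τ 𝒰 a b) (h' : Related τ 𝒰 a' b') :
    Related τ 𝒰 (jl i a a') (jl i b b') := by
  obtain ⟨l, d, h, h₁, h₂⟩ := h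
  obtain ⟨l', d', h', h₁', h₂'⟩ := h'
  have bound : ∀ (l : ℝ≥0) (d : ∀ n, selfAdjoint (τ n).D.carrier) (a : selfAdjoint X.carrier),
      (∀ n, (τ n).D.L (d n) ≤ l) → Tendsto (fun n => mapSA (τ n).π₁ (d n)) 𝒰 (𝓝 a) →
      ∀ᶠ n in 𝒰, ‖d n‖ ≤ (‖a‖₊ + 1 + l : ℝ≥0) := by
    intro l d a hl ht
    filter_upwards [ht.norm.eventually_le_const (lt_add_one ‖a‖)] with n hn
    have h1 := (hτ n).left (d n) l (hl n)
    have h2 : (e n : ℝ) * l ≤ l := mul_le_of_le_one_left l.2 (he n)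
    push_cast
    linarith
  let G : ℝ≥0 := F (‖a‖₊ + 1 + l, ‖a'‖₊ + 1 + l', l, l')
  let good : ℕ → Prop := fun n => (τ n).D.L (QuasiLeibniz.jl i (d n) (d' n)) ≤ G
  have hgood : ∀ᶠ n in 𝒰, good n := by
    filter_upwards [bound l d a h h₁, bound l' d' a' h' h₁'] with n hn hn'
    exact (τ n).D.L_jl_le hF i hn hn' (h n) (h' n)
  classical
  refine ⟨G, fun n => if good n then QuasiLeibniz.jl i (d n) (d' n) else 0, fun n => ?_, ?_, ?_⟩
  · dsimp only
    split_ifs with hn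
    · exact hn
    · rw [Space.L_zero]; exact zero_le
  · refine Tendsto.congr' ?_ (((continuous_jl i).tendsto (a, a')).comp (h₁.prodMk_nhds h₁'))
    filter_upwards [hgood] with n hn
    rw [if_pos hn, mapSA_jl]; rfl
  · refine Tendsto.congr' ?_ (((continuous_jl i).tendsto (b, b')).comp (h₂.prodMk_nhds h₂'))
    filter_upwards [hgood] with n hn
    rw [if_pos hn, mapSA_jl]; rfl

variable (he0 : Tendsto e 𝒰 (𝓝 0))

include hτ he0 in
/-- The norm of the first image of a term exceeds that of the second one by at most `l` times the
extent, which vanishes in the limit. -/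
theorem Related.norm_le {a : selfAdjoint X.carrier} {b : selfAdjoint Y.carrier}
    (h : Related τ 𝒰 a b) : ‖a‖ ≤ ‖b‖ := by
  obtain ⟨l, d, h, h₁, h₂⟩ := h
  have h3 : Tendsto (fun n => ‖mapSA (τ n).π₂ (d n)‖ + e n * l) 𝒰 (𝓝 (‖b‖ + (0 : ℝ≥0) * l)) :=
    h₂.norm.add ((NNReal.tendsto_coe.2 he0).mul_const _)
  rw [NNReal.coe_zero, zero_mul, add_zero] at h3
  exact le_of_tendsto_of_tendsto' h₁.norm h3 fun n =>
    (norm_mapSA_le _ _).trans ((hτ n).right (d n) l (h n))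

include hτ he0 in
theorem Related.norm_eq {a : selfAdjoint X.carrier} {b : selfAdjoint Y.carrier}
    (h : Related τ 𝒰 a b) : ‖a‖ = ‖b‖ :=
  le_antisymm (h.norm_le hτ he0)
    (h.symm.norm_le (e := e) (fun n => ⟨(hτ n).right, (hτ n).left⟩) he0)

include hτ he in
/-- The images in `Y` of lifts of `a` converge along the ultrafilter, because norm bounded balls for
the seminorm of `Y` are compact. -/
theorem exists_related {a : selfAdjoint X.carrier} {l : ℝ≥0} (ha : X.L a ≤ l) :
    ∃ b, Y.L b ≤ l ∧ Related τ 𝒰 a b := by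
  choose d hd hL using fun n => (τ n).exists_lift₁ ha
  have hK := Y.isCompact_ball l (‖a‖₊ + l)
  have hmem : ∀ n, mapSA (τ n).π₂ (d n) ∈ {b | Y.L b ≤ l ∧ ‖b‖ ≤ (‖a‖₊ + l : ℝ≥0)} := by
    intro n
    refine ⟨((τ n).L_map₂_le _).trans (hL n), (norm_mapSA_le _ _).trans ?_⟩
    have h1 := (hτ n).left (d n) l (hL n)
    have h2 : (e n : ℝ) * l ≤ l := mul_le_of_le_one_left l.2 (he n)
    rw [hd] at h1
    push_cast
    linarith
  obtain ⟨b, hb, hlim⟩ := hK.ultrafilter_le_nhds (𝒰.map fun n => mapSA (τ n).π₂ (d n))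
    (tendsto_principal.2 (Eventually.of_forall hmem))
  refine ⟨b, hb.1, l, d, hL, ?_, hlim⟩
  simp only [hd]
  exact tendsto_const_nhds

end Coincidence

/-- The *-isomorphism between spaces at distance zero is the closure of the relation "being limits
of images of the same elements of tunnels of vanishing extent": it is a Jordan-Lie algebra of
pairs of elements of equal norms, so that the C*-algebra it generates projects injectively to both
factors. -/
theorem isometric_of_propinquity_eq_zero (hF : Permissible F) {X Y : Space.{u} F}
    (h : propinquity X Y = 0) : Isometric X Y := by
  let e : ℕ → ℝ≥0 := fun n => ((n : ℝ≥0) + 1)⁻¹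
  have hpos : ∀ n, 0 < e n := fun n => by positivity
  have he : ∀ n, e n ≤ 1 := fun n => inv_le_one_of_one_le₀ (by simp)
  choose τ hτ using fun n => exists_tunnel (X := X) (Y := Y) (r := e n)
    (by rw [h]; exact_mod_cast hpos n)
  let 𝒰 : Ultrafilter ℕ := hyperfilter ℕ
  have he0 : Tendsto e 𝒰 (𝓝 0) := by
    refine Tendsto.mono_left ?_ (Nat.hyperfilter_le_atTop)
    rw [← NNReal.tendsto_coe]
    simpa [e] using tendsto_one_div_add_atTop_nhds_zero_nat (𝕜 := ℝ)
  let p₁ := StarAlgHom.fst ℂ X.carrier Y.carrier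
  let p₂ := StarAlgHom.snd ℂ X.carrier Y.carrier
  let S : Submodule ℝ (selfAdjoint (X.carrier × Y.carrier)) :=
    { carrier := {p | Related τ 𝒰 (mapSA p₁ p) (mapSA p₂ p)}
      add_mem' := fun {p q} hp hq => by
        change Related τ 𝒰 _ _
        rw [map_add, map_add]
        exact Related.add hp hq
      zero_mem' := by
        change Related τ 𝒰 _ _
        have := (related_one (τ := τ) (𝒰 := 𝒰)).smul 0
        rw [zero_smul, zero_smul] at this
        rwa [map_zero, map_zero]
      smul_mem' := fun t p hp => by
        change Related τ 𝒰 _ _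
        rw [map_smul, map_smul]
        exact Related.smul hp t }
  have memS : ∀ {a b}, Related τ 𝒰 a b → pairSA a b ∈ S := fun {a b} hab => by
    change Related τ 𝒰 _ _
    rw [mapSA_fst_pairSA, mapSA_snd_pairSA]; exact hab
  have h1 : (1 : selfAdjoint (X.carrier × Y.carrier)) ∈ S := by
    change Related τ 𝒰 _ _
    rw [mapSA_one, mapSA_one]; exact related_one
  have hS : ∀ i, ∀ a ∈ S, ∀ b ∈ S, jl i a b ∈ S := by
    intro i a ha b hb
    change Related τ 𝒰 _ _
    rw [mapSA_jl, mapSA_jl]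
    exact Related.jl hτ he hF i ha hb
  let C := jlClosure S h1 hS
  let q₁ : C →⋆ₐ[ℂ] X.carrier := p₁.comp C.subtype
  let q₂ : C →⋆ₐ[ℂ] Y.carrier := p₂.comp C.subtype
  have hsa : ∀ z : selfAdjoint C, ‖mapSA q₁ z‖ = ‖mapSA q₂ z‖ := by
    intro z
    have hcl : IsClosed {z : selfAdjoint C | ‖mapSA q₁ z‖ = ‖mapSA q₂ z‖} :=
      isClosed_eq (continuous_mapSA q₁).norm (continuous_mapSA q₂).norm
    refine closure_minimal ?_ hcl ((dense_jlClosure (S := S) (h1 := h1) (hS := hS)) z)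
    intro z hz
    exact Related.norm_eq hτ he0 hz
  have h₁₂ := norm_le_of_norm_mapSA_le q₁ q₂ fun z => (hsa z).le
  have h₂₁ := norm_le_of_norm_mapSA_le q₂ q₁ fun z => (hsa z).ge
  -- The two projections have the same norms, hence the same kernel, which is zero.
  have hz : ∀ z : C, q₁ z = 0 → q₂ z = 0 → z = 0 := by
    intro z hz₁ hz₂
    exact Subtype.ext (Prod.ext hz₁ hz₂)
  have inj₁ : Function.Injective q₁ := by
    rw [injective_iff_map_eq_zero]
    intro z hz₁
    refine hz z hz₁ ?_
    have := h₂₁ z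
    rwa [hz₁, norm_zero, norm_le_zero_iff] at this
  have inj₂ : Function.Injective q₂ := by
    rw [injective_iff_map_eq_zero]
    intro z hz₂
    refine hz z ?_ hz₂
    have := h₁₂ z
    rwa [hz₂, norm_zero, norm_le_zero_iff] at this
  have lift₁ : ∀ {a : selfAdjoint X.carrier} {l : ℝ≥0}, X.L a ≤ l →
      ∃ z : selfAdjoint C, mapSA q₁ z = a ∧ Y.L (mapSA q₂ z) ≤ l := by
    intro a l ha
    obtain ⟨b, hb, hab⟩ := exists_related (𝒰 := 𝒰) hτ he ha
    exact ⟨toJlClosure _ (memS hab), mapSA_fst_pairSA a b, by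
      convert hb; exact mapSA_snd_pairSA a b⟩
  have lift₂ : ∀ {b : selfAdjoint Y.carrier} {l : ℝ≥0}, Y.L b ≤ l →
      ∃ z : selfAdjoint C, mapSA q₂ z = b ∧ X.L (mapSA q₁ z) ≤ l := by
    intro b l hb
    obtain ⟨a, ha, hab⟩ := exists_related (τ := fun n => (τ n).symm) (𝒰 := 𝒰) (e := e)
      (fun n => ⟨(hτ n).right, (hτ n).left⟩) he hb
    exact ⟨toJlClosure _ (memS hab.symm), mapSA_snd_pairSA a b, by
      convert ha; exact mapSA_fst_pairSA a b⟩
  have surj₁ : Function.Surjective q₁ := by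
    refine surjective_of_dense q₁ _ X.dense_dom fun a ha => ?_
    obtain ⟨z, hz, -⟩ := lift₁ (a := a) (l := (X.L a).toNNReal) (by
      rw [ENNReal.coe_toNNReal (ne_of_lt ha)])
    exact ⟨z, congrArg Subtype.val hz⟩
  have surj₂ : Function.Surjective q₂ := by
    refine surjective_of_dense q₂ _ Y.dense_dom fun b hb => ?_
    obtain ⟨z, hz, -⟩ := lift₂ (b := b) (l := (Y.L b).toNNReal) (by
      rw [ENNReal.coe_toNNReal (ne_of_lt hb)])
    exact ⟨z, congrArg Subtype.val hz⟩
  let e₁ : C ≃⋆ₐ[ℂ] X.carrier := StarAlgEquiv.ofBijective q₁ ⟨inj₁, surj₁⟩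
  let e₂ : C ≃⋆ₐ[ℂ] Y.carrier := StarAlgEquiv.ofBijective q₂ ⟨inj₂, surj₂⟩
  let π : X.carrier ≃⋆ₐ[ℂ] Y.carrier := e₁.symm.trans e₂
  have hπ : ∀ z : selfAdjoint C, mapSA (π : X.carrier →⋆ₐ[ℂ] Y.carrier) (mapSA q₁ z) =
      mapSA q₂ z := by
    intro z
    rw [mapSA_eq_iff]
    change e₂ (e₁.symm (e₁ z)) = e₂ z
    rw [StarAlgEquiv.symm_apply_apply]
  refine isometric_of_equiv π fun a => ?_
  obtain ⟨z, rfl⟩ := surjective_mapSA q₁ surj₁ a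
  rw [hπ]
  have isa₁ : Function.Injective (mapSA q₁) := fun z w h =>
    Subtype.ext (inj₁ (congrArg Subtype.val h))
  have isa₂ : Function.Injective (mapSA q₂) := fun z w h =>
    Subtype.ext (inj₂ (congrArg Subtype.val h))
  refine ENNReal.eq_of_forall_le_nnreal_iff fun l => ⟨fun hl => ?_, fun hl => ?_⟩
  · obtain ⟨w, hw, hwl⟩ := lift₂ hl
    rwa [isa₂ hw] at hwl
  · obtain ⟨w, hw, hwl⟩ := lift₁ hl
    rwa [isa₁ hw] at hwl

end

end QuasiLeibniz

namespace QuasiLeibniz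

noncomputable section

open Filter Topology
open scoped ComplexStarModule

/-! ### C*-algebras of bounded families, and C*-quotients -/

section Lp

variable {I : Type v} {E : I → Type u} [∀ i, CStarAlgebra (E i)] [∀ i, Nontrivial (E i)]

instance : CStarAlgebra (lp E ∞) where

/-- The coordinates of a bounded family. -/
def lpEval (i : I) : lp E ∞ →⋆ₐ[ℂ] E i where
  toFun f := f i
  map_one' := rfl
  map_mul' _ _ := rfl
  map_zero' := rfl
  map_add' _ _ := rfl
  commutes' _ := rfl
  map_star' _ := rfl

/-- The morphism to bounded families with given coordinates. -/
def lpPi {A : Type*} [CStarAlgebra A] (f : ∀ i, A →⋆ₐ[ℂ] E i) : A →⋆ₐ[ℂ] lp E ∞ where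
  toFun a := ⟨fun i => f i a, memℓp_infty ⟨‖a‖, by
    rintro _ ⟨i, rfl⟩; exact NonUnitalStarAlgHom.norm_apply_le (f i) a⟩⟩
  map_one' := Subtype.ext <| funext fun i => map_one (f i)
  map_mul' _ _ := Subtype.ext <| funext fun i => map_mul (f i) _ _
  map_zero' := Subtype.ext <| funext fun i => map_zero (f i)
  map_add' _ _ := Subtype.ext <| funext fun i => map_add (f i) _ _
  commutes' c := Subtype.ext <| funext fun i => (f i).commutes c
  map_star' _ := Subtype.ext <| funext fun i => map_star (f i) _

theorem norm_lp_le {z : lp E ∞} {r : ℝ} (hr : 0 ≤ r) (h : ∀ i, ‖lpEval i z‖ ≤ r) : ‖z‖ ≤ r :=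
  lp.norm_le_of_forall_le hr h

end Lp

section Completion

open UniformSpace

variable {A : Type u} [SeminormedRing A] [StarRing A] [NormedAlgebra ℂ A] [StarModule ℂ A]

/-- The completion of a *-algebra for a C*-seminorm is a C*-algebra. -/
theorem exists_completion_of_seminorm (hs : ∀ a : A, ‖star a‖ = ‖a‖)
    (h : ∀ a : A, ‖star a * a‖ = ‖a‖ * ‖a‖) :
    ∃ (B : Type u) (_ : CStarAlgebra B) (q : A →⋆ₐ[ℂ] B), DenseRange q ∧ ∀ a, ‖q a‖ = ‖a‖ := by
  have hu : UniformContinuous (star : A → A) := by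
    have : Isometry (star : A → A) := Isometry.of_dist_eq fun a b => by
      rw [dist_eq_norm, dist_eq_norm, ← star_sub, hs]
    exact this.uniformContinuous
  let _ : Star (Completion A) := ⟨Completion.map star⟩
  have hc : Continuous (star : Completion A → Completion A) := Completion.continuous_map
  have _ : ContinuousStar (Completion A) := ⟨hc⟩
  have hcoe : ∀ a : A, star (a : Completion A) = ((star a : A) : Completion A) :=
    fun a => Completion.map_coe hu a
  let _ : StarRing (Completion A) :=
    { star_involutive := fun x => by
        induction x using Completion.induction_on with
        | hp => exact isClosed_eq (hc.comp hc) continuous_id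
        | ih a => rw [hcoe, hcoe, star_star]
      star_mul := fun x y => by
        induction x, y using Completion.induction_on₂ with
        | hp => exact isClosed_eq (hc.comp continuous_mul)
                  (Continuous.mul (hc.comp continuous_snd) (hc.comp continuous_fst))
        | ih a b => rw [← Completion.coe_mul, hcoe, hcoe, hcoe, star_mul, Completion.coe_mul]
      star_add := fun x y => by
        induction x, y using Completion.induction_on₂ with
        | hp => exact isClosed_eq (hc.comp continuous_add)
                  (Continuous.add (hc.comp continuous_fst) (hc.comp continuous_snd))
        | ih a b => rw [← Completion.coe_add, hcoe, hcoe, hcoe, star_add, Completion.coe_add] }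
  have hcs : ∀ x : Completion A, ‖star x * x‖ = ‖x‖ * ‖x‖ := fun x => by
    induction x using Completion.induction_on with
    | hp => exact isClosed_eq ((hc.mul continuous_id).norm) (continuous_norm.mul continuous_norm)
    | ih a => rw [hcoe, ← Completion.coe_mul, Completion.norm_coe, Completion.norm_coe, h]
  have hsm : ∀ (c : ℂ) (x : Completion A), star (c • x) = star c • star x := fun c x => by
    induction x using Completion.induction_on with
    | hp => exact isClosed_eq (hc.comp (continuous_const_smul c)) (hc.const_smul (star c))
    | ih a => rw [← Completion.coe_smul, hcoe, hcoe, star_smul, Completion.coe_smul]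
  let _ : CStarAlgebra (Completion A) :=
    { norm_smul_le := norm_smul_le
      norm_mul_self_le := fun x => (hcs x).ge
      star_smul := hsm }
  exact ⟨Completion A, inferInstance,
    { toFun := fun a => (a : Completion A)
      map_one' := rfl
      map_mul' := fun a b => Completion.coe_mul a b
      map_zero' := rfl
      map_add' := fun a b => Completion.coe_add a b
      commutes' := fun c => rfl
      map_star' := fun a => (hcoe a).symm }, Completion.denseRange_coe, Completion.norm_coe⟩

end Completion

/-- A C*-algebra has a quotient for each C*-seminorm. The canonical map to the completion is
surjective, because its range is dense, and closed as the range of a morphism of C*-algebras. -/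
theorem exists_quotient_of_seminorm {A : Type u} [CStarAlgebra A] (p : A → ℝ)
    (p_add : ∀ a b, p (a + b) ≤ p a + p b)
    (p_smul : ∀ (c : ℂ) a, p (c • a) = ‖c‖ * p a) (p_mul : ∀ a b, p (a * b) ≤ p a * p b)
    (p_star : ∀ a, p (star a) = p a) (p_cstar : ∀ a, p (star a * a) = p a * p a) :
    ∃ (B : Type u) (_ : CStarAlgebra B) (q : A →⋆ₐ[ℂ] B), Function.Surjective q ∧
      ∀ a, ‖q a‖ = p a := by
  let p' : RingSeminorm A :=
    { toFun := p
      map_zero' := by have := p_smul 0 0; rwa [zero_smul, norm_zero, zero_mul] at this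
      add_le' := p_add
      neg' := fun a => by
        have := p_smul (-1) a
        rwa [neg_one_smul, norm_neg, norm_one, one_mul] at this
      mul_le' := p_mul }
  -- The algebra `A` is regarded as a seminormed algebra for `p`, instead of its own norm.
  let i₁ : Algebra ℂ A := inferInstance
  have i₂ : StarModule ℂ A := inferInstance
  let i₃ : SeminormedRing A := p'.toSeminormedRing
  let i₄ : @NormedAlgebra ℂ A _ i₃ :=
    @NormedAlgebra.mk ℂ A _ i₃ i₁ fun c a => (p_smul c a).le
  have key := @exists_completion_of_seminorm A i₃ inferInstance i₄ i₂ p_star p_cstar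
  obtain ⟨B, hB, q, hq, hp⟩ := key
  refine ⟨B, hB, q, ?_, hp⟩
  rw [← Set.range_eq_univ, ← (isClosed_range q).closure_eq]
  exact Dense.closure_eq hq

/-- A morphism factors through any surjective morphism that dominates it in norm. -/
theorem exists_factor {A B C : Type*} [CStarAlgebra A] [CStarAlgebra B] [CStarAlgebra C]
    (r : A →⋆ₐ[ℂ] C) (hr : Function.Surjective r) (q : A →⋆ₐ[ℂ] B) (h : ∀ a, ‖q a‖ ≤ ‖r a‖) :
    ∃ s : C →⋆ₐ[ℂ] B, ∀ a, s (r a) = q a := by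
  have key : ∀ a b, r a = r b → q a = q b := by
    intro a b hab
    have h1 := h (a - b)
    rw [map_sub, map_sub, hab, sub_self, norm_zero, norm_le_zero_iff, sub_eq_zero] at h1
    exact h1
  choose σ hσ using hr
  have hs : ∀ a, q (σ (r a)) = q a := fun a => key _ _ (hσ _)
  exact ⟨{
    toFun := fun c => q (σ c)
    map_one' := by rw [← map_one r, hs, map_one]
    map_mul' := fun c d => by rw [← map_mul]; exact key _ _ (by rw [map_mul, hσ, hσ, hσ])
    map_zero' := by rw [← map_zero r, hs, map_zero]
    map_add' := fun c d => by rw [← map_add]; exact key _ _ (by rw [map_add, hσ, hσ, hσ])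
    commutes' := fun c => by rw [← r.commutes c]; exact (hs _).trans (q.commutes c)
    map_star' := fun c => by rw [← map_star]; exact key _ _ (by rw [map_star, hσ, hσ]) }, hs⟩

/-- Morphisms between C*-algebras generated by Jordan-Lie algebras. -/
def jlClosureMap {A : Type u} {B : Type v} [CStarAlgebra A] [CStarAlgebra B]
    {S : Submodule ℝ (selfAdjoint A)} {h1 : (1 : selfAdjoint A) ∈ S}
    {hS : ∀ i, ∀ a ∈ S, ∀ b ∈ S, jl i a b ∈ S}
    {T : Submodule ℝ (selfAdjoint B)} {h1' : (1 : selfAdjoint B) ∈ T}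
    {hT : ∀ i, ∀ a ∈ T, ∀ b ∈ T, jl i a b ∈ T} (f : A →⋆ₐ[ℂ] B)
    (hf : ∀ a ∈ S, mapSA f a ∈ T) : jlClosure S h1 hS →⋆ₐ[ℂ] jlClosure T h1' hT :=
  StarAlgHom.codRestrict (f.comp (jlClosure S h1 hS).subtype) (jlClosure T h1' hT) fun z => by
    have hc : Continuous f :=
      haveI := NonUnitalStarAlgHom.instContinuousLinearMapClassComplex (F := A →⋆ₐ[ℂ] B)
      map_continuous f
    refine map_mem_closure (s := (jlStarSubalgebra S h1 hS : Set A)) hc z.2 fun x hx => ?_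
    have hre : ℜ (f x) = mapSA f (ℜ x) := Subtype.ext <| by
      rw [coe_mapSA, realPart_apply_coe, realPart_apply_coe, ← Complex.coe_smul, ← Complex.coe_smul,
        map_smul, map_add, map_star]
    have him : ℑ (f x) = mapSA f (ℑ x) := Subtype.ext <| by
      rw [coe_mapSA, imaginaryPart_apply_coe, imaginaryPart_apply_coe, ← Complex.coe_smul,
        ← Complex.coe_smul, map_smul, map_smul, map_sub, map_star]
    change ℜ (f x) ∈ T ∧ ℑ (f x) ∈ T
    rw [hre, him]
    exact ⟨hf _ hx.1, hf _ hx.2⟩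

/-! ### Quotients of spaces -/

section Quotient

variable {F : ℝ≥0 × ℝ≥0 × ℝ≥0 × ℝ≥0 → ℝ≥0} (X : Space.{u} F) {B : Type u} [CStarAlgebra B]
  (q : X.carrier →⋆ₐ[ℂ] B)

/-- The quotient seminorm. -/
def quotientL (b : selfAdjoint B) : ℝ≥0∞ := ⨅ (d : selfAdjoint X.carrier) (_ : q d = b), X.L d

theorem quotientL_map_le (d : selfAdjoint X.carrier) : quotientL X q (mapSA q d) ≤ X.L d :=
  iInf₂_le (f := fun (e : selfAdjoint X.carrier) (_ : q e = mapSA q d) => X.L e) d rfl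

variable [Nontrivial B]

theorem quotientL_le_iff (b : selfAdjoint B) (l : ℝ≥0) :
    quotientL X q b ≤ l ↔ ∃ d, mapSA q d = b ∧ X.L d ≤ l :=
  ⟨fun h => X.exists_lift q h, fun ⟨d, hd, hl⟩ => hd ▸ (quotientL_map_le X q d).trans hl⟩

theorem exists_quotientL_eq {b : selfAdjoint B} (hb : quotientL X q b ≠ ⊤) :
    ∃ d, mapSA q d = b ∧ X.L d ≤ quotientL X q b := by
  have := (quotientL_le_iff X q b (quotientL X q b).toNNReal).1 (by rw [ENNReal.coe_toNNReal hb])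
  rwa [ENNReal.coe_toNNReal hb] at this

/-- Near a given element, the unit ball of the quotient seminorm is in the image of a compact set. -/
theorem isClosed_quotientL : IsClosed {b | quotientL X q b ≤ 1} := by
  rw [← closure_subset_iff_isClosed]
  intro b hb
  obtain ⟨K, hK⟩ : ∃ K : ℝ≥0, X.diam ≤ K := ⟨X.diam.toNNReal, by
    rw [ENNReal.coe_toNNReal X.diam_lt_top.ne]⟩
  let R : ℝ≥0 := ‖b‖₊ + 1 + K + K
  have hcl : IsClosed (mapSA q '' {d | X.L d ≤ (1 : ℝ≥0) ∧ ‖d‖ ≤ R}) :=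
    ((X.isCompact_ball 1 R).image (continuous_mapSA q)).isClosed
  have hb' : b ∈ closure ({b | quotientL X q b ≤ 1} ∩ Metric.ball b 1) :=
    (mem_closure_iff_nhds.2 fun U hU => by
      obtain ⟨x, hx⟩ := mem_closure_iff_nhds.1 hb _ (inter_mem hU (Metric.ball_mem_nhds b one_pos))
      exact ⟨x, hx.1.1, hx.2, hx.1.2⟩)
  suffices hsub : {b | quotientL X q b ≤ 1} ∩ Metric.ball b 1 ⊆
      mapSA q '' {d | X.L d ≤ (1 : ℝ≥0) ∧ ‖d‖ ≤ R} by
    obtain ⟨d, hd, hdb⟩ := closure_minimal hsub hcl hb'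
    have h1 : X.L d ≤ 1 := by simpa using hd.1
    rw [Set.mem_ofPred_eq, ← hdb]
    exact (quotientL_map_le X q d).trans h1
  rintro c hc
  obtain ⟨d, rfl, hd⟩ := (quotientL_le_iff X q c 1).1 (by simpa using hc.1)
  obtain ⟨t, ht⟩ := X.exists_norm_sub_scalar_le hK hd
  refine ⟨d, ⟨hd, ?_⟩, rfl⟩
  have hc2 : ‖mapSA q d - b‖ < 1 := by rw [← dist_eq_norm]; exact hc.2
  -- A lift is close to a scalar `t`, which is bounded because the image is.
  have h1 : ‖mapSA q d - t • (1 : selfAdjoint B)‖ ≤ K := by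
    rw [← mapSA_scalar q, ← map_sub]
    exact (norm_mapSA_le _ _).trans (ht.trans (by simp))
  have h2 : ‖t • (1 : selfAdjoint B)‖ ≤ ‖b‖ + 1 + K := by
    have e : t • (1 : selfAdjoint B) = b + (mapSA q d - b) - (mapSA q d - t • 1) := by abel
    rw [e]
    exact (norm_sub_le _ _).trans (add_le_add ((norm_add_le _ _).trans (by gcongr)) h1)
  rw [norm_smul, norm_selfAdjoint_one, mul_one] at h2
  have h3 : ‖d‖ ≤ ‖d - t • (1 : selfAdjoint X.carrier)‖ + ‖t • (1 : selfAdjoint X.carrier)‖ := by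
    have := norm_add_le (d - t • (1 : selfAdjoint X.carrier)) (t • (1 : selfAdjoint X.carrier))
    rwa [sub_add_cancel] at this
  rw [norm_smul, norm_selfAdjoint_one, mul_one] at h3
  simp only [NNReal.coe_one, mul_one] at ht
  simp only [R, NNReal.coe_add, NNReal.coe_one, coe_nnnorm]
  linarith

/-- A quotient of a space, where only the quasi-Leibniz inequality does not come for free. -/
def quotientSpace (hq : Function.Surjective q)
    (L_leibniz : ∀ (i : Bool) (d e : selfAdjoint X.carrier) (l m : ℝ≥0), X.L d ≤ l → X.L e ≤ m →
      quotientL X q (jl i (mapSA q d) (mapSA q e)) ≤ F (‖mapSA q d‖₊, ‖mapSA q e‖₊, l, m)) :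
    Space.{u} F :=
  Space.ofTotallyBounded B (quotientL X q)
    (by
      intro a b
      by_cases ha : quotientL X q a = ⊤
      · rw [ha, top_add]; exact le_top
      by_cases hb : quotientL X q b = ⊤
      · rw [hb, add_top]; exact le_top
      obtain ⟨d, hd, hdl⟩ := exists_quotientL_eq X q ha
      obtain ⟨e, he, hel⟩ := exists_quotientL_eq X q hb
      rw [← hd, ← he, ← map_add, hd, he]
      exact (quotientL_map_le X q _).trans ((X.L_add d e).trans (add_le_add hdl hel)))
    (by
      have key : ∀ (t : ℝ) (a : selfAdjoint B), t ≠ 0 →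
          quotientL X q (t • a) ≤ ‖t‖ₑ * quotientL X q a := by
        intro t a ht
        by_cases ha : quotientL X q a = ⊤
        · rw [ha, ENNReal.mul_top (by simpa using ht)]; exact le_top
        obtain ⟨d, hd, hdl⟩ := exists_quotientL_eq X q ha
        rw [← hd, ← map_smul, hd]
        refine (quotientL_map_le X q _).trans ?_
        rw [X.L_smul]
        exact mul_le_mul_right hdl _
      intro t a
      by_cases ht : t = 0
      · rw [ht, zero_smul, enorm_zero, zero_mul, ← map_zero (mapSA q)]
        exact le_antisymm ((quotientL_map_le X q 0).trans X.L_zero.le) zero_le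
      · refine le_antisymm (key t a ht) ?_
        have h1 := key t⁻¹ (t • a) (inv_ne_zero ht)
        rw [smul_smul, inv_mul_cancel₀ ht, one_smul] at h1
        calc ‖t‖ₑ * quotientL X q a ≤ ‖t‖ₑ * (‖t⁻¹‖ₑ * quotientL X q (t • a)) :=
              mul_le_mul_right h1 _
          _ = quotientL X q (t • a) := by
              rw [← mul_assoc, ← enorm_mul, mul_inv_cancel₀ ht, enorm_one, one_mul])
    (by
      refine ((surjective_mapSA q hq).denseRange.dense_image (continuous_mapSA q) X.dense_dom).mono ?_
      rintro _ ⟨d, hd, rfl⟩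
      exact (quotientL_map_le X q d).trans_lt hd)
    (by
      intro a
      constructor
      · intro h
        obtain ⟨d, rfl, hd⟩ := (quotientL_le_iff X q a 0).1 (by rw [h]; exact zero_le)
        obtain ⟨t, rfl⟩ := (X.L_eq_zero d).1 (le_antisymm hd zero_le)
        exact ⟨t, mapSA_scalar q t⟩
      · rintro ⟨t, rfl⟩
        rw [← mapSA_scalar q]
        exact le_antisymm ((quotientL_map_le X q _).trans (X.L_scalar t).le) zero_le)
    (isClosed_quotientL X q)
    (by
      obtain ⟨K, hK, h⟩ := X.exists_totallyBounded
      have hu : UniformContinuous (mapSA q) :=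
        ((mapSA q : selfAdjoint X.carrier →+ selfAdjoint B).uniformContinuous_of_continuousAt_zero
          (continuous_mapSA q).continuousAt)
      refine ⟨mapSA q '' K, hK.image hu, fun a ha => ?_⟩
      obtain ⟨d, rfl, hd⟩ := (quotientL_le_iff X q a 1).1 (by simpa using ha)
      obtain ⟨t, ht⟩ := h d (by simpa using hd)
      exact ⟨t, _, ht, by rw [map_sub, mapSA_scalar]⟩)
    (by
      intro i a b l m ha hb
      obtain ⟨d, rfl, hd⟩ := (quotientL_le_iff X q a l).1 ha
      obtain ⟨e, rfl, he⟩ := (quotientL_le_iff X q b m).1 hb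
      exact L_leibniz i d e l m hd he)

end Quotient

end

end QuasiLeibniz

namespace QuasiLeibniz

noncomputable section

open Filter Topology

variable {F : ℝ≥0 × ℝ≥0 × ℝ≥0 × ℝ≥0 → ℝ≥0}

/-! ### The space of coherent sequences of a chain of tunnels -/

/-- Chains of tunnels between consecutive spaces, of extents `e n` whose sum from the index `n` on
is at most `t n`. -/
structure Chain (X : ℕ → Space.{u} F) where
  τ : ∀ n, Tunnel (X n) (X (n + 1))
  e : ℕ → ℝ≥0
  t : ℕ → ℝ≥0
  extentLE : ∀ n, (τ n).ExtentLE (e n)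
  add_le : ∀ n, e n + t (n + 1) ≤ t n
  tendsto : Tendsto t atTop (𝓝 0)

namespace Chain

variable {X : ℕ → Space.{u} F} (T : Chain X)

theorem antitone : Antitone T.t :=
  antitone_nat_of_succ_le fun n => le_add_self.trans (T.add_le n)

/-- Sequences of elements of the tunnels, from the index `n` on, with seminorms at most `l`, such
that consecutive terms have the same image in the space between their tunnels. -/
structure Coherent (n : ℕ) (l : ℝ≥0) (y : ∀ k, n ≤ k → selfAdjoint (T.τ k).D.carrier) : Prop where
  compat : ∀ k h, mapSA (T.τ k).π₂ (y k h) =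
    mapSA (T.τ (k + 1)).π₁ (y (k + 1) (h.trans k.le_succ))
  L_le : ∀ k h, (T.τ k).D.L (y k h) ≤ l

variable {T}

namespace Coherent

variable {n : ℕ} {l : ℝ≥0} {y : ∀ k, n ≤ k → selfAdjoint (T.τ k).D.carrier}

theorem norm_succ_le (hy : T.Coherent n l y) (k : ℕ) (h : n ≤ k) :
    ‖y (k + 1) (h.trans k.le_succ)‖ ≤ ‖y k h‖ + T.e (k + 1) * l := by
  have h1 := (T.extentLE (k + 1)).left _ l (hy.L_le (k + 1) (h.trans k.le_succ))
  rw [← hy.compat] at h1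
  exact h1.trans (by gcongr; exact norm_mapSA_le _ _)

theorem norm_le_succ (hy : T.Coherent n l y) (k : ℕ) (h : n ≤ k) :
    ‖y k h‖ ≤ ‖y (k + 1) (h.trans k.le_succ)‖ + T.e k * l := by
  have h1 := (T.extentLE k).right _ l (hy.L_le k h)
  rw [hy.compat] at h1
  exact h1.trans (by gcongr; exact norm_mapSA_le _ _)

/-- A term of a coherent sequence bounds the norms of the later ones, up to the extents in between. -/
theorem norm_le_of_le (hy : T.Coherent n l y) {m k : ℕ} (hm : n ≤ m) (h : m ≤ k) :
    ‖y k (hm.trans h)‖ ≤ ‖y m hm‖ + T.t (m + 1) * l := by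
  have key : ∀ k (h : m ≤ k),
      ‖y k (hm.trans h)‖ + T.t (k + 1) * l ≤ ‖y m hm‖ + T.t (m + 1) * l := by
    intro k h
    induction k, h using Nat.le_induction with
    | base => exact le_rfl
    | succ k h ih =>
      have h1 := hy.norm_succ_le k (hm.trans h)
      have h2 : (T.e (k + 1) : ℝ) + T.t (k + 1 + 1) ≤ T.t (k + 1) := T.add_le (k + 1)
      nlinarith [mul_le_mul_of_nonneg_right h2 l.2]
  have := key k h
  have h0 : (0 : ℝ) ≤ T.t (k + 1) * l := by positivity
  linarith

/-- A term of a coherent sequence bounds the norms of the earlier ones, up to the extents in between. -/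
theorem norm_le_of_ge (hy : T.Coherent n l y) {m k : ℕ} (hm : n ≤ m) (h : m ≤ k) :
    ‖y m hm‖ ≤ ‖y k (hm.trans h)‖ + T.t m * l := by
  have key : ∀ k (h : m ≤ k),
      ‖y m hm‖ + T.t k * l ≤ ‖y k (hm.trans h)‖ + T.t m * l := by
    intro k h
    induction k, h using Nat.le_induction with
    | base => exact le_rfl
    | succ k h ih =>
      have h1 := hy.norm_le_succ k (hm.trans h)
      have h2 : (T.e k : ℝ) + T.t (k + 1) ≤ T.t k := T.add_le k
      nlinarith [mul_le_mul_of_nonneg_right h2 l.2]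
  have := key k h
  have h0 : (0 : ℝ) ≤ T.t k * l := by positivity
  linarith

end Coherent

variable (T)

/-- The bounded sequences of elements of the tunnels, from the index `n` on. -/
def Tails (n : ℕ) : Type u := lp (fun k : Set.Ici n => (T.τ k).D.carrier) ∞

instance (n : ℕ) : CStarAlgebra (T.Tails n) :=
  inferInstanceAs (CStarAlgebra (lp (fun k : Set.Ici n => (T.τ k).D.carrier) ∞))

/-- The coordinates of a bounded sequence. -/
def tailCoord (n k : ℕ) (h : n ≤ k) : T.Tails n →⋆ₐ[ℂ] (T.τ k).D.carrier :=
  lpEval (E := fun k : Set.Ici n => (T.τ k).D.carrier) ⟨k, h⟩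

theorem norm_tails_le {n : ℕ} {z : T.Tails n} {r : ℝ} (hr : 0 ≤ r)
    (h : ∀ k h, ‖T.tailCoord n k h z‖ ≤ r) : ‖z‖ ≤ r :=
  norm_lp_le hr fun k => h k.1 k.2

theorem exists_tails {n : ℕ} {l : ℝ≥0} {y : ∀ k, n ≤ k → selfAdjoint (T.τ k).D.carrier}
    (hy : T.Coherent n l y) : ∃ d : selfAdjoint (T.Tails n), ∀ k h,
      mapSA (T.tailCoord n k h) d = y k h := by
  refine ⟨⟨⟨fun k => (y k.1 k.2 : (T.τ k).D.carrier), memℓp_infty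
    ⟨‖y n le_rfl‖ + T.t (n + 1) * l, ?_⟩⟩, ?_⟩, fun k h => rfl⟩
  · rintro _ ⟨k, rfl⟩
    exact hy.norm_le_of_le le_rfl k.2
  · exact Subtype.ext (funext fun k => (y k.1 k.2).2)

/-- The Jordan-Lie algebra of coherent sequences. -/
def tailJL (n : ℕ) : Submodule ℝ (selfAdjoint (T.Tails n)) where
  carrier := {d | ∃ l, T.Coherent n l fun k h => mapSA (T.tailCoord n k h) d}
  add_mem' := by
    rintro a b ⟨l, ha⟩ ⟨m, hb⟩
    refine ⟨l + m, fun k h => ?_, fun k h => ?_⟩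
    · simp only [map_add]
      exact congrArg₂ (· + ·) (ha.compat k h) (hb.compat k h)
    · rw [map_add, ENNReal.coe_add]
      exact ((T.τ k).D.L_add _ _).trans (add_le_add (ha.L_le k h) (hb.L_le k h))
  zero_mem' := by
    refine ⟨0, fun k h => ?_, fun k h => ?_⟩
    · simp only [map_zero]
    · rw [map_zero, Space.L_zero]; exact zero_le
  smul_mem' := by
    rintro t a ⟨l, ha⟩
    refine ⟨‖t‖₊ * l, fun k h => ?_, fun k h => ?_⟩
    · simp only [map_smul]
      exact congrArg (t • ·) (ha.compat k h)
    · rw [map_smul, Space.L_smul, ENNReal.coe_mul]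
      exact mul_le_mul_right (ha.L_le k h) _

theorem one_mem_tailJL (n : ℕ) : (1 : selfAdjoint (T.Tails n)) ∈ T.tailJL n := by
  refine ⟨0, fun k h => ?_, fun k h => ?_⟩
  · simp only [mapSA_one]
  · rw [mapSA_one, Space.L_one]; exact zero_le

variable (hF : Permissible F)

theorem jl_mem_tailJL (hF : Permissible F) (n : ℕ) (i : Bool) :
    ∀ a ∈ T.tailJL n, ∀ b ∈ T.tailJL n, jl i a b ∈ T.tailJL n := by
  rintro a ⟨l, ha⟩ b ⟨m, hb⟩
  refine ⟨F (‖a‖₊, ‖b‖₊, l, m), fun k h => ?_, fun k h => ?_⟩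
  · simp only [mapSA_jl]
    rw [ha.compat k h, hb.compat k h]
  · rw [mapSA_jl]
    exact (T.τ k).D.L_jl_le hF i (norm_mapSA_le _ _) (norm_mapSA_le _ _) (ha.L_le k h) (hb.L_le k h)

/-- The C*-algebra generated by the coherent sequences. -/
def TailAlgebra (n : ℕ) : Type u :=
  jlClosure (T.tailJL n) (T.one_mem_tailJL n) (T.jl_mem_tailJL hF n)

instance (n : ℕ) : CStarAlgebra (T.TailAlgebra hF n) :=
  inferInstanceAs (CStarAlgebra (jlClosure (T.tailJL n) (T.one_mem_tailJL n)
    (T.jl_mem_tailJL hF n)))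

/-- The elements of the C*-algebra of coherent sequences, as bounded sequences. -/
def tailInclusion (n : ℕ) : T.TailAlgebra hF n →⋆ₐ[ℂ] T.Tails n :=
  (jlClosure (T.tailJL n) (T.one_mem_tailJL n) (T.jl_mem_tailJL hF n)).subtype

theorem dense_tailJL (n : ℕ) :
    Dense {d : selfAdjoint (T.TailAlgebra hF n) | mapSA (T.tailInclusion hF n) d ∈ T.tailJL n} :=
  dense_jlClosure

/-- The coordinates of an element of the C*-algebra of coherent sequences. -/
def coord (n k : ℕ) (h : n ≤ k) : T.TailAlgebra hF n →⋆ₐ[ℂ] (T.τ k).D.carrier :=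
  (T.tailCoord n k h).comp (T.tailInclusion hF n)

instance (n : ℕ) : Nontrivial (T.TailAlgebra hF n) :=
  (T.coord hF n n le_rfl).toRingHom.domain_nontrivial

theorem norm_tailAlgebra_le {n : ℕ} {z : T.TailAlgebra hF n} {r : ℝ} (hr : 0 ≤ r)
    (h : ∀ k h, ‖T.coord hF n k h z‖ ≤ r) : ‖z‖ ≤ r :=
  T.norm_tails_le hr h

theorem norm_mapSA_coord_le {n : ℕ} {d : selfAdjoint (T.TailAlgebra hF n)} {r : ℝ} (hr : 0 ≤ r)
    (h : ∀ k h, ‖mapSA (T.coord hF n k h) d‖ ≤ r) : ‖d‖ ≤ r :=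
  T.norm_tailAlgebra_le hF hr h

theorem compat_coord {n : ℕ} (d : selfAdjoint (T.TailAlgebra hF n)) (k : ℕ) (h : n ≤ k) :
    mapSA (T.τ k).π₂ (mapSA (T.coord hF n k h) d) =
      mapSA (T.τ (k + 1)).π₁ (mapSA (T.coord hF n (k + 1) (h.trans k.le_succ)) d) := by
  have hcl : IsClosed {d : selfAdjoint (T.TailAlgebra hF n) |
      mapSA (T.τ k).π₂ (mapSA (T.coord hF n k h) d) =
      mapSA (T.τ (k + 1)).π₁ (mapSA (T.coord hF n (k + 1) (h.trans k.le_succ)) d)} :=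
    isClosed_eq ((continuous_mapSA _).comp (continuous_mapSA _))
      ((continuous_mapSA _).comp (continuous_mapSA _))
  refine closure_minimal ?_ hcl (T.dense_tailJL hF n d)
  rintro d ⟨l, hl⟩
  exact hl.compat k h

theorem exists_coord {n : ℕ} {l : ℝ≥0} {y : ∀ k, n ≤ k → selfAdjoint (T.τ k).D.carrier}
    (hy : T.Coherent n l y) : ∃ d : selfAdjoint (T.TailAlgebra hF n), ∀ k h,
      mapSA (T.coord hF n k h) d = y k h := by
  obtain ⟨d, hd⟩ := T.exists_tails hy
  refine ⟨toJlClosure d ⟨l, ?_⟩, hd⟩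
  simp only [hd]; exact hy

/-- The supremum of the seminorms of the coordinates. -/
def tailL (n : ℕ) (d : selfAdjoint (T.TailAlgebra hF n)) : ℝ≥0∞ :=
  ⨆ (k : ℕ) (h : n ≤ k), (T.τ k).D.L (mapSA (T.coord hF n k h) d)

theorem tailL_le_iff {n : ℕ} (d : selfAdjoint (T.TailAlgebra hF n)) (l : ℝ≥0∞) :
    T.tailL hF n d ≤ l ↔ ∀ k h, (T.τ k).D.L (mapSA (T.coord hF n k h) d) ≤ l := iSup₂_le_iff

theorem L_coord_le {n : ℕ} (d : selfAdjoint (T.TailAlgebra hF n)) (k : ℕ) (h : n ≤ k) :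
    (T.τ k).D.L (mapSA (T.coord hF n k h) d) ≤ T.tailL hF n d :=
  (T.tailL_le_iff hF d _).1 le_rfl k h

theorem coherent_coord {n : ℕ} {d : selfAdjoint (T.TailAlgebra hF n)} {l : ℝ≥0}
    (hd : T.tailL hF n d ≤ l) : T.Coherent n l fun k h => mapSA (T.coord hF n k h) d :=
  ⟨T.compat_coord hF d, (T.tailL_le_iff hF d l).1 hd⟩

theorem tailL_add (n : ℕ) (a b : selfAdjoint (T.TailAlgebra hF n)) :
    T.tailL hF n (a + b) ≤ T.tailL hF n a + T.tailL hF n b := by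
  refine (T.tailL_le_iff hF _ _).2 fun k h => ?_
  rw [map_add]
  exact ((T.τ k).D.L_add _ _).trans (add_le_add (T.L_coord_le hF a k h) (T.L_coord_le hF b k h))

theorem tailL_smul (n : ℕ) (t : ℝ) (a : selfAdjoint (T.TailAlgebra hF n)) :
    T.tailL hF n (t • a) = ‖t‖ₑ * T.tailL hF n a := by
  simp only [tailL, map_smul, Space.L_smul, ENNReal.mul_iSup]

theorem tailL_eq_zero (n : ℕ) (a : selfAdjoint (T.TailAlgebra hF n)) :
    T.tailL hF n a = 0 ↔ ∃ t : ℝ, a = t • (1 : selfAdjoint (T.TailAlgebra hF n)) := by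
  constructor
  · intro h0
    have h1 : ∀ k (h : n ≤ k), ∃ t : ℝ, mapSA (T.coord hF n k h) a = t • 1 := fun k h =>
      ((T.τ k).D.L_eq_zero _).1 (le_antisymm ((T.L_coord_le hF a k h).trans h0.le) zero_le)
    obtain ⟨t, ht⟩ := h1 n le_rfl
    have h2 : ∀ k (h : n ≤ k), mapSA (T.coord hF n k h) a = t • 1 := by
      intro k h
      induction k, h using Nat.le_induction with
      | base => exact ht
      | succ k h ih =>
        obtain ⟨s, hs⟩ := h1 (k + 1) (h.trans k.le_succ)
        have h3 := T.compat_coord hF a k h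
        rw [ih, hs, mapSA_scalar, mapSA_scalar] at h3
        have h4 : ‖(t - s) • (1 : selfAdjoint (X (k + 1)).carrier)‖ = 0 := by
          rw [sub_smul, h3, sub_self, norm_zero]
        rw [norm_smul, norm_selfAdjoint_one, mul_one, norm_eq_zero, sub_eq_zero] at h4
        rw [hs, h4]
    refine ⟨t, ?_⟩
    rw [← sub_eq_zero, ← norm_le_zero_iff]
    refine T.norm_mapSA_coord_le hF le_rfl fun k h => ?_
    rw [map_sub, mapSA_scalar, h2 k h, sub_self, norm_zero]
  · rintro ⟨t, rfl⟩
    refine le_antisymm ((T.tailL_le_iff hF _ _).2 fun k h => ?_) zero_le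
    rw [mapSA_scalar, Space.L_scalar]

theorem isClosed_tailL (n : ℕ) : IsClosed {d | T.tailL hF n d ≤ 1} := by
  have e : {d | T.tailL hF n d ≤ 1} =
      ⋂ (k : ℕ) (h : n ≤ k), mapSA (T.coord hF n k h) ⁻¹' {d | (T.τ k).D.L d ≤ 1} := by
    ext d
    simp only [Set.mem_iInter]
    exact T.tailL_le_iff hF d 1
  rw [e]
  exact isClosed_iInter fun k => isClosed_iInter fun h =>
    (T.τ k).D.isClosed_unitBall.preimage (continuous_mapSA _)

/-- The first coordinates determine a coherent sequence up to the sum of the remaining extents. -/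
theorem totallyBounded_tailL (n : ℕ) (R : ℝ≥0) :
    TotallyBounded {d | T.tailL hF n d ≤ 1 ∧ ‖mapSA (T.coord hF n n le_rfl) d‖ ≤ R} := by
  refine totallyBounded_of_approx.{u, u} fun ε hε => ?_
  obtain ⟨ε', hε0, hεε'⟩ := ENNReal.lt_iff_exists_nnreal_btwn.1 hε
  have hε' : 0 < ε' := by exact_mod_cast hε0
  obtain ⟨m, hm, hnm⟩ := ((T.tendsto.eventually_le_const (show 0 < ε' / 4 by positivity)).and
    (eventually_ge_atTop n)).exists
  refine ⟨∀ k : Set.Icc n m, selfAdjoint (T.τ k).D.carrier, inferInstance,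
    fun d k => mapSA (T.coord hF n k k.2.1) d, ?_, (ε' / 2 : ℝ≥0), by
      exact_mod_cast (show 0 < ε' / 2 by positivity), ?_⟩
  · have hc : IsCompact (Set.pi Set.univ fun k : Set.Icc n m =>
        {a | (T.τ k).D.L a ≤ (1 : ℝ≥0) ∧ ‖a‖ ≤ (R + T.t (n + 1) : ℝ≥0)}) :=
      isCompact_univ_pi fun k => (T.τ k).D.isCompact_ball 1 (R + T.t (n + 1))
    refine hc.totallyBounded.subset ?_
    rintro _ ⟨d, ⟨hd, hdR⟩, rfl⟩ k -
    have hco := T.coherent_coord hF (d := d) (l := 1) (by simpa using hd)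
    refine ⟨hco.L_le _ _, (hco.norm_le_of_le le_rfl k.2.1).trans ?_⟩
    push_cast
    linarith
  · rintro a ⟨ha, -⟩ b ⟨hb, -⟩ hab
    have hL : T.tailL hF n (a - b) ≤ (2 : ℝ≥0) := by
      refine (T.tailL_le_iff hF _ _).2 fun k h => ?_
      rw [map_sub]
      refine ((T.τ k).D.L_sub _ _).trans ((add_le_add ((T.L_coord_le hF a k h).trans ha)
        ((T.L_coord_le hF b k h).trans hb)).trans ?_)
      norm_num
    have hco := T.coherent_coord hF hL
    have hfirst : ∀ k (h : n ≤ k), k ≤ m → ‖mapSA (T.coord hF n k h) (a - b)‖ ≤ ε' / 2 := by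
      intro k h hk
      have h1 := (edist_le_pi_edist (fun k : Set.Icc n m => mapSA (T.coord hF n k k.2.1) a)
        (fun k : Set.Icc n m => mapSA (T.coord hF n k k.2.1) b) ⟨k, h, hk⟩).trans hab.le
      rw [edist_nndist, ENNReal.coe_le_coe, ← NNReal.coe_le_coe, coe_nndist, dist_eq_norm,
        ← map_sub] at h1
      simpa using h1
    refine lt_of_le_of_lt ?_ hεε'
    rw [edist_nndist, ENNReal.coe_le_coe, ← NNReal.coe_le_coe, coe_nndist, dist_eq_norm]
    refine T.norm_mapSA_coord_le hF ε'.2 fun k h => ?_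
    have hε'' : (0 : ℝ) ≤ ε' := ε'.2
    rcases le_total k m with hk | hk
    · exact (hfirst k h hk).trans (by linarith)
    · have h1 := hco.norm_le_of_le hnm hk
      have h2 := hfirst m hnm le_rfl
      have h3 : (T.t (m + 1) : ℝ) ≤ ε' / 4 := by
        exact_mod_cast (T.antitone m.le_succ).trans hm
      simp only [NNReal.coe_ofNat] at h1
      linarith

/-- The coherent sequences from the index `n` on, as a quantum compact metric space. -/
def tailSpace (n : ℕ) : Space.{u} F :=
  Space.ofTotallyBounded (T.TailAlgebra hF n) (T.tailL hF n) (T.tailL_add hF n) (T.tailL_smul hF n)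
    (by
      refine (T.dense_tailJL hF n).mono ?_
      rintro d ⟨l, hl⟩
      exact ((T.tailL_le_iff hF d l).2 hl.L_le).trans_lt ENNReal.coe_lt_top)
    (T.tailL_eq_zero hF n) (T.isClosed_tailL hF n)
    (by
      have hK : (T.τ n).D.diam ≤ ((T.τ n).D.diam.toNNReal : ℝ≥0) := by
        rw [ENNReal.coe_toNNReal (T.τ n).D.diam_lt_top.ne]
      refine ⟨_, T.totallyBounded_tailL hF n (T.τ n).D.diam.toNNReal, fun a ha => ?_⟩
      obtain ⟨t, ht⟩ := (T.τ n).D.exists_norm_sub_scalar_le hK (l := 1)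
        (((T.L_coord_le hF a n le_rfl).trans ha).trans (by simp))
      refine ⟨t, ?_, ?_⟩
      · refine (T.tailL_le_iff hF _ _).2 fun k h => ?_
        rw [map_sub, mapSA_scalar, Space.L_sub_scalar]
        exact (T.L_coord_le hF a k h).trans ha
      · rw [map_sub, mapSA_scalar]
        simpa using ht)
    (by
      intro i a b l m ha hb
      refine (T.tailL_le_iff hF _ _).2 fun k h => ?_
      rw [mapSA_jl]
      exact (T.τ k).D.L_jl_le hF i (norm_mapSA_le _ _) (norm_mapSA_le _ _)
        ((T.L_coord_le hF a k h).trans ha) ((T.L_coord_le hF b k h).trans hb))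

end Chain

end

end QuasiLeibniz

namespace QuasiLeibniz

noncomputable section

open Filter Topology

variable {F : ℝ≥0 × ℝ≥0 × ℝ≥0 × ℝ≥0 → ℝ≥0}

namespace Chain

variable {X : ℕ → Space.{u} F} (T : Chain X)

/-! ### The limit of a chain of tunnels -/

/-- A coherent sequence from the index `n` on is completed by lifting its first term successively to the
earlier tunnels. -/
theorem exists_coherent_extension (n : ℕ) {l : ℝ≥0}
    {y : ∀ k, n ≤ k → selfAdjoint (T.τ k).D.carrier} (hy : T.Coherent n l y) :
    ∃ z, T.Coherent 0 l z ∧ ∀ k (h : n ≤ k), z k k.zero_le = y k h := by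
  induction n with
  | zero => exact ⟨y, hy, fun k h => rfl⟩
  | succ n ih =>
    obtain ⟨d, hd, hdl⟩ := (T.τ n).exists_lift₂ (((T.τ (n + 1)).L_map₁_le _).trans
      (hy.L_le (n + 1) le_rfl))
    let y' : ∀ k, n ≤ k → selfAdjoint (T.τ k).D.carrier := fun k h =>
      Nat.leRec (motive := fun k _ => selfAdjoint (T.τ k).D.carrier) d
        (fun k h _ => y (k + 1) (Nat.succ_le_succ h)) h
    have hn : y' n le_rfl = d := Nat.leRec_self _ _
    have hs : ∀ k (h : n ≤ k), y' (k + 1) (h.trans k.le_succ) = y (k + 1) (Nat.succ_le_succ h) :=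
      fun k h => Nat.leRec_succ _ _ h
    have hy' : T.Coherent n l y' := by
      refine ⟨fun k h => ?_, fun k h => ?_⟩
      · rw [hs k h]
        rcases h.eq_or_lt with rfl | hlt
        · rw [hn, hd]
        · obtain ⟨j, rfl⟩ := Nat.exists_eq_add_of_lt hlt
          rw [hs (n + j) (Nat.le_add_right n j)]
          exact hy.compat _ _
      · rcases h.eq_or_lt with rfl | hlt
        · rw [hn]; exact hdl
        · obtain ⟨j, rfl⟩ := Nat.exists_eq_add_of_lt hlt
          rw [hs (n + j) (Nat.le_add_right n j)]
          exact hy.L_le _ _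
    obtain ⟨z, hz, hzy⟩ := ih hy'
    refine ⟨z, hz, fun k h => ?_⟩
    obtain ⟨j, rfl⟩ := Nat.exists_eq_add_of_lt h
    rw [hzy _ ((Nat.le_add_right n j).trans (Nat.le_succ _)), hs (n + j) (Nat.le_add_right n j)]

/-- An element of `X n` is lifted to the first tunnel, mapped to `X (n + 1)`, lifted to the second tunnel,
and so on. -/
theorem exists_coherent (n : ℕ) {l : ℝ≥0} {a : selfAdjoint (X n).carrier} (ha : (X n).L a ≤ l) :
    ∃ y, T.Coherent n l y ∧ mapSA (T.τ n).π₁ (y n le_rfl) = a := by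
  choose φ hφ hφl using fun (k : ℕ) (a : {a : selfAdjoint (X k).carrier // (X k).L a ≤ l}) =>
    (T.τ k).exists_lift₁ a.2
  let y : ∀ k, n ≤ k → {d : selfAdjoint (T.τ k).D.carrier // (T.τ k).D.L d ≤ l} := fun k h =>
    Nat.leRec (motive := fun k _ => {d : selfAdjoint (T.τ k).D.carrier // (T.τ k).D.L d ≤ l})
      ⟨φ n ⟨a, ha⟩, hφl n ⟨a, ha⟩⟩
      (fun k h d => ⟨φ (k + 1) ⟨mapSA (T.τ k).π₂ d.1, ((T.τ k).L_map₂_le d.1).trans d.2⟩,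
        hφl (k + 1) _⟩) h
  have hn : y n le_rfl = ⟨φ n ⟨a, ha⟩, hφl n ⟨a, ha⟩⟩ := Nat.leRec_self _ _
  have hs : ∀ k (h : n ≤ k), y (k + 1) (h.trans k.le_succ) =
      ⟨φ (k + 1) ⟨mapSA (T.τ k).π₂ (y k h).1, ((T.τ k).L_map₂_le (y k h).1).trans (y k h).2⟩,
        hφl (k + 1) _⟩ := fun k h => Nat.leRec_succ _ _ h
  refine ⟨fun k h => (y k h).1, ⟨fun k h => ?_, fun k h => (y k h).2⟩, ?_⟩
  · rw [hs k h, hφ]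
  · change mapSA (T.τ n).π₁ (y n le_rfl).1 = a
    rw [hn, hφ]

variable (hF : Permissible F)

/-- The coordinates from the index `n` on. -/
def restrict (n : ℕ) : T.TailAlgebra hF 0 →⋆ₐ[ℂ] T.TailAlgebra hF n :=
  jlClosureMap (S := T.tailJL 0) (T := T.tailJL n)
    (lpPi fun k : Set.Ici n => T.tailCoord 0 k (Nat.zero_le _)) fun _ ⟨l, ha⟩ =>
      ⟨l, fun k _ => ha.compat k k.zero_le, fun k _ => ha.L_le k k.zero_le⟩

theorem coord_restrict (n k : ℕ) (h : n ≤ k) (a : T.TailAlgebra hF 0) :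
    T.coord hF n k h (T.restrict hF n a) = T.coord hF 0 k k.zero_le a := rfl

theorem mapSA_coord_restrict (n k : ℕ) (h : n ≤ k) (d : selfAdjoint (T.TailAlgebra hF 0)) :
    mapSA (T.coord hF n k h) (mapSA (T.restrict hF n) d) =
      mapSA (T.coord hF 0 k k.zero_le) d := rfl

theorem norm_restrict_antitone (a : T.TailAlgebra hF 0) :
    Antitone fun n => ‖T.restrict hF n a‖ := by
  intro n m hnm
  refine T.norm_tailAlgebra_le hF (norm_nonneg _) fun k h => ?_
  rw [coord_restrict, ← T.coord_restrict hF n k (hnm.trans h)]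
  exact NonUnitalStarAlgHom.norm_apply_le _ _

theorem ext_coord {n : ℕ} {d d' : selfAdjoint (T.TailAlgebra hF n)}
    (h : ∀ k h, mapSA (T.coord hF n k h) d = mapSA (T.coord hF n k h) d') : d = d' := by
  rw [← sub_eq_zero, ← norm_le_zero_iff]
  refine T.norm_mapSA_coord_le hF le_rfl fun k hk => ?_
  rw [map_sub, h, sub_self, norm_zero]

theorem exists_restrict_eq (n : ℕ) {d : selfAdjoint (T.TailAlgebra hF n)} {l : ℝ≥0}
    (hd : T.tailL hF n d ≤ l) :
    ∃ d', mapSA (T.restrict hF n) d' = d ∧ T.tailL hF 0 d' ≤ l := by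
  obtain ⟨z, hz, hzd⟩ := T.exists_coherent_extension n (T.coherent_coord hF hd)
  obtain ⟨d', hd'⟩ := T.exists_coord hF hz
  refine ⟨d', T.ext_coord hF fun k h => ?_, (T.tailL_le_iff hF _ _).2 fun k h => ?_⟩
  · rw [mapSA_coord_restrict, hd', hzd k h]
  · rw [hd']; exact hz.L_le k h

theorem tailL_restrict_le (n : ℕ) (d : selfAdjoint (T.TailAlgebra hF 0)) :
    T.tailL hF n (mapSA (T.restrict hF n) d) ≤ T.tailL hF 0 d := by
  refine (T.tailL_le_iff hF _ _).2 fun k h => ?_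
  rw [mapSA_coord_restrict]
  exact T.L_coord_le hF d k k.zero_le

theorem surjective_restrict (n : ℕ) : Function.Surjective (T.restrict hF n) := by
  refine surjective_of_dense _ _ (T.tailSpace hF n).dense_dom fun d hd => ?_
  obtain ⟨d', hd', -⟩ := T.exists_restrict_eq hF n (d := d) (l := (T.tailL hF n d).toNNReal)
    (ENNReal.coe_toNNReal (ne_of_lt hd)).ge
  exact ⟨d', congrArg Subtype.val hd'⟩

/-- The limit C*-algebra: the quotient by the limit of the norms of the tails. -/
theorem exists_limit_quotient :
    ∃ (B : Type u) (_ : CStarAlgebra B) (_ : Nontrivial B) (q : T.TailAlgebra hF 0 →⋆ₐ[ℂ] B),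
      Function.Surjective q ∧
      ∀ a, Tendsto (fun n => ‖T.restrict hF n a‖) atTop (𝓝 ‖q a‖) := by
  let p : T.TailAlgebra hF 0 → ℝ := fun a => ⨅ n, ‖T.restrict hF n a‖
  have hp : ∀ a, Tendsto (fun n => ‖T.restrict hF n a‖) atTop (𝓝 (p a)) := fun a =>
    tendsto_atTop_ciInf (T.norm_restrict_antitone hF a)
      ⟨0, by rintro _ ⟨n, rfl⟩; exact norm_nonneg _⟩
  obtain ⟨B, hB, q, hq, hqp⟩ := exists_quotient_of_seminorm p
    (fun a b => le_of_tendsto_of_tendsto' (hp _) ((hp a).add (hp b)) fun n => by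
      rw [map_add]; exact norm_add_le _ _)
    (fun c a => tendsto_nhds_unique (hp _) (((hp a).const_mul ‖c‖).congr fun n => by
      rw [map_smul, norm_smul]))
    (fun a b => le_of_tendsto_of_tendsto' (hp _) ((hp a).mul (hp b)) fun n => by
      rw [map_mul]; exact norm_mul_le _ _)
    (fun a => tendsto_nhds_unique (hp _) ((hp a).congr fun n => by
      rw [map_star, norm_star]))
    (fun a => tendsto_nhds_unique (hp _) (((hp a).mul (hp a)).congr fun n => by
      rw [map_mul, map_star, CStarRing.norm_star_mul_self]))
  have h1 : ‖q 1‖ = 1 := by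
    rw [hqp]
    refine tendsto_nhds_unique (hp 1) (tendsto_const_nhds.congr fun n => ?_)
    rw [map_one, CStarRing.norm_one]
  refine ⟨B, hB, ⟨q 1, 0, fun h => ?_⟩, q, hq, fun a => by rw [hqp]; exact hp a⟩
  rw [h, norm_zero] at h1
  exact zero_ne_one h1

/-- The spaces of a chain converge: the tunnel from `X n` to the limit is the space of coherent
sequences from the index `n` on. -/
theorem exists_limit (hF : Permissible F) (hc : Continuous F) :
    ∃ Y : Space.{u} F, ∀ n, propinquity (X n) Y ≤ T.t n := by
  obtain ⟨B, hB, hBn, q, hq, hlim⟩ := T.exists_limit_quotient hF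
  have hle : ∀ n a, ‖q a‖ ≤ ‖T.restrict hF n a‖ := fun n a =>
    (T.norm_restrict_antitone hF a).le_of_tendsto (hlim a) n
  let Y : Space.{u} F := quotientSpace (T.tailSpace hF 0) q hq (by
    intro i (d : selfAdjoint (T.TailAlgebra hF 0)) (e : selfAdjoint (T.TailAlgebra hF 0)) l m hd he
    have hlim' : ∀ d : selfAdjoint (T.TailAlgebra hF 0),
        Tendsto (fun n => ‖mapSA (T.restrict hF n) d‖₊) atTop (𝓝 ‖mapSA q d‖₊) := fun d =>
      NNReal.tendsto_coe.1 (hlim d)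
    have h1 : Tendsto (fun n => ((F (‖mapSA (T.restrict hF n) d‖₊, ‖mapSA (T.restrict hF n) e‖₊,
        l, m) : ℝ≥0) : ℝ≥0∞)) atTop (𝓝 (F (‖mapSA q d‖₊, ‖mapSA q e‖₊, l, m))) :=
      (ENNReal.continuous_coe.tendsto _).comp ((hc.tendsto _).comp
        ((hlim' d).prodMk_nhds ((hlim' e).prodMk_nhds tendsto_const_nhds)))
    refine ge_of_tendsto' h1 fun n => ?_
    -- The estimate for the tails from `n` on descends to the quotient: a product of tails has a lift
    -- of the same seminorm, whose image is the product because `‖q(·)‖` is at most the norm of tails.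
    have h2 : T.tailL hF n (jl i (mapSA (T.restrict hF n) d) (mapSA (T.restrict hF n) e)) ≤
        F (‖mapSA (T.restrict hF n) d‖₊, ‖mapSA (T.restrict hF n) e‖₊, l, m) :=
      (T.tailSpace hF n).L_jl_le hF i le_rfl le_rfl ((T.tailL_restrict_le hF n d).trans hd)
        ((T.tailL_restrict_le hF n e).trans he)
    obtain ⟨c, hc, hcl⟩ := T.exists_restrict_eq hF n h2
    refine (quotientL_le_iff (T.tailSpace hF 0) q _ _).2 ⟨c, ?_, hcl⟩
    rw [← mapSA_jl] at hc
    have h3 : ‖mapSA q c - mapSA q (jl i d e)‖ ≤ 0 := by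
      rw [← map_sub]
      refine (hle n _).trans_eq ?_
      change ‖mapSA (T.restrict hF n) (c - jl i d e)‖ = 0
      rw [map_sub, hc, sub_self, norm_zero]
    rw [norm_le_zero_iff, sub_eq_zero] at h3
    exact h3.trans (mapSA_jl _ _ _ _))
  have hY : ∀ (b : selfAdjoint B) (l : ℝ≥0),
      Y.L b ≤ l ↔ ∃ d, mapSA q d = b ∧ T.tailL hF 0 d ≤ l := fun b l =>
    quotientL_le_iff (T.tailSpace hF 0) q b l
  refine ⟨Y, fun n => ?_⟩
  obtain ⟨s, hs⟩ := exists_factor (T.restrict hF n) (T.surjective_restrict hF n) q (hle n)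
  have hs' : ∀ d, mapSA s (mapSA (T.restrict hF n) d) = mapSA q d := fun d => Subtype.ext (hs d)
  have lift₁ : ∀ (a : selfAdjoint (X n).carrier) (l : ℝ≥0), (X n).L a ≤ l →
      ∃ d, mapSA ((T.τ n).π₁.comp (T.coord hF n n le_rfl)) d = a ∧ T.tailL hF n d ≤ l := by
    intro a l ha
    obtain ⟨y, hy, hya⟩ := T.exists_coherent n ha
    obtain ⟨d, hd⟩ := T.exists_coord hF hy
    refine ⟨d, ?_, (T.tailL_le_iff hF _ _).2 fun k h => ?_⟩
    · rw [← hya, ← hd]; rfl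
    · rw [hd]; exact hy.L_le k h
  have surj₁ : Function.Surjective ((T.τ n).π₁.comp (T.coord hF n n le_rfl)) := by
    refine surjective_of_dense _ _ (X n).dense_dom fun a ha => ?_
    obtain ⟨d, hd, -⟩ := lift₁ a ((X n).L a).toNNReal (by
      rw [ENNReal.coe_toNNReal (ne_of_lt ha)])
    exact ⟨d, congrArg Subtype.val hd⟩
  have surj₂ : Function.Surjective s := fun b => by
    obtain ⟨a, rfl⟩ := hq b
    exact ⟨T.restrict hF n a, hs a⟩
  have hle₂ : ∀ d, Y.L (mapSA s d) ≤ T.tailL hF n d := fun d => by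
    by_cases h : T.tailL hF n d = ⊤
    · rw [h]; exact le_top
    rw [← ENNReal.coe_toNNReal h]
    obtain ⟨d', hd, hd'⟩ := T.exists_restrict_eq hF n (ENNReal.coe_toNNReal h).ge
    exact (hY _ _).2 ⟨d', by rw [← hs', hd], hd'⟩
  let σ : Tunnel (X n) Y := Tunnel.ofLifts (T.tailSpace hF n)
    ((T.τ n).π₁.comp (T.coord hF n n le_rfl)) s surj₁ surj₂
    (fun d => ((T.τ n).L_map₁_le _).trans (T.L_coord_le hF d n le_rfl)) hle₂ lift₁
    (fun b l hb => by
      obtain ⟨d, hd, hdl⟩ := (hY b l).1 hb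
      exact ⟨mapSA (T.restrict hF n) d, (hs' d).trans hd, (T.tailL_restrict_le hF n d).trans hdl⟩)
  have left : ∀ (d : selfAdjoint (T.TailAlgebra hF n)) (l : ℝ≥0), T.tailL hF n d ≤ l →
      ‖d‖ ≤ ‖mapSA ((T.τ n).π₁.comp (T.coord hF n n le_rfl)) d‖ + T.t n * l := by
    intro d l hd
    have hco := T.coherent_coord hF hd
    refine T.norm_mapSA_coord_le hF (by positivity) fun k h => ?_
    have h1 := hco.norm_le_of_le le_rfl h
    have h2 := (T.extentLE n).left _ l (hco.L_le n le_rfl)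
    have h3 : (T.e n : ℝ) + T.t (n + 1) ≤ T.t n := T.add_le n
    have h4 := mul_le_mul_of_nonneg_right h3 l.2
    change _ ≤ ‖mapSA (T.τ n).π₁ (mapSA (T.coord hF n n le_rfl) d)‖ + T.t n * l
    nlinarith
  have right : ∀ (d : selfAdjoint (T.TailAlgebra hF n)) (l : ℝ≥0), T.tailL hF n d ≤ l →
      ‖d‖ ≤ ‖mapSA s d‖ + T.t n * l := by
    intro d l hd
    have hco := T.coherent_coord hF hd
    obtain ⟨d', rfl, -⟩ := T.exists_restrict_eq hF n hd
    rw [hs']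
    refine T.norm_mapSA_coord_le hF (by positivity) fun k h => ?_
    -- The norm of `q d'` is the limit of the norms of the tails, which bound those of their first terms.
    refine ge_of_tendsto ((hlim d').add_const _) ?_
    filter_upwards [eventually_ge_atTop k] with m hm
    have h1 := hco.norm_le_of_ge h hm
    have h2 : ‖mapSA (T.coord hF n m (h.trans hm)) (mapSA (T.restrict hF n) d')‖ ≤
        ‖T.restrict hF m d'‖ :=
      NonUnitalStarAlgHom.norm_apply_le (T.coord hF m m le_rfl) (T.restrict hF m d')
    have h3 : (T.t k : ℝ) * l ≤ T.t n * l :=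
      mul_le_mul_of_nonneg_right (by exact_mod_cast T.antitone h) l.2
    linarith
  exact propinquity_le σ ⟨left, right⟩

end Chain

end

end QuasiLeibniz

namespace QuasiLeibniz

noncomputable section

open Filter Topology

variable {F : ℝ≥0 × ℝ≥0 × ℝ≥0 × ℝ≥0 → ℝ≥0}

/-! ### The class of all spaces as a complete pseudometric space -/

/-- The pseudometric of the dual propinquity, with the topology that it induces. -/
abbrev propinquityEMetric (hF : Permissible F) : PseudoEMetricSpace (Space.{u} F) :=
  let u : UniformSpace (Space.{u} F) :=
    uniformSpaceOfEDist propinquity propinquity_self propinquity_comm (propinquity_triangle hF)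
  { edist := propinquity
    edist_self := propinquity_self
    edist_comm := propinquity_comm
    edist_triangle := propinquity_triangle hF
    toUniformSpace := u.replaceTopology (i := instTopologicalSpaceSpace) (by
      let m : PseudoEMetricSpace (Space.{u} F) :=
        { edist := propinquity
          edist_self := propinquity_self
          edist_comm := propinquity_comm
          edist_triangle := propinquity_triangle hF }
      ext U
      rw [EMetric.isOpen_iff]
      refine forall₂_congr fun x _ => exists_congr fun ε => and_congr_right fun _ => ?_
      refine forall_congr' fun y => ?_
      rw [Metric.mem_eball, edist_comm]
      rfl)
    uniformity_edist := rfl }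

/-- Cauchy sequences with distances less than `2 ^ (-n)` are chains of tunnels. -/
theorem completeSpace_propinquity (hF : StronglyPermissible F) :
    @CompleteSpace (Space.{u} F) (propinquityEMetric hF.toPermissible).toUniformSpace := by
  let _ := propinquityEMetric (F := F) hF.toPermissible
  let e : ℕ → ℝ≥0 := fun n => (1 / 2) ^ n
  refine EMetric.complete_of_convergent_controlled_sequences (fun n => (e n : ℝ≥0∞))
    (fun n => by exact_mod_cast (show 0 < e n by positivity)) fun X hX => ?_
  choose τ hτ using fun n => exists_tunnel (hX n n (n + 1) le_rfl n.le_succ)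
  have ht : Tendsto (fun n => 2 * e n) atTop (𝓝 0) := by
    have := (tendsto_pow_atTop_nhds_zero_of_lt_one (r := (1 / 2 : ℝ≥0)) zero_le
      (by norm_num)).const_mul 2
    rwa [mul_zero] at this
  let T : Chain X := ⟨τ, e, fun n => 2 * e n, hτ, fun n => by
    simp only [e, pow_succ]; apply le_of_eq; ring, ht⟩
  obtain ⟨Y, hY⟩ := T.exists_limit hF.toPermissible hF.continuous
  refine ⟨Y, tendsto_iff_edist_tendsto_0.2 ?_⟩
  refine tendsto_of_tendsto_of_tendsto_of_le_of_le tendsto_const_nhds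
    (ENNReal.tendsto_coe.2 ht) (fun n => zero_le) hY

/-! ### Compact classes -/

theorem exists_of_coveringNumber_le {X : Space.{u} F} {ε : ℝ} {N : ℕ}
    (h : coveringNumber X ε ≤ N) :
    ∃ Y : Space.{u} F, Module.rank ℂ Y.carrier ≤ N ∧ propinquity X Y ≤ ENNReal.ofReal ε := by
  have h1 : coveringNumber X ε < ((N + 1 : ℕ) : ℕ∞) := by
    refine h.trans_lt ?_
    exact_mod_cast N.lt_succ_self
  obtain ⟨n, ⟨Y, hY, hXY⟩, hn⟩ : ∃ (n : ℕ) (_ : ∃ Y : Space.{u} F, Module.rank ℂ Y.carrier ≤ n ∧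
      propinquity X Y ≤ ENNReal.ofReal ε), (n : ℕ∞) < ((N + 1 : ℕ) : ℕ∞) := by
    simpa only [coveringNumber, iInf_lt_iff] using h1
  refine ⟨Y, hY.trans ?_, hXY⟩
  have h2 : n < N + 1 := by exact_mod_cast hn
  exact_mod_cast Nat.lt_succ_iff.1 h2

/-- The members of the class are close to spaces of bounded dimension, whose diameters are bounded as
well, and these fall in finitely many small classes. -/
theorem totallyBounded_of_coveringNumber (hF : Permissible F) (𝒜 : Set (Space.{u} F))
    (f : Set.Ioi (0 : ℝ) → ℕ) (K : ℝ) (hK : ∀ X ∈ 𝒜, X.diam ≤ ENNReal.ofReal K)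
    (hf : ∀ X ∈ 𝒜, ∀ ε : Set.Ioi (0 : ℝ), coveringNumber X ε ≤ f ε) :
    @TotallyBounded _ (propinquityEMetric hF).toUniformSpace 𝒜 := by
  let _ := propinquityEMetric (F := F) hF
  refine EMetric.totallyBounded_iff.2 fun ε hε => ?_
  obtain ⟨ε', hε0, hεε'⟩ := ENNReal.lt_iff_exists_nnreal_btwn.1 hε
  have hε' : 0 < ε' := by exact_mod_cast hε0
  let δ : ℝ≥0 := ε' / 3
  have hδ : 0 < δ := by positivity
  let K' : ℝ≥0 := K.toNNReal + 2 * (2 * δ)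
  obtain ⟨C, hC, P, hP, hPP⟩ := exists_finite_code hF (f ⟨δ, hδ⟩) K' δ hδ
  have approx : ∀ X ∈ 𝒜, ∃ (Y : Space.{u} F) (c : C), Y.diam ≤ K' ∧ P Y c ∧
      propinquity X Y ≤ δ := by
    intro X hX
    obtain ⟨Y, hY, hXY⟩ := exists_of_coveringNumber_le (hf X hX ⟨δ, hδ⟩)
    rw [ENNReal.ofReal_coe_nnreal] at hXY
    have hd : Y.diam ≤ K' := by
      have h1 : propinquity Y X < (2 * δ : ℝ≥0) := by
        rw [propinquity_comm]
        refine hXY.trans_lt ?_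
        exact_mod_cast (by linarith [NNReal.coe_pos.2 hδ] : δ < 2 * δ)
      refine (diam_le_add h1).trans ?_
      simp only [K']
      push_cast
      gcongr
      exact hK X hX
    obtain ⟨c, hc⟩ := hP Y hY hd
    exact ⟨Y, c, hd, hc, hXY⟩
  let Q : Space.{u} F → C → Prop := fun X c => ∃ Y : Space.{u} F, Y.diam ≤ K' ∧ P Y c ∧
    propinquity X Y ≤ δ
  -- One space for each class that is close to some space gives a finite net.
  choose σ hσ using fun c : {c : C // ∃ X, Q X c} => c.2
  refine ⟨Set.range σ, Set.finite_range σ, fun X hX => ?_⟩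
  obtain ⟨Y, c, hd, hc, hXY⟩ := approx X hX
  obtain ⟨Y', hd', hc', hXY'⟩ := hσ ⟨c, X, Y, hd, hc, hXY⟩
  set Z := σ ⟨c, X, Y, hd, hc, hXY⟩
  refine Set.mem_iUnion₂.2 ⟨Z, ⟨_, rfl⟩, ?_⟩
  rw [Metric.mem_eball]
  calc propinquity X Z ≤ propinquity X Y + propinquity Y Z := propinquity_triangle hF _ _ _
    _ ≤ propinquity X Y + (propinquity Y Y' + propinquity Y' Z) := by
        gcongr; exact propinquity_triangle hF _ _ _
    _ ≤ δ + (δ + δ) := by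
        rw [propinquity_comm Y' Z]
        exact add_le_add hXY (add_le_add (hPP Y Y' c hd hd' hc hc') hXY')
    _ = ε' := by
        have : δ + (δ + δ) = ε' := by simp only [δ]; ring
        exact_mod_cast this
    _ < ε := hεε'

theorem isometryHull_subset_closure (hF : Permissible F) (𝒜 : Set (Space.{u} F)) :
    isometryHull 𝒜 ⊆ closure 𝒜 := by
  let _ := propinquityEMetric (F := F) hF
  rintro X ⟨Y, hY, hYX⟩
  refine EMetric.mem_closure_iff.2 fun ε hε => ⟨Y, hY, ?_⟩
  change propinquity X Y < ε
  rwa [propinquity_comm, hYX.propinquity_eq_zero]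

theorem subset_isometryHull (𝒜 : Set (Space.{u} F)) : 𝒜 ⊆ isometryHull 𝒜 := fun X hX =>
  ⟨X, hX, isometric_of_equiv (StarAlgEquiv.refl (R := ℂ) (A := X.carrier)) fun _ => rfl⟩

/-- In the closure of a compact class, every space is at distance zero from a member. -/
theorem isClosed_isometryHull (hF : Permissible F) {𝒜 : Set (Space.{u} F)} (h : IsCompact 𝒜) :
    IsClosed (isometryHull 𝒜) := by
  let _ := propinquityEMetric (F := F) hF
  rw [← closure_subset_iff_isClosed]
  intro X hX
  have hX' : X ∈ closure 𝒜 :=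
    closure_minimal (isometryHull_subset_closure hF 𝒜) isClosed_closure hX
  obtain ⟨Y, hY, hYX⟩ := h.mem_closure_iff_exists_inseparable.1 hX'
  exact ⟨Y, hY, isometric_of_propinquity_eq_zero hF (EMetric.inseparable_iff.1 hYX)⟩

/-- The diameter is bounded on a finite net, and it is Lipschitz. -/
theorem exists_diam_le (hF : Permissible F) {𝒜 : Set (Space.{u} F)} (h : IsCompact 𝒜) :
    ∃ K : ℝ, 0 < K ∧ ∀ X ∈ 𝒜, X.diam ≤ ENNReal.ofReal K := by
  let _ := propinquityEMetric (F := F) hF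
  obtain ⟨S, hS, hSfin, hcov⟩ := EMetric.totallyBounded_iff'.1 h.totallyBounded 1 one_pos
  obtain ⟨M, hM⟩ : ∃ M : ℝ≥0, ∀ X ∈ S, X.diam.toNNReal ≤ M :=
    (hSfin.image fun X => X.diam.toNNReal).bddAbove.imp fun M hM X hX => hM ⟨X, hX, rfl⟩
  refine ⟨M + 2, by positivity, fun X hX => ?_⟩
  obtain ⟨Y, hY, hXY⟩ := Set.mem_iUnion₂.1 (hcov hX)
  have h1 : propinquity X Y < (1 : ℝ≥0) := by
    rw [ENNReal.coe_one]; exact hXY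
  refine (diam_le_add h1).trans ?_
  have h2 : Y.diam ≤ M := by
    rw [← ENNReal.coe_toNNReal Y.diam_lt_top.ne]
    exact_mod_cast hM Y hY
  have h3 : ENNReal.ofReal ((M : ℝ) + 2) = M + 2 := by
    rw [ENNReal.ofReal_add (p := (M : ℝ)) (q := 2) M.2 zero_le_two, ENNReal.ofReal_coe_nnreal,
      ENNReal.ofReal_ofNat]
  rw [h3]
  simpa using h2

theorem exists_coveringNumber_le (hF : Permissible F) {𝒜 : Set (Space.{u} F)} (h : IsCompact 𝒜)
    (h𝒜 : 𝒜 ⊆ closure (finiteDimensionalSpaces F)) (ε : ℝ) (hε : 0 < ε) :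
    ∃ N : ℕ, ∀ X ∈ 𝒜, coveringNumber X ε ≤ N := by
  let _ := propinquityEMetric (F := F) hF
  have hε2 : 0 < ENNReal.ofReal (ε / 2) := ENNReal.ofReal_pos.2 (half_pos hε)
  obtain ⟨S, hS, hSfin, hcov⟩ := EMetric.totallyBounded_iff'.1 h.totallyBounded _ hε2
  have hfd : ∀ X ∈ S, ∃ (N : ℕ) (Y : Space.{u} F), Module.rank ℂ Y.carrier ≤ N ∧
      propinquity X Y < ENNReal.ofReal (ε / 2) := by
    intro X hX
    obtain ⟨Y, hY, hXY⟩ := EMetric.mem_closure_iff.1 (h𝒜 (hS hX)) _ hε2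
    have : FiniteDimensional ℂ Y.carrier := hY
    exact ⟨Module.finrank ℂ Y.carrier, Y, (Module.finrank_eq_rank ℂ Y.carrier).ge, hXY⟩
  choose! ν Y hν hY using hfd
  obtain ⟨M, hM⟩ : ∃ M : ℕ, ∀ X ∈ S, ν X ≤ M :=
    (hSfin.image ν).bddAbove.imp fun M hM X hX => hM ⟨X, hX, rfl⟩
  refine ⟨M, fun X hX => ?_⟩
  obtain ⟨Z, hZ, hXZ⟩ := Set.mem_iUnion₂.1 (hcov hX)
  have h1 : propinquity X Z < ENNReal.ofReal (ε / 2) := hXZ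
  refine (iInf₂_le (ν Z) ⟨Y Z, hν Z hZ, ?_⟩).trans (by exact_mod_cast hM Z hZ)
  refine (propinquity_triangle hF X Z (Y Z)).trans ((add_le_add h1.le (hY Z hZ).le).trans ?_)
  rw [← ENNReal.ofReal_add (half_pos hε).le (half_pos hε).le, add_halves]

/-- Compactness does not see points at distance zero. -/
theorem isCompact_of_isCompact_isometryHull (hF : Permissible F) {𝒜 : Set (Space.{u} F)}
    (h : IsCompact (isometryHull 𝒜)) : IsCompact 𝒜 := by
  let _ := propinquityEMetric (F := F) hF
  intro f hf hf𝒜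
  obtain ⟨X, ⟨Y, hY, hYX⟩, hX⟩ :=
    h (hf𝒜.trans (principal_mono.2 (subset_isometryHull 𝒜)))
  refine ⟨Y, hY, ?_⟩
  have : Inseparable Y X := EMetric.inseparable_iff.2 hYX.propinquity_eq_zero
  rw [ClusterPt, this.nhds_eq]
  exact hX

end

end QuasiLeibniz

theorem mainTheorem2 (F : ℝ≥0 × ℝ≥0 × ℝ≥0 × ℝ≥0 → ℝ≥0)
    (hF : QuasiLeibniz.StronglyPermissible F) (𝒜 : Set (QuasiLeibniz.Space.{u} F))
    (h𝒜 : 𝒜 ⊆ closure (QuasiLeibniz.finiteDimensionalSpaces F)) :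
    IsCompact 𝒜 ↔
      ∃ (f : Set.Ioi (0 : ℝ) → ℕ) (K : ℝ), 0 < K ∧
        (∀ X ∈ 𝒜, X.diam ≤ ENNReal.ofReal K) ∧
        (∀ X ∈ 𝒜, ∀ ε : Set.Ioi (0 : ℝ), QuasiLeibniz.coveringNumber X ε ≤ f ε) ∧
        IsClosed (QuasiLeibniz.isometryHull 𝒜) := by
  constructor
  · intro h
    obtain ⟨K, hK0, hK⟩ := QuasiLeibniz.exists_diam_le hF.toPermissible h
    choose f hf using fun ε : Set.Ioi (0 : ℝ) =>
      QuasiLeibniz.exists_coveringNumber_le hF.toPermissible h h𝒜 ε ε.2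
    exact ⟨f, K, hK0, hK, fun X hX ε => hf ε X hX,
      QuasiLeibniz.isClosed_isometryHull hF.toPermissible h⟩
  · rintro ⟨f, K, -, hK, hf, hcl⟩
    let _ := QuasiLeibniz.propinquityEMetric (F := F) hF.toPermissible
    have _ := QuasiLeibniz.completeSpace_propinquity hF
    have htb := QuasiLeibniz.totallyBounded_of_coveringNumber hF.toPermissible 𝒜 f K hK hf
    refine QuasiLeibniz.isCompact_of_isCompact_isometryHull hF.toPermissible ?_
    exact isCompact_iff_totallyBounded_isComplete.2 ⟨htb.closure.subset
      (QuasiLeibniz.isometryHull_subset_closure hF.toPermissible 𝒜), hcl.isComplete⟩
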